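/- Let $k \ge 2$. For a commutative ring $A$, a symmetric $k$-variable (additive) $2$-cocycle over $A$ is a symmetric polynomial $f \in A[x_1,\dots,x_k]$ with $$f(x_1,x_2,x_3,\dots,x_k) - f(x_0+x_1,x_2,x_3,\dots,x_k) + f(x_0,x_1+x_2,x_3,\dots,x_k) - f(x_0,x_1,x_3,\dots,x_k) = 0;$$ a symmetric $2$-cocycle power series is an $f\in A[[x_1,\dots,x_k]]$ with the same properties. For $n \ge k$ let $$\zeta_k^n = d^{-1}\sum_{\emptyset\neq I\subseteq\{1,\dots,k\}} (-1)^{|I|}\Bigl(\sum_{i\in I}x_i\Bigr)^n \in \mathbb{Z}[x_1,\dots,x_k],$$ where $d$ is the greatest common divisor of the coefficients of the sum. For a prime $p$, a nonzero symmetric $2$-cocycle over $\mathbb{F}_p=\mathbb{Z}/p\mathbb{Z}$, homogeneous of degree $n$, is called indecomposable if it is not the sum of two nonzero such cocycles that lie in the spans of complementary subsets of the basis of monomial symmetric polynomials. Theorem. For every $n\ge k$ and every prime $p$ the $\mathbb{F}_p$-space of symmetric $k$-variable $2$-cocycles over $\mathbb{F}_p$, homogeneous of degree $n$, is nonzero and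 has a finite basis consisting of indecomposable cocycles and containing each indecomposable cocycle up to a scalar. Choose for all $n\ge k$ and $p$ such a basis $\beta_{n,p,0},\dots,\beta_{n,p,l_{n,p}}$, listed in any order, and put $$L_k^n = \mathbb{Z}[b_n]\otimes_{\mathbb{Z}}\bigotimes_{\substack{p \text{ prime}\\ 1\le i\le l_{n,p}}} \mathbb{Z}[c_{n,p,i}]/(p\,c_{n,p,i}),\qquad L_k=\bigotimes_{n\ge k}L_k^n$$ (tensor products over $\mathbb{Z}$; an infinite tensor product is the direct limit of the finite ones). Then: 1. For each $n \ge k$ only finitely many pairs $(p,i)$ with $1\le i\le l_{n,p}$ occur, and $L_k^n$ represents the functor sending a commutative ring $A$ to the set of symmetric $k$-variable $2$-cocycles over $A$ that are homogeneous of degree $n$. The universal cocycle is $$u_n = b_n\,\zeta_k^n+\sum_{p}\sum_{i=1}^{l_{n,p}}c_{n,p,i}\,\beta_{n,p,i}$$ (well defined, since $p\,c_{n,p,i}=0$): for every such cocycle $f$ over $A$ there is exactly one ring homomorphism $L_k^n\to A$ that sends $u_n$ to $f$. 2. $L_k$ represents the functor sending a commutative ring $A$ to the set of symmetric $k$-variable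 $2$-cocycle power series over $A$ without constant term (polynomial cocycles without constant term being a special case), with universal cocycle $\sum_{n\ge k}u_n$. 3. For $k=2$ all $l_{n,p}$ are $0$, and $L_2\cong\mathbb{Z}[b_2,b_3,b_4,\dots]$ by an isomorphism that sends each $b_n$ to $b_n$. -/

import Mathlib

open scoped TensorProduct

universe u

noncomputable section

namespace Cocycle

/-! ### Symmetric additive 2-cocycles in `k` variables -/

section Cocycles

variable (k : ℕ) (A : Type*) [CommRing A]

/-- The four substitutions occurring in the 2-coboundary.  The variable of index `j : Fin k` is
`x_{j+1}`, and the variable of index `j : Fin (k+1)` is `x_j`; the four lists of arguments are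
`(x_1, x_2, …, x_k)`, `(x_0 + x_1, x_2, …, x_k)`, `(x_0, x_1 + x_2, x_3, …, x_k)` and
`(x_0, x_1, x_3, …, x_k)`. -/
def face : Fin 4 → Fin k → MvPolynomial (Fin (k + 1)) A
  | 0 => fun j => MvPolynomial.X j.succ
  | 1 => fun j =>
      if (j : ℕ) = 0 then MvPolynomial.X j.castSucc + MvPolynomial.X j.succ
      else MvPolynomial.X j.succ
  | 2 => fun j =>
      if (j : ℕ) = 0 then MvPolynomial.X j.castSucc
      else if (j : ℕ) = 1 then MvPolynomial.X j.castSucc + MvPolynomial.X j.succ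
      else MvPolynomial.X j.succ
  | 3 => fun j =>
      if (j : ℕ) < 2 then MvPolynomial.X j.castSucc else MvPolynomial.X j.succ

/-- The 2-coboundary `δ₂ f = f(x_1, x_2, …) - f(x_0 + x_1, x_2, …) + f(x_0, x_1 + x_2, …)
- f(x_0, x_1, x_3, …)` of a polynomial in `k` variables (used for `2 ≤ k`). -/
def coboundary : MvPolynomial (Fin k) A →ₗ[A] MvPolynomial (Fin (k + 1)) A :=
  ∑ i : Fin 4, ((-1 : A) ^ (i : ℕ)) • (MvPolynomial.aeval (face k A i)).toLinearMap

/-- Symmetric `k`-variable 2-cocycles over `A`, homogeneous of degree `n`. -/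
def cocycles (n : ℕ) : Submodule A (MvPolynomial (Fin k) A) :=
  MvPolynomial.homogeneousSubmodule (Fin k) A n ⊓
    Subalgebra.toSubmodule (MvPolynomial.symmetricSubalgebra (Fin k) A) ⊓
    LinearMap.ker (coboundary k A)

/-- Symmetric `k`-variable 2-cocycle power series over `A` without constant term. -/
structure IsSeriesCocycle (f : MvPowerSeries (Fin k) A) : Prop where
  constantCoeff : MvPowerSeries.constantCoeff f = 0
  symm : ∀ σ : Equiv.Perm (Fin k), MvPowerSeries.renameEquiv A σ f = f
  cocycle : ∑ i : Fin 4, ((-1 : A) ^ (i : ℕ)) •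
    MvPowerSeries.subst
      (fun j => (face k A i j : MvPowerSeries (Fin (k + 1)) A)) f = 0

end Cocycles

/-! ### The integral cocycles `ζ` -/

/-- `∑_{∅ ≠ I ⊆ {1, …, k}} (-1)^{|I|} (∑_{i ∈ I} x_i) ^ n`. -/
def zetaRaw (k n : ℕ) : MvPolynomial (Fin k) ℤ :=
  ∑ I ∈ (Finset.univ : Finset (Finset (Fin k))).filter Finset.Nonempty,
    (-1) ^ I.card * (∑ i ∈ I, MvPolynomial.X i) ^ n

/-- The greatest common divisor of the coefficients of an integral polynomial. -/
def coeffGcd {σ : Type*} (f : MvPolynomial σ ℤ) : ℤ :=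
  f.support.gcd fun s => f.coeff s

/-- `ζ_k^n`: the polynomial `zetaRaw k n` divided by the gcd of its coefficients. -/
def zeta (k n : ℕ) : MvPolynomial (Fin k) ℤ :=
  ∑ s ∈ (zetaRaw k n).support,
    MvPolynomial.monomial s ((zetaRaw k n).coeff s / coeffGcd (zetaRaw k n))

/-! ### Indecomposable cocycles -/

section Indecomposable

variable (k n : ℕ) {K : Type*} [CommRing K]

/-- The span of the symmetrized monomials attached to the partitions in `S`.  The polynomials
`msymm μ`, for `μ` a partition of `n` (with at most `k` parts, the others giving `0`), form the
monomial basis of the symmetric polynomials of degree `n` in `k` variables. -/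
def monomialSpan (K : Type*) [CommRing K] (S : Set n.Partition) :
    Submodule K (MvPolynomial (Fin k) K) :=
  Submodule.span K ((fun μ => MvPolynomial.msymm (Fin k) K μ) '' S)

/-- A nonzero cocycle is indecomposable if it is not the sum of two nonzero cocycles that lie in
the spans of complementary parts of the monomial basis. -/
def IsIndecomposable (f : MvPolynomial (Fin k) K) : Prop :=
  f ∈ cocycles k K n ∧ f ≠ 0 ∧
    ¬ ∃ (S : Set n.Partition) (f₁ f₂ : MvPolynomial (Fin k) K),
      f₁ ∈ cocycles k K n ∧ f₂ ∈ cocycles k K n ∧ f₁ ≠ 0 ∧ f₂ ≠ 0 ∧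
      f₁ ∈ monomialSpan k n K S ∧ f₂ ∈ monomialSpan k n K Sᶜ ∧ f₁ + f₂ = f

/-- `β` lists the indecomposable cocycles up to scalars, and is a basis of the cocycles. -/
structure IsIndecomposableBasis {ι : Type*} (β : ι → MvPolynomial (Fin k) K) : Prop where
  indecomposable : ∀ i, IsIndecomposable k n (β i)
  complete : ∀ f, IsIndecomposable k n f → ∃ (i : ι) (c : K), f = c • β i
  linearIndependent : LinearIndependent K β
  span_eq : Submodule.span K (Set.range β) = cocycles k K n

end Indecomposable

/-! ### Tensor products of arbitrary families of commutative rings -/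

section RingTensor

variable {ι : Type*} (R : ι → Type*) [∀ i, CommRing (R i)]

/-- The tensor product over `ℤ` of the rings `R i`, for `i` in a finite set `s`. -/
def FinTensor (s : Finset ι) : Type _ := ⨂[ℤ] i : s, R i

instance (s : Finset ι) : CommRing (FinTensor R s) :=
  inferInstanceAs (CommRing (⨂[ℤ] i : s, R i))

open Classical in
/-- The map `a ↦ 1 ⊗ ⋯ ⊗ a ⊗ ⋯ ⊗ 1` of a factor into the tensor product. -/
def FinTensor.of (s : Finset ι) (i : s) : R i →+* FinTensor R s :=
  (PiTensorProduct.singleAlgHom (R := ℤ) (A := fun i : s => R i) i).toRingHom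

/-- The map `⨂ a_i ↦ ∏ g_i(a_i)` induced by ring homomorphisms `g_i : R i → A`. -/
def FinTensor.lift (s : Finset ι) {A : Type*} [CommRing A] (g : ∀ i : s, R i →+* A) :
    FinTensor R s →+* A :=
  (PiTensorProduct.liftAlgHom (R := ℤ) (A := fun i : s => R i)
    ((MultilinearMap.mkPiAlgebra ℤ s A).compLinearMap fun i => (g i).toIntAlgHom.toLinearMap)
    (by simp) (fun x y => by simp [Finset.prod_mul_distrib])).toRingHom

/-- The map `⨂_{i ∈ s} R i → ⨂_{i ∈ t} R i` for `s ⊆ t`, which puts `1` into the new factors. -/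
def FinTensor.trans (s t : Finset ι) (h : s ≤ t) : FinTensor R s →+* FinTensor R t :=
  FinTensor.lift R s fun i => FinTensor.of R t ⟨i, h i.2⟩

/-- The tensor product over `ℤ` of an arbitrary family of commutative rings: the direct limit of
the tensor products over the finite subfamilies. -/
def RingTensor : Type _ :=
  Ring.DirectLimit (FinTensor R) fun s t h => FinTensor.trans R s t h

instance : CommRing (RingTensor R) :=
  inferInstanceAs (CommRing (Ring.DirectLimit (FinTensor R) fun s t h => FinTensor.trans R s t h))

/-- The canonical map of a factor into the tensor product. -/
def RingTensor.of (i : ι) : R i →+* RingTensor R :=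
  (Ring.DirectLimit.of (FinTensor R) (fun s t h => FinTensor.trans R s t h) {i}).comp
    (FinTensor.of R {i} ⟨i, Finset.mem_singleton_self i⟩)

end RingTensor

/-! ### The rings `L_k^n` and `L_k` -/

/-- `ℤ[c] / (p c)`. -/
abbrev TorsionFactor (p : ℕ) : Type :=
  Polynomial ℤ ⧸ Ideal.span {(Polynomial.C (p : ℤ) * Polynomial.X : Polynomial ℤ)}

/-- `ℤ[b] ⊗ ⨂_{p, i} ℤ[c_{p,i}] / (p c_{p,i})`, with `l p` factors for the prime `p`. -/
abbrev DegreeRing (l : Nat.Primes → ℕ) : Type :=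
  Polynomial ℤ ⊗[ℤ] RingTensor fun j : Σ p : Nat.Primes, Fin (l p) => TorsionFactor j.1

/-- The generator `b` of `DegreeRing l`. -/
def DegreeRing.b (l : Nat.Primes → ℕ) : DegreeRing l :=
  Polynomial.X ⊗ₜ[ℤ] 1

/-- The generator `c_{p,i}` of `DegreeRing l`. -/
def DegreeRing.c (l : Nat.Primes → ℕ) (j : Σ p : Nat.Primes, Fin (l p)) : DegreeRing l :=
  1 ⊗ₜ[ℤ] RingTensor.of (fun j : Σ p : Nat.Primes, Fin (l p) => TorsionFactor j.1) j
    (Ideal.Quotient.mk _ Polynomial.X)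

/-- The product `c · f` of an element `c` with `p c = 0` and a polynomial `f` over `ℤ/p`: lift the
coefficients of `f` to `ℕ` (the choice of the lifts does not matter) and multiply by `c`. -/
def torsionMul {σ : Type*} {L : Type*} [CommRing L] {p : ℕ} (c : L)
    (f : MvPolynomial σ (ZMod p)) : MvPolynomial σ L :=
  ∑ s ∈ f.support, MvPolynomial.monomial s ((f.coeff s).val • c)

/-- The cocycle `b ζ_k^n + ∑_{p, i ≥ 1} c_{p,i} β_{p,i}` over `DegreeRing l`.  For each prime `p`
the cocycle `β p 0` does not occur. -/
def univCocycle (k n : ℕ) (l : Nat.Primes → ℕ)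
    (β : ∀ p : Nat.Primes, Fin (l p + 1) → MvPolynomial (Fin k) (ZMod p)) :
    MvPolynomial (Fin k) (DegreeRing l) :=
  MvPolynomial.C (DegreeRing.b l) * MvPolynomial.map (Int.castRingHom (DegreeRing l)) (zeta k n) +
    ∑ᶠ j : Σ p : Nat.Primes, Fin (l p), torsionMul (DegreeRing.c l j) (β j.1 j.2.succ)

/-- `L_k`: the tensor product of the rings of all degrees `n ≥ k`. -/
abbrev LazardRing (k : ℕ) (l : {n : ℕ // k ≤ n} → Nat.Primes → ℕ) : Type :=
  RingTensor fun n : {n : ℕ // k ≤ n} => DegreeRing (l n)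

/-- The power series over `L_k` that is the sum of the homogeneous polynomials `u n`, each with
coefficients in the factor of degree `n` (in degrees below `k` it has no terms). -/
def univSeries (k : ℕ) (l : {n : ℕ // k ≤ n} → Nat.Primes → ℕ)
    (u : ∀ n : {n : ℕ // k ≤ n}, MvPolynomial (Fin k) (DegreeRing (l n))) :
    MvPowerSeries (Fin k) (LazardRing k l) := fun s =>
  if h : k ≤ s.degree then
    RingTensor.of (fun n : {n : ℕ // k ≤ n} => DegreeRing (l n)) ⟨s.degree, h⟩
      ((u ⟨s.degree, h⟩).coeff s)
  else 0

/-! ### Representability -/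

/-- `(L, f)` represents the functor sending a commutative ring `A` to the symmetric `k`-variable
2-cocycles over `A` that are homogeneous of degree `n`. -/
def IsUniversalCocycle (k n : ℕ) (L : Type) [CommRing L] (f : MvPolynomial (Fin k) L) : Prop :=
  f ∈ cocycles k L n ∧
    ∀ (A : Type u) [CommRing A], ∀ g ∈ cocycles k A n,
      ∃! φ : L →+* A, MvPolynomial.map φ f = g

/-- `(L, f)` represents the functor sending a commutative ring `A` to the symmetric `k`-variable
2-cocycle power series over `A` without constant term. -/
def IsUniversalSeriesCocycle (k : ℕ) (L : Type) [CommRing L] (f : MvPowerSeries (Fin k) L) :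
    Prop :=
  IsSeriesCocycle k L f ∧
    ∀ (A : Type u) [CommRing A], ∀ g : MvPowerSeries (Fin k) A, IsSeriesCocycle k A g →
      ∃! φ : L →+* A, MvPowerSeries.map φ f = g

end Cocycle

end

/-! A symmetric polynomial of degree `n` is a function `c` on partitions. Comparing coefficients,
the cocycle condition says that `c` vanishes on exponents with a zero entry and that `(a+b choose a)
c(a+b, d, R) = (b+d choose b) c(a, b+d, R)` for positive `a, b, d` and positive entries of `R`
(`mem_cocycles_iff`, `IsPartitionCocycle`). Write `F(s)` for the product of the factorials of the
parts of `s`. The relation says that `F(s) c(s)` is the same at both ends of an edge, even after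
cancelling any common divisor `D` of `F(a, b, d, R)`. Rationally `c` is therefore proportional to
`1/F`, which is `ζ` up to a scalar; the work lies in the torsion.

Fix a prime `p`. If `X` has more than `k` elements and `D` divides `F(X)`, then `(F(s)/D) c(s)` is
the same for all `s` obtained by grouping `X` into `k` blocks (`scaled_eq_of_isGrouping`). This is
applied to multisets `X` of powers of `p`. Base-`p` expansion of its parts shows that every `s` is a
grouping of such an `X` with `F(X)` of the same `p`-adic valuation, and replacing `p` copies of
`p^j` by `p^(j+1)` raises this valuation by one. Any two such `X` are joined by merges and splits,
and the valuation can be kept at least `v` if both start there and one of them starts above `v`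
(`scaled_eq_of_powers`). Hence `(F(s)/p^v) c(s) = (F(t)/p^v) c(t)` whenever `v ≤ v_p(F(s))` and `v <
v_p(F(t))`.

Consequently the minors `ζ(t) c(s) - ζ(s) c(t)` have order dividing the product of the primes up to
`n`, each prime occurring once (`prod_primes_smul_minor_eq_zero`); for `k = 2` or `p > n` they have
no `p`-torsion. Over `𝔽_p` every cocycle vanishes wherever `ζ` does
(`eq_zero_of_zetaParts_eq_zero`). Since each relation involves only two coefficients, the support of
`ζ` then splits into classes on which all cocycles are proportional to `ζ`; the restrictions of `ζ`
to these classes are the indecomposable cocycles, and they form a basis. As `ζ` has nonzero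
coordinates in this basis, it can replace the omitted member `β 0`.

The coefficients of `ζ` have gcd one, so a Bézout combination of the values of `c` gives `b` for
which `c - b ζ` is a combination of minors, hence killed by a squarefree integer. It splits into
`p`-torsion cocycles, each with unique coordinates in the basis `ζ, β 1, …, β l`; the
`ζ`-coordinates are absorbed into `b` (`Relations.exists_decomposition`,
`Relations.decomposition_unique`). These data are exactly a homomorphism out of `L_k^n`. Power
series are treated degree by degree. -/

noncomputable section

namespace Cocycle

/-! ### Universal property of tensor products of families of rings -/

section RingTensor

variable {ι : Type*} {R : ι → Type*} [∀ i, CommRing (R i)]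

theorem FinTensor.lift_of {s : Finset ι} {A : Type*} [CommRing A] (g : ∀ i : s, R i →+* A) (i : s)
    (a : R i) : FinTensor.lift R s g (FinTensor.of R s i a) = g i a := by
  classical
  change PiTensorProduct.lift _ (PiTensorProduct.tprod ℤ _) = _
  rw [PiTensorProduct.lift.tprod]
  simp only [MultilinearMap.compLinearMap_apply, MultilinearMap.mkPiAlgebra_apply]
  rw [Finset.prod_eq_single i]
  · simp [MonoidHom.mulSingle_apply]
  · intro j _ hj
    simp [MonoidHom.mulSingle_apply, Pi.mulSingle_eq_of_ne hj]
  · simp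

theorem FinTensor.hom_ext {s : Finset ι} {A : Type*} [CommRing A] {f g : FinTensor R s →+* A}
    (h : ∀ i a, f (FinTensor.of R s i a) = g (FinTensor.of R s i a)) : f = g := by
  classical
  let toAlgHom (f : FinTensor R s →+* A) : (⨂[ℤ] i : s, R i) →ₐ[ℤ] A :=
    AlgHom.mk f fun n => RingHom.congr_fun (RingHom.ext_int
      (RingHom.comp (α := ℤ) f (algebraMap ℤ (⨂[ℤ] i : s, R i))) (algebraMap ℤ A)) n
  have : toAlgHom f = toAlgHom g := by
    apply PiTensorProduct.algHom_ext
    intro i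
    apply AlgHom.ext
    intro a
    have key : FinTensor.of R s i a = PiTensorProduct.singleAlgHom (R := ℤ)
        (A := fun i : s => R i) i a := by
      change PiTensorProduct.singleAlgHom (R := ℤ) (A := fun i : s => R i) i a = _
      congr!
    have := h i a
    rw [key] at this
    exact this
  exact RingHom.ext fun x => DFunLike.congr_fun this x

/-- The transition maps carry a factor to itself, so its image in the limit does not depend on the
finite stage at which it is inserted. -/
theorem RingTensor.limit_of {s : Finset ι} (i : s) (a : R i) :
    Ring.DirectLimit.of (FinTensor R) (fun s t h => FinTensor.trans R s t h) s
      (FinTensor.of R s i a) = RingTensor.of R i a := by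
  have h : ({(i : ι)} : Finset ι) ≤ s := by simp
  have := Ring.DirectLimit.of_f (G := FinTensor R) (f := fun s t h => FinTensor.trans R s t h) h
    (FinTensor.of R {(i : ι)} ⟨i, Finset.mem_singleton_self _⟩ a)
  refine Eq.trans ?_ this
  rw [FinTensor.trans, FinTensor.lift_of]

theorem RingTensor.hom_ext {A : Type*} [CommRing A] {f g : RingTensor R →+* A}
    (h : ∀ i a, f (RingTensor.of R i a) = g (RingTensor.of R i a)) : f = g := by
  apply Ring.DirectLimit.hom_ext
  intro s
  apply FinTensor.hom_ext
  intro i a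
  have := h i a
  rw [← RingTensor.limit_of] at this
  exact this

/-- The ring homomorphism out of a tensor product given by its restrictions to the factors. -/
def RingTensor.lift {A : Type*} [CommRing A] (g : ∀ i, R i →+* A) : RingTensor R →+* A :=
  Ring.DirectLimit.lift _ _ A (fun s => FinTensor.lift R s fun i => g i) (by
    intro s t h x
    rw [← RingHom.comp_apply]
    congr 1
    apply FinTensor.hom_ext
    intro i a
    rw [RingHom.comp_apply, FinTensor.trans, FinTensor.lift_of, FinTensor.lift_of,
      FinTensor.lift_of])

theorem RingTensor.lift_of {A : Type*} [CommRing A] (g : ∀ i, R i →+* A) (i : ι) (a : R i) :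
    RingTensor.lift g (RingTensor.of R i a) = g i a := by
  refine (Ring.DirectLimit.lift_of A _ _ _ _).trans ?_
  rw [FinTensor.lift_of]

end RingTensor

/-! ### Homomorphisms out of `L_k^n`: a free element and elements killed by primes -/

section DegreeRing

variable {l : Nat.Primes → ℕ} {A : Type*} [CommRing A]

theorem TorsionFactor.hom_ext {p : ℕ} {f g : TorsionFactor p →+* A}
    (h : f (Ideal.Quotient.mk _ Polynomial.X) = g (Ideal.Quotient.mk _ Polynomial.X)) :
    f = g := by
  apply Ideal.Quotient.ringHom_ext
  apply Polynomial.ringHom_ext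
  · intro a; simp
  · exact h

/-- The homomorphism `ℤ[c] / (p c) → A` with `c ↦ a`, for `p a = 0`. -/
def TorsionFactor.lift {p : ℕ} (a : A) (ha : p • a = 0) : TorsionFactor p →+* A :=
  Ideal.Quotient.lift _ (Polynomial.eval₂RingHom (Int.castRingHom A) a) (by
    intro x hx
    obtain ⟨y, rfl⟩ := Ideal.mem_span_singleton'.1 hx
    have : (p : A) * a = 0 := by simpa using ha
    simp [Polynomial.eval₂_mul, this])

theorem DegreeRing.hom_ext {f g : DegreeRing l →+* A} (hb : f (b l) = g (b l))
    (hc : ∀ j, f (c l j) = g (c l j)) : f = g := by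
  have : f.toIntAlgHom = g.toIntAlgHom := by
    apply Algebra.TensorProduct.ext
    · exact Polynomial.algHom_ext hb
    · have : (f.comp Algebra.TensorProduct.includeRight.toRingHom :
          (RingTensor fun j : Σ p : Nat.Primes, Fin (l p) => TorsionFactor j.1) →+* A) =
          g.comp Algebra.TensorProduct.includeRight.toRingHom := by
        apply RingTensor.hom_ext
        intro j a
        rw [← RingHom.comp_apply, ← RingHom.comp_apply (RingHom.comp g _)]
        congr 1
        exact TorsionFactor.hom_ext (hc j)
      exact AlgHom.ext fun x => DFunLike.congr_fun this x
  exact RingHom.ext fun x => DFunLike.congr_fun this x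

theorem DegreeRing.exists_hom (x : A) (y : (Σ p : Nat.Primes, Fin (l p)) → A)
    (hy : ∀ j, (j.1 : ℕ) • y j = 0) :
    ∃ φ : DegreeRing l →+* A, φ (b l) = x ∧ ∀ j, φ (c l j) = y j := by
  refine ⟨(Algebra.TensorProduct.lift (Polynomial.aeval x : Polynomial ℤ →ₐ[ℤ] A)
    (RingTensor.lift fun j => TorsionFactor.lift (y j) (hy j)).toIntAlgHom
    fun _ _ => Commute.all _ _).toRingHom, ?_, ?_⟩
  · simp [b]
  · intro j
    simp [c, RingTensor.lift_of, TorsionFactor.lift]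

theorem DegreeRing.prime_smul_c (j : Σ p : Nat.Primes, Fin (l p)) : (j.1 : ℕ) • c l j = 0 := by
  have h : (j.1 : ℕ) • (Ideal.Quotient.mk _ Polynomial.X : TorsionFactor j.1) = 0 := by
    rw [← map_nsmul, Ideal.Quotient.eq_zero_iff_mem, Ideal.mem_span_singleton]
    simp
  have := congrArg (fun a => (1 : Polynomial ℤ) ⊗ₜ[ℤ] RingTensor.of
    (fun j : Σ p : Nat.Primes, Fin (l p) => TorsionFactor j.1) j a) h
  simp only [map_nsmul, map_zero, TensorProduct.tmul_zero] at this
  rw [c, ← this]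
  exact (map_nsmul (TensorProduct.mk ℤ _ _ (1 : Polynomial ℤ)) _ _).symm

end DegreeRing

/-! ### Products of factorials and the cocycle relations on partitions -/

/-- The product of the factorials of the elements of a multiset. -/
def factProd (s : Multiset ℕ) : ℕ := (s.map Nat.factorial).prod

@[simp] theorem factProd_zero : factProd 0 = 1 := by simp [factProd]

@[simp] theorem factProd_cons (a : ℕ) (s : Multiset ℕ) :
    factProd (a ::ₘ s) = a.factorial * factProd s := by simp [factProd]

@[simp] theorem factProd_add (s t : Multiset ℕ) : factProd (s + t) = factProd s * factProd t := by
  simp [factProd]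

theorem factProd_pos (s : Multiset ℕ) : 0 < factProd s := by
  induction s using Multiset.induction with
  | empty => simp
  | cons a s ih => simpa using ⟨a.factorial_pos, ih⟩

theorem factProd_dvd_factorial_sum (s : Multiset ℕ) : factProd s ∣ s.sum.factorial := by
  induction s using Multiset.induction with
  | empty => simp
  | cons a s ih =>
    rw [factProd_cons, Multiset.sum_cons]
    exact (mul_dvd_mul_left _ ih).trans (Nat.factorial_mul_factorial_dvd_factorial_add _ _)

/-- The quotient is a product of multinomial coefficients, one for each block. -/
theorem factProd_join_dvd (B : Multiset (Multiset ℕ)) :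
    factProd B.join ∣ factProd (B.map Multiset.sum) := by
  induction B using Multiset.induction with
  | empty => simp
  | cons a s ih =>
    simp only [Multiset.join_cons, factProd_add, Multiset.map_cons, factProd_cons]
    exact mul_dvd_mul (factProd_dvd_factorial_sum a) ih

/-- The relations between the coefficients of a symmetric 2-cocycle, as a condition on functions
on partitions with `k` parts of `n`. -/
def IsPartitionCocycle {A : Type*} [AddCommGroup A] (k n : ℕ) (c : Multiset ℕ → A) : Prop :=
  ∀ (a b d : ℕ) (R : Multiset ℕ), 0 < a → 0 < b → 0 < d → (∀ x ∈ R, 0 < x) →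
    R.card + 2 = k → a + b + d + R.sum = n →
    (a + b).choose a • c ((a + b) ::ₘ d ::ₘ R) = (b + d).choose b • c (a ::ₘ (b + d) ::ₘ R)

/-- A multiset of `k` positive numbers with sum `n`. -/
def IsParts (k n : ℕ) (s : Multiset ℕ) : Prop :=
  s.card = k ∧ s.sum = n ∧ ∀ x ∈ s, 0 < x

/-! ### Scaled coefficients are constant on the groupings of a fine multiset -/

section Scaled

variable {A : Type*} [AddCommGroup A]

/-- The coefficient of a partition scaled by the product of its factorials, divided by `D`. -/
def scaled (D : ℕ) (c : Multiset ℕ → A) (s : Multiset ℕ) : A := (factProd s / D) • c s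

variable {k n D : ℕ} {c : Multiset ℕ → A}

/-- Both partitions coarsen `(a, b, d, R)`, and their factorial products exceed that of the
refinement by exactly the two binomial coefficients of the relation. Dividing by `D` leaves the
relation multiplied by the integer `factProd (a, b, d, R) / D`. -/
theorem scaled_edge (hc : IsPartitionCocycle k n c) {a b d : ℕ} {R : Multiset ℕ} (ha : 0 < a)
    (hb : 0 < b) (hd : 0 < d) (hR : ∀ x ∈ R, 0 < x) (hk : R.card + 2 = k)
    (hn : a + b + d + R.sum = n) (hD : D ∣ factProd (a ::ₘ b ::ₘ d ::ₘ R)) :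
    scaled D c ((a + b) ::ₘ d ::ₘ R) = scaled D c (a ::ₘ (b + d) ::ₘ R) := by
  have h := hc a b d R ha hb hd hR hk hn
  have e1 : factProd ((a + b) ::ₘ d ::ₘ R) =
      (a + b).choose a * factProd (a ::ₘ b ::ₘ d ::ₘ R) := by
    have := Nat.add_choose_mul_factorial_mul_factorial a b
    simp only [factProd_cons]
    rw [← this, Nat.choose_symm_add]
    ring
  have e2 : factProd (a ::ₘ (b + d) ::ₘ R) =
      (b + d).choose b * factProd (a ::ₘ b ::ₘ d ::ₘ R) := by
    have := Nat.add_choose_mul_factorial_mul_factorial b d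
    simp only [factProd_cons]
    rw [← this, Nat.choose_symm_add]
    ring
  obtain ⟨t, ht⟩ := hD
  rcases Nat.eq_zero_or_pos D with rfl | hD
  · simp [scaled]
  rw [scaled, scaled, e1, e2, ht, mul_left_comm, mul_left_comm _ D, Nat.mul_div_cancel_left _ hD,
    Nat.mul_div_cancel_left _ hD, mul_comm, mul_smul, h, mul_comm _ t, mul_smul]

/-- Normal form of a grouping: one distinguished block `β₀` absorbs all but one element of every
other block, one edge per block. `S₀` collects the blocks already reduced to singletons. The
divisibility needed for each edge follows from `D ∣ factProd X`, since coarsening multiplies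
`factProd` by multinomial coefficients. -/
theorem scaled_reduce (hc : IsPartitionCocycle k n c) {X : Multiset ℕ} (hX : ∀ x ∈ X, 0 < x)
    (hn : X.sum = n) (hD : D ∣ factProd X) (B : Multiset (Multiset ℕ)) :
    ∀ S₀ β₀ : Multiset ℕ, β₀ ≠ 0 → (∀ β ∈ B, β ≠ 0) → B.card + S₀.card + 1 = k →
      β₀ + B.join + S₀ = X → ∃ S T : Multiset ℕ, S + T = X ∧ S.card + 1 = k ∧
        scaled D c (β₀.sum ::ₘ (B.map Multiset.sum + S₀)) = scaled D c (T.sum ::ₘ S) := by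
  have pos : ∀ s : Multiset ℕ, s ≤ X → s ≠ 0 → 0 < s.sum := by
    intro s hs h0
    obtain ⟨x, hx⟩ := Multiset.exists_mem_of_ne_zero h0
    exact (hX x (Multiset.mem_of_le hs hx)).trans_le (Multiset.single_le_sum (by simp) _ hx)
  induction B using Multiset.induction with
  | empty =>
    intro S₀ β₀ _ _ hk h
    refine ⟨S₀, β₀, ?_, by simpa using hk, by simp⟩
    rw [← h]; simp [add_comm]
  | cons β B ih =>
    intro S₀ β₀ h0 hB hk h
    obtain ⟨x, hx⟩ := Multiset.exists_mem_of_ne_zero (hB β (by simp))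
    obtain ⟨β', rfl⟩ := Multiset.exists_cons_of_mem hx
    have hB' : ∀ β ∈ B, β ≠ 0 := fun β h => hB β (by simp [h])
    rcases eq_or_ne β' 0 with rfl | hβ'
    · obtain ⟨S, T, h1, h2, h3⟩ := ih (x ::ₘ S₀) β₀ h0 hB' (by simp at hk ⊢; omega) (by
        rw [← h]; simp)
      refine ⟨S, T, h1, h2, ?_⟩
      rw [← h3]
      simp
    · obtain ⟨S, T, h1, h2, h3⟩ := ih (x ::ₘ S₀) (β₀ + β') (by simp [h0]) hB'
        (by simp at hk ⊢; omega) (by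
          rw [← h]
          simp only [Multiset.join_cons]
          simp only [← Multiset.singleton_add]
          ac_rfl)
      refine ⟨S, T, h1, h2, ?_⟩
      rw [← h3]
      have := scaled_edge (D := D) hc (a := β₀.sum) (b := β'.sum) (d := x)
        (R := B.map Multiset.sum + S₀) (pos _ (by
          rw [← h, add_assoc]; exact Multiset.le_add_right _ _) h0) (pos _ (by
          rw [← h]
          refine le_trans ?_ (Multiset.le_add_right _ _)
          refine le_trans ?_ (Multiset.le_add_left _ _)
          rw [Multiset.join_cons]
          refine le_trans ?_ (Multiset.le_add_right _ _)
          exact Multiset.le_cons_self _ _) hβ')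
        (hX x (by rw [← h]; simp)) (by
          intro y hy
          rcases Multiset.mem_add.1 hy with hy | hy
          · obtain ⟨β, hβ, rfl⟩ := Multiset.mem_map.1 hy
            refine pos _ ?_ (hB' β hβ)
            rw [← h]
            refine le_trans ?_ (Multiset.le_add_right _ _)
            refine le_trans ?_ (Multiset.le_add_left _ _)
            rw [Multiset.join_cons]
            refine le_trans ?_ (Multiset.le_add_left _ _)
            obtain ⟨B', rfl⟩ := Multiset.exists_cons_of_mem hβ
            rw [Multiset.join_cons]
            exact Multiset.le_add_right _ _
          · exact hX y (by rw [← h]; simp [hy])) (by simp at hk ⊢; omega) (by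
          rw [← hn, ← h]
          simp [Multiset.sum_join]
          ring) (by
          refine hD.trans ?_
          rw [← h]
          simp only [factProd_add, factProd_cons, Multiset.join_cons]
          have h1 := factProd_dvd_factorial_sum β₀
          have h2 := factProd_dvd_factorial_sum β'
          have h3 := factProd_join_dvd B
          calc _ = factProd β₀ * (factProd β' * (x.factorial * (factProd B.join * factProd S₀))) := by
                ring
            _ ∣ _ := mul_dvd_mul h1 (mul_dvd_mul h2 (mul_dvd_mul_left _ (mul_dvd_mul_right h3 _))))
      simp only [Multiset.map_cons, Multiset.sum_cons, Multiset.sum_add, Multiset.cons_add,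
        Multiset.add_cons] at this ⊢
      rw [this, add_comm x]

/-- A singleton `a` is traded for an element `y` of the large block `y ::ₘ Z` along the single edge
from `(y + Z.sum, a)` to `(y, Z.sum + a)`. Repeating this replaces `U` by `U'`, with `C` the common
singletons. -/
theorem scaled_exchange (hc : IsPartitionCocycle k n c) {X : Multiset ℕ} (hX : ∀ x ∈ X, 0 < x)
    (hn : X.sum = n) (hD : D ∣ factProd X) (hcard : k + 1 ≤ X.card) (U : Multiset ℕ) :
    ∀ U' C T T' : Multiset ℕ, Disjoint U U' → U.card = U'.card → C + U + T = X → C + U' + T' = X →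
      C.card + U.card + 1 = k →
      scaled D c (T.sum ::ₘ (C + U)) = scaled D c (T'.sum ::ₘ (C + U')) := by
  induction U using Multiset.induction with
  | empty =>
    intro U' C T T' _ hU h1 h2 _
    obtain rfl : U' = 0 := Multiset.card_eq_zero.1 hU.symm
    obtain rfl : T = T' := by
      rw [← h2] at h1
      exact add_left_cancel h1
    rfl
  | cons a U ih =>
    intro U' C T T' hdis hU h1 h2 hk
    obtain ⟨y, hy⟩ : ∃ y, y ∈ U' := Multiset.card_pos_iff_exists_mem.1 (by
      rw [← hU]; simp)
    obtain ⟨U', rfl⟩ := Multiset.exists_cons_of_mem hy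
    have hya : y ∉ a ::ₘ U := fun h => Multiset.disjoint_left.1 hdis h hy
    have hyT : y ∈ T := by
      have := congrArg (Multiset.count y) (h1.trans h2.symm)
      simp only [Multiset.count_add, Multiset.count_eq_zero_of_notMem hya,
        Multiset.count_cons_self] at this
      rw [← Multiset.count_pos]
      omega
    obtain ⟨Z, rfl⟩ := Multiset.exists_cons_of_mem hyT
    -- Since `X` has at least `k + 1` elements and there are `k - 1` singletons, the large block has
    -- at least two elements.
    have hZ : Z ≠ 0 := by
      rintro rfl
      rw [← h1] at hcard
      simp at hcard hk
      omega
    have hZX : Z ≤ X := by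
      rw [← h1]
      exact (Multiset.le_cons_self _ _).trans (Multiset.le_add_left _ _)
    have hZpos : 0 < Z.sum := by
      obtain ⟨x, hx⟩ := Multiset.exists_mem_of_ne_zero hZ
      exact (hX x (Multiset.mem_of_le hZX hx)).trans_le (Multiset.single_le_sum (by simp) _ hx)
    have step := scaled_edge (D := D) hc (a := y) (b := Z.sum) (d := a) (R := C + U)
      (hX y (by rw [← h1]; simp)) hZpos (hX a (by rw [← h1]; simp))
      (fun x hx => hX x (by
        rw [← h1]; rcases Multiset.mem_add.1 hx with h | h <;> simp [h]))
      (by simp at hk ⊢; omega) (by rw [← hn, ← h1]; simp; ring) (by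
        refine hD.trans ?_
        rw [← h1]
        simp only [factProd_add, factProd_cons]
        have h1 := factProd_dvd_factorial_sum Z
        calc _ = factProd Z * (y.factorial * a.factorial * factProd C * factProd U) := by ring
          _ ∣ Z.sum.factorial * (y.factorial * a.factorial * factProd C * factProd U) :=
              mul_dvd_mul_right h1 _
          _ ∣ _ := by apply dvd_of_eq; ring)
    have := ih U' (y ::ₘ C) (a ::ₘ Z) T'
      (Multiset.disjoint_left.2 fun hx hx' => Multiset.disjoint_left.1 hdis
        (Multiset.mem_cons_of_mem hx) (Multiset.mem_cons_of_mem hx'))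
      (by simpa using hU) (by
        rw [← h1]; simp only [← Multiset.singleton_add]; ac_rfl) (by
        rw [← h2]; simp only [← Multiset.singleton_add]; ac_rfl) (by simp at hk ⊢; omega)
    simp only [Multiset.sum_cons, Multiset.cons_add, Multiset.add_cons] at this step ⊢
    rw [step, ← this, Multiset.cons_swap, add_comm a]

/-- `s` is obtained from `X` by dividing `X` into `k` non-empty blocks and replacing each block
by its sum. -/
def IsGrouping (k : ℕ) (X s : Multiset ℕ) : Prop :=
  ∃ B : Multiset (Multiset ℕ), B.card = k ∧ (∀ β ∈ B, β ≠ 0) ∧ B.join = X ∧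
    B.map Multiset.sum = s

/-- Each grouping is first brought to a normal form with singletons `S` and one large block; two
normal forms then differ by exchanging `S - S'` with `S' - S` while `S ∩ S'` stays. -/
theorem scaled_eq_of_isGrouping (hk : 0 < k) (hc : IsPartitionCocycle k n c) {X : Multiset ℕ}
    (hX : ∀ x ∈ X, 0 < x) (hn : X.sum = n) (hD : D ∣ factProd X) (hcard : k + 1 ≤ X.card)
    {s t : Multiset ℕ} (hs : IsGrouping k X s) (ht : IsGrouping k X t) :
    scaled D c s = scaled D c t := by
  have key : ∀ s, IsGrouping k X s → ∃ S T : Multiset ℕ, S + T = X ∧ S.card + 1 = k ∧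
        scaled D c s = scaled D c (T.sum ::ₘ S) := by
    rintro s ⟨B, hB, hB0, hBX, rfl⟩
    obtain ⟨β, hβ⟩ := Multiset.card_pos_iff_exists_mem.1 (hB ▸ hk)
    obtain ⟨B, rfl⟩ := Multiset.exists_cons_of_mem hβ
    obtain ⟨S, T, h1, h2, h3⟩ := scaled_reduce hc hX hn hD B 0 β (hB0 β (by simp))
      (fun β h => hB0 β (by simp [h])) (by simpa using hB) (by simpa using hBX)
    exact ⟨S, T, h1, h2, by simpa using h3⟩
  obtain ⟨S, T, h1, h2, h3⟩ := key s hs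
  obtain ⟨S', T', h1', h2', h3'⟩ := key t ht
  rw [h3, h3']
  have e : S ∩ S' + (S - S') = S := by rw [add_comm]; exact Multiset.sub_add_inter S S'
  have e' : S ∩ S' + (S' - S) = S' := by
    rw [add_comm, Multiset.inter_comm]; exact Multiset.sub_add_inter S' S
  have c1 := congrArg Multiset.card e
  have c2 := congrArg Multiset.card e'
  rw [Multiset.card_add] at c1 c2
  have := scaled_exchange hc hX hn hD hcard (S - S') (S' - S) (S ∩ S') T T' (by
    rw [Multiset.disjoint_left]
    intro x hx hx'
    rw [← Multiset.count_pos, Multiset.count_sub] at hx hx'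
    omega) (by omega) (by rw [e, h1]) (by rw [e', h1']) (by omega)
  rwa [e, e'] at this

theorem IsGrouping.refine {x : ℕ} {Y Z s : Multiset ℕ} (h : IsGrouping k (x ::ₘ Y) s)
    (hZ : Z.sum = x) (hZ0 : Z ≠ 0) : IsGrouping k (Z + Y) s := by
  obtain ⟨B, hB, hB0, hBX, rfl⟩ := h
  have hx : x ∈ B.join := by rw [hBX]; simp
  obtain ⟨β, hβ, hxβ⟩ := Multiset.mem_join.1 hx
  obtain ⟨B, rfl⟩ := Multiset.exists_cons_of_mem hβ
  obtain ⟨β, rfl⟩ := Multiset.exists_cons_of_mem hxβ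
  refine ⟨(Z + β) ::ₘ B, by simpa using hB, ?_, ?_, ?_⟩
  · intro γ hγ
    rcases Multiset.mem_cons.1 hγ with rfl | h
    · simp [hZ0]
    · exact hB0 γ (by simp [h])
  · rw [Multiset.join_cons, Multiset.cons_add, Multiset.cons_inj_right] at hBX
    rw [Multiset.join_cons, ← hBX, add_assoc]
  · simp [hZ]

theorem exists_isGrouping (hk : 0 < k) {X : Multiset ℕ} (hX : k ≤ X.card) :
    ∃ s, IsGrouping k X s := by
  induction k, hk using Nat.le_induction generalizing X with
  | base =>
    refine ⟨_, {X}, by simp, ?_, by simp, rfl⟩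
    rintro β hβ
    rw [Multiset.mem_singleton.1 hβ, ← Multiset.card_pos]
    exact hX
  | succ k hk ih =>
    obtain ⟨x, hx⟩ := Multiset.card_pos_iff_exists_mem.1 (lt_of_lt_of_le (Nat.succ_pos k) hX)
    obtain ⟨X, rfl⟩ := Multiset.exists_cons_of_mem hx
    obtain ⟨s, B, hB, hB0, hBX, rfl⟩ := ih (X := X) (by simpa using hX)
    refine ⟨_, {x} ::ₘ B, by simp [hB], ?_, by simp [hBX], rfl⟩
    intro β hβ
    rcases Multiset.mem_cons.1 hβ with rfl | h
    · simp
    · exact hB0 β h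

theorem IsGrouping.eq_of_card_eq {X s : Multiset ℕ} (h : IsGrouping k X s) (hX : X.card = k) :
    s = X := by
  obtain ⟨B, rfl, hB0, rfl, rfl⟩ := h
  have le : ∀ B : Multiset (Multiset ℕ), (∀ β ∈ B, β ≠ 0) → B.card ≤ B.join.card := by
    intro B
    induction B using Multiset.induction with
    | empty => simp
    | cons β B ih =>
      intro h
      have h1 := ih fun β hβ => h β (by simp [hβ])
      have h2 := Multiset.card_pos.2 (h β (by simp))
      simp only [Multiset.card_cons, Multiset.join_cons, Multiset.card_add]
      omega
  induction B using Multiset.induction with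
  | empty => simp
  | cons β B ih =>
    have hB := fun β hβ => hB0 β (Multiset.mem_cons_of_mem hβ)
    have h1 := le B hB
    have h2 := Multiset.card_pos.2 (hB0 β (by simp))
    simp only [Multiset.card_cons, Multiset.join_cons, Multiset.card_add] at hX
    obtain ⟨x, rfl⟩ := Multiset.card_eq_one.1 (show β.card = 1 by omega)
    rw [Multiset.map_cons, ih hB (by omega)]
    simp

theorem IsGrouping.sum_eq {X s : Multiset ℕ} (h : IsGrouping k X s) : s.sum = X.sum := by
  obtain ⟨B, rfl, hB0, rfl, rfl⟩ := h
  rw [Multiset.sum_join]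

theorem IsGrouping.isParts {X s : Multiset ℕ} (h : IsGrouping k X s) (hX : ∀ x ∈ X, 0 < x) :
    IsParts k X.sum s := by
  refine ⟨?_, h.sum_eq, ?_⟩
  · obtain ⟨B, rfl, hB0, rfl, rfl⟩ := h
    simp
  · obtain ⟨B, rfl, hB0, rfl, rfl⟩ := h
    intro x hx
    obtain ⟨β, hβ, rfl⟩ := Multiset.mem_map.1 hx
    obtain ⟨y, hy⟩ := Multiset.exists_mem_of_ne_zero (hB0 β hβ)
    exact (hX y (Multiset.mem_join.2 ⟨β, hβ, hy⟩)).trans_le (Multiset.single_le_sum (by simp) _ hy)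

theorem IsGrouping.factProd_dvd {X s : Multiset ℕ} (h : IsGrouping k X s) :
    factProd X ∣ factProd s := by
  obtain ⟨B, rfl, hB0, rfl, rfl⟩ := h
  exact factProd_join_dvd B

theorem isGrouping_replicate_one {s : Multiset ℕ} (hs : IsParts k n s) :
    IsGrouping k (Multiset.replicate n 1) s := by
  obtain ⟨rfl, rfl, h⟩ := hs
  refine ⟨s.map fun x => Multiset.replicate x 1, by simp, ?_, ?_, by simp⟩
  · intro β hβ
    obtain ⟨x, hx, rfl⟩ := Multiset.mem_map.1 hβ
    have := h x hx
    rw [← Multiset.card_pos]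
    simpa
  · clear h
    induction s using Multiset.induction with
    | empty => simp
    | cons a s ih => simp [ih, Multiset.replicate_add]

/-- Every partition groups the multiset of `n` ones, where `D = 1` is allowed. For `n = k` this
multiset is itself the only partition. -/
theorem factProd_smul_eq (hk : 0 < k) (hc : IsPartitionCocycle k n c) {s t : Multiset ℕ}
    (hs : IsParts k n s) (ht : IsParts k n t) : factProd s • c s = factProd t • c t := by
  have gs := isGrouping_replicate_one hs
  have gt := isGrouping_replicate_one ht
  have hkn : k ≤ n := by
    have h : ∀ x ∈ s, 1 ≤ x := hs.2.2
    have := Multiset.card_nsmul_le_sum h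
    rw [hs.1, hs.2.1] at this
    simpa using this
  rcases hkn.eq_or_lt with h | h
  · rw [gs.eq_of_card_eq (by simp [h]), gt.eq_of_card_eq (by simp [h])]
  · have := scaled_eq_of_isGrouping (D := 1) hk hc (X := Multiset.replicate n 1)
      (fun x hx => by rw [Multiset.eq_of_mem_replicate hx]; exact one_pos) (by simp) (by simp)
      (by simpa using h) gs gt
    simpa [scaled] using this

end Scaled

/-! ### Refinement into powers of a prime; merging and splitting -/

section Atoms

variable {p : ℕ}

/-- The sum of the integral parts of `p ^ e / p ^ i`, for `e` in `Y`. -/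
def floorSum (p i : ℕ) (Y : Multiset ℕ) : ℕ := (Y.map fun e => p ^ e / p ^ i).sum

/-- The `p`-adic valuation of the product of the factorials of the `p ^ e`, for `e` in `Y`,
when all elements of `Y` are at most `L`. -/
def floorTotal (p L : ℕ) (Y : Multiset ℕ) : ℕ := ∑ i ∈ Finset.range L, floorSum p (i + 1) Y

/-- The powers `p ^ e`, for `e` in `Y`. -/
def powers (p : ℕ) (Y : Multiset ℕ) : Multiset ℕ := Y.map (p ^ ·)

@[simp] theorem floorSum_cons (i e : ℕ) (Y : Multiset ℕ) :
    floorSum p i (e ::ₘ Y) = p ^ e / p ^ i + floorSum p i Y := by simp [floorSum]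

@[simp] theorem floorSum_add (i : ℕ) (Y Z : Multiset ℕ) :
    floorSum p i (Y + Z) = floorSum p i Y + floorSum p i Z := by simp [floorSum]

@[simp] theorem floorSum_replicate (i m e : ℕ) :
    floorSum p i (Multiset.replicate m e) = m * (p ^ e / p ^ i) := by simp [floorSum]

theorem floorSum_zero (Y : Multiset ℕ) : floorSum p 0 Y = (powers p Y).sum := by
  simp [floorSum, powers]

theorem powers_pos (hp : 2 ≤ p) (Y : Multiset ℕ) : ∀ x ∈ powers p Y, 0 < x := by
  intro x hx
  obtain ⟨e, _, rfl⟩ := Multiset.mem_map.1 hx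
  positivity

theorem pow_div_pow_eq (hp : 2 ≤ p) (e i : ℕ) :
    p ^ e / p ^ i = (if i = e then 1 else 0) + p * (p ^ e / p ^ (i + 1)) := by
  rcases lt_trichotomy e i with h | rfl | h
  · rw [if_neg (by omega), Nat.div_eq_of_lt (Nat.pow_lt_pow_right hp h),
      Nat.div_eq_of_lt (Nat.pow_lt_pow_right hp (by omega))]
    simp
  · rw [if_pos rfl, Nat.div_self (by positivity),
      Nat.div_eq_of_lt (Nat.pow_lt_pow_right hp (by omega)), mul_zero, add_zero]
  · rw [if_neg (by omega), Nat.pow_div h.le (by omega), Nat.pow_div h (by omega), zero_add,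
      ← pow_succ']
    congr 1
    omega

/-- Multiplicities can be read off from consecutive floor sums, so the floor sums serve as
coordinates on multisets of exponents. -/
theorem floorSum_eq (hp : 2 ≤ p) (i : ℕ) (Y : Multiset ℕ) :
    floorSum p i Y = Y.count i + p * floorSum p (i + 1) Y := by
  induction Y using Multiset.induction with
  | empty => simp [floorSum]
  | cons e Y ih =>
    rw [floorSum_cons, floorSum_cons, ih, pow_div_pow_eq hp, Multiset.count_cons]
    ring

theorem le_of_mem_of_sum_powers (hp : 2 ≤ p) {n : ℕ} {Y : Multiset ℕ} (hn : (powers p Y).sum = n)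
    {e : ℕ} (he : e ∈ Y) : e < n := by
  rw [← hn]
  exact (Nat.lt_pow_self hp).trans_le
    (Multiset.single_le_sum (by simp) _ (Multiset.mem_map_of_mem _ he))

theorem floorSum_eq_zero (hp : 2 ≤ p) {L i : ℕ} {Y : Multiset ℕ} (hY : ∀ e ∈ Y, e < L)
    (hi : L ≤ i) : floorSum p i Y = 0 := by
  rw [floorSum, Multiset.sum_eq_zero_iff]
  intro x hx
  obtain ⟨e, he, rfl⟩ := Multiset.mem_map.1 hx
  exact Nat.div_eq_of_lt (Nat.pow_lt_pow_right hp ((hY e he).trans_le hi))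

/-- Sum `floorSum_eq` over `i < L`: the shifted sum telescopes, since the floor sum at `L` vanishes
and the one at `0` is the total. The number of powers is thus the total minus `(p - 1) *
floorTotal`; a larger valuation means fewer powers. -/
theorem card_add_mul_floorTotal (hp : 2 ≤ p) {L : ℕ} {Y : Multiset ℕ} (hY : ∀ e ∈ Y, e < L) :
    Y.card + p * floorTotal p L Y = (powers p Y).sum + floorTotal p L Y := by
  have h1 : ∑ i ∈ Finset.range L, floorSum p i Y = Y.card + p * floorTotal p L Y := by
    rw [Finset.sum_congr rfl fun i _ => floorSum_eq hp i Y]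
    rw [Finset.sum_add_distrib, Multiset.sum_count_eq_card (fun e he => Finset.mem_range.2 (hY e he)),
      ← Finset.mul_sum]
    rfl
  rw [← h1, ← floorSum_zero, floorTotal]
  have h2 := Finset.sum_range_succ (fun i => floorSum p i Y) L
  rw [Finset.sum_range_succ', floorSum_eq_zero hp hY le_rfl] at h2
  omega

theorem padicValNat_factProd_cons [Fact p.Prime] (a : ℕ) (s : Multiset ℕ) :
    padicValNat p (factProd (a ::ₘ s)) =
      padicValNat p a.factorial + padicValNat p (factProd s) := by
  rw [factProd_cons, padicValNat.mul a.factorial_ne_zero (factProd_pos s).ne']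

theorem padicValNat_factProd_powers [hp : Fact p.Prime] {L : ℕ} {Y : Multiset ℕ}
    (hY : ∀ e ∈ Y, e < L) : padicValNat p (factProd (powers p Y)) = floorTotal p L Y := by
  induction Y using Multiset.induction with
  | empty => simp [powers, floorTotal, floorSum]
  | cons e Y ih =>
    have h1 := ih fun e he => hY e (by simp [he])
    have h2 : powers p (e ::ₘ Y) = p ^ e ::ₘ powers p Y := by simp [powers]
    rw [h2, padicValNat_factProd_cons, h1, padicValNat_factorial (b := L + 1)]
    · simp only [floorTotal, floorSum_cons, Finset.sum_add_distrib, add_left_inj]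
      rw [Finset.sum_Ico_eq_sum_range]
      simp [add_comm]
    · rw [Nat.log_pow hp.out.one_lt]
      have := hY e (by simp)
      omega

theorem eq_of_floorSum_eq (hp : 2 ≤ p) {Y Z : Multiset ℕ}
    (h : ∀ i, floorSum p i Y = floorSum p i Z) : Y = Z := by
  ext i
  have h1 := floorSum_eq hp i Y
  have h2 := floorSum_eq hp i Z
  rw [h, h] at h1
  omega

/-- In floor-sum coordinates, merging `p` copies of `p ^ j` is a unit step in the coordinate `j + 1`
alone. -/
theorem floorSum_merge (hp : 2 ≤ p) (i j : ℕ) (Z : Multiset ℕ) :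
    floorSum p i ((j + 1) ::ₘ Z) =
      floorSum p i (Multiset.replicate p j + Z) + if i = j + 1 then 1 else 0 := by
  rw [floorSum_cons, floorSum_add, floorSum_replicate]
  have : p ^ (j + 1) / p ^ i = p * (p ^ j / p ^ i) + if i = j + 1 then 1 else 0 := by
    rcases Nat.eq_zero_or_pos i with rfl | hi
    · simp [pow_succ']
    · obtain ⟨i, rfl⟩ := Nat.exists_eq_succ_of_ne_zero hi.ne'
      rw [pow_div_pow_eq hp j, Nat.succ_eq_add_one, pow_succ, pow_succ,
        Nat.mul_div_mul_right _ _ (by omega), mul_comm p, pow_div_pow_eq hp j i]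
      simp only [add_left_inj]
      rw [add_comm, mul_comm]
      congr 1
      rw [pow_div_pow_eq hp j (i + 1), mul_comm]
  rw [this]
  ring

theorem powers_merge (j : ℕ) (Z : Multiset ℕ) :
    powers p (Multiset.replicate p j + Z) = Multiset.replicate p (p ^ j) + powers p Z ∧
    powers p ((j + 1) ::ₘ Z) = p ^ (j + 1) ::ₘ powers p Z := by
  simp [powers]

theorem sum_powers_merge (j : ℕ) (Z : Multiset ℕ) :
    (powers p ((j + 1) ::ₘ Z)).sum = (powers p (Multiset.replicate p j + Z)).sum := by
  rw [(powers_merge j Z).1, (powers_merge j Z).2]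
  simp [pow_succ']

theorem IsGrouping.of_merge (hp : 2 ≤ p) {k j : ℕ} {Z s : Multiset ℕ}
    (h : IsGrouping k (powers p ((j + 1) ::ₘ Z)) s) :
    IsGrouping k (powers p (Multiset.replicate p j + Z)) s := by
  rw [(powers_merge j Z).2] at h
  rw [(powers_merge j Z).1]
  refine h.refine (by simp [pow_succ']) ?_
  rw [← Multiset.card_pos]
  simp
  omega

theorem floorTotal_merge (hp : 2 ≤ p) {L j : ℕ} (hj : j < L) (Z : Multiset ℕ) :
    floorTotal p L ((j + 1) ::ₘ Z) = floorTotal p L (Multiset.replicate p j + Z) + 1 := by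
  simp only [floorTotal, floorSum_merge hp, Finset.sum_add_distrib]
  simp [hj]

/-- Take the first index at which `Y` falls below `Y'`; it is positive because the totals agree. At
the preceding index `j` the floor sum of `Y` is not smaller, while the next one is smaller, so by
`floorSum_eq` the deficit must be made up by at least `p` copies of `j`. -/
theorem exists_merge (hp : 2 ≤ p) {Y Y' : Multiset ℕ}
    (hs : (powers p Y).sum = (powers p Y').sum) (h : ∃ i, floorSum p i Y < floorSum p i Y') :
    ∃ j Z, Y = Multiset.replicate p j + Z ∧ floorSum p (j + 1) Y < floorSum p (j + 1) Y' := by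
  classical
  have h1 := Nat.find_spec h
  have h2 := fun m => Nat.find_min h (m := m)
  rcases hi : Nat.find h with _ | j
  · rw [hi, floorSum_zero, floorSum_zero, hs] at h1
    exact absurd h1 (lt_irrefl _)
  · rw [hi] at h1
    have h3 := h2 j (by omega)
    have e1 := floorSum_eq hp j Y
    have e2 := floorSum_eq hp j Y'
    have h4 : p * (floorSum p (j + 1) Y + 1) ≤ p * floorSum p (j + 1) Y' :=
      Nat.mul_le_mul_left _ h1
    have h5 : p ≤ Y.count j := by
      rw [mul_add] at h4
      omega
    obtain ⟨Z, hZ⟩ := Multiset.le_iff_exists_add.1 (Multiset.le_count_iff_replicate_le.1 h5)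
    exact ⟨j, Z, hZ, h1⟩

/-- Take the last index at which the floor sums differ. Beyond it they agree, so there the larger
floor sum means a larger multiplicity, and that multiset contains an element which can be split. -/
theorem exists_split (hp : 2 ≤ p) {Y Y' : Multiset ℕ}
    (hs : (powers p Y).sum = (powers p Y').sum) (h : Y ≠ Y') :
    (∃ j Z, Y' = (j + 1) ::ₘ Z ∧ floorSum p (j + 1) Y < floorSum p (j + 1) Y') ∨
    (∃ j Z, Y = (j + 1) ::ₘ Z ∧ floorSum p (j + 1) Y' < floorSum p (j + 1) Y) := by
  classical
  set n := (powers p Y).sum with hn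
  have hbd : ∀ i, floorSum p i Y ≠ floorSum p i Y' → i ≤ n := by
    intro i hi
    by_contra hni
    exact hi (by
      rw [floorSum_eq_zero hp (fun e he => le_of_mem_of_sum_powers hp hn.symm he) (by omega),
        floorSum_eq_zero hp (fun e he => le_of_mem_of_sum_powers hp hs.symm he) (by omega)])
  obtain ⟨i, hi⟩ : ∃ i, floorSum p i Y ≠ floorSum p i Y' := by
    by_contra hcon
    push Not at hcon
    exact h (eq_of_floorSum_eq hp hcon)
  have h1 := Nat.findGreatest_spec (P := fun i => floorSum p i Y ≠ floorSum p i Y') (hbd i hi) hi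
  have h2 := fun m h => Nat.findGreatest_is_greatest (n := n) (k := m)
    (P := fun i => floorSum p i Y ≠ floorSum p i Y') h
  set m := Nat.findGreatest (fun i => floorSum p i Y ≠ floorSum p i Y') n with hm
  have h3 : floorSum p (m + 1) Y = floorSum p (m + 1) Y' := by
    by_contra hcon
    exact h2 (m + 1) (by omega) (hbd _ hcon) hcon
  have e1 := floorSum_eq hp m Y
  have e2 := floorSum_eq hp m Y'
  rw [h3] at e1
  rcases hmj : m with _ | j
  · rw [hmj, floorSum_zero, floorSum_zero, ← hs] at h1
    exact absurd rfl h1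
  · rw [hmj] at h1 e1 e2
    rcases lt_or_gt_of_ne h1 with hlt | hlt
    · left
      obtain ⟨Z, hZ⟩ := Multiset.exists_cons_of_mem
        (Multiset.count_pos.1 (show 0 < Y'.count (j + 1) by omega))
      exact ⟨j, Z, hZ, hlt⟩
    · right
      obtain ⟨Z, hZ⟩ := Multiset.exists_cons_of_mem
        (Multiset.count_pos.1 (show 0 < Y.count (j + 1) by omega))
      exact ⟨j, Z, hZ, hlt⟩

theorem card_lt_of_floorTotal_lt (hp : 2 ≤ p) {n : ℕ} {Y Y' : Multiset ℕ}
    (hY : (powers p Y).sum = n) (hY' : (powers p Y').sum = n)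
    (h : floorTotal p n Y < floorTotal p n Y') : Y'.card < Y.card := by
  have h1 := card_add_mul_floorTotal hp (fun e he => le_of_mem_of_sum_powers hp hY he)
  have h2 := card_add_mul_floorTotal hp (fun e he => le_of_mem_of_sum_powers hp hY' he)
  rw [hY] at h1
  rw [hY'] at h2
  have h3 : 2 * (floorTotal p n Y' - floorTotal p n Y) ≤
    p * (floorTotal p n Y' - floorTotal p n Y) := Nat.mul_le_mul_right _ hp
  rw [Nat.mul_sub p] at h3
  have h4 : p * floorTotal p n Y ≤ p * floorTotal p n Y' := Nat.mul_le_mul_left _ h.le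
  omega

variable {A : Type*} [AddCommGroup A] {k n D : ℕ} {c : Multiset ℕ → A}

theorem scaled_eq_of_isGrouping_powers [Fact p.Prime] (hp : 2 ≤ p) (hk : 0 < k)
    (hc : IsPartitionCocycle k n c) {Y s t : Multiset ℕ} (hY : (powers p Y).sum = n)
    (hcard : k + 1 ≤ Y.card) (hD : D ≤ floorTotal p n Y)
    (hs : IsGrouping k (powers p Y) s) (ht : IsGrouping k (powers p Y) t) :
    scaled (p ^ D) c s = scaled (p ^ D) c t := by
  refine scaled_eq_of_isGrouping hk hc (powers_pos hp Y) hY ?_ (by simpa [powers] using hcard) hs ht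
  rw [padicValNat_dvd_iff_le (factProd_pos _).ne',
    padicValNat_factProd_powers (fun e he => le_of_mem_of_sum_powers hp hY he)]
  exact hD

/-- Induction on the `ℓ¹`-distance `N` between the floor-sum coordinates of `Y` and `Y'`. If the
valuations differ, the smaller side is merged towards the other; if they agree and `Y ≠ Y'`, one
side is split. Each move decreases the distance by one. A grouping of the merged multiset is also
one of the multiset before merging, which carries the scaled value along. -/
theorem scaled_eq_of_powers [hp' : Fact p.Prime] (hk : 0 < k) (hc : IsPartitionCocycle k n c)
    (N : ℕ) : ∀ (Y Y' s t : Multiset ℕ),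
      ∑ i ∈ Finset.range n, (((floorSum p (i + 1) Y : ℤ) - floorSum p (i + 1) Y').natAbs) ≤ N →
      (powers p Y).sum = n → (powers p Y').sum = n → k ≤ Y.card → k ≤ Y'.card →
      D ≤ floorTotal p n Y → D ≤ floorTotal p n Y' →
      (D + 1 ≤ floorTotal p n Y ∨ D + 1 ≤ floorTotal p n Y') →
      IsGrouping k (powers p Y) s → IsGrouping k (powers p Y') t →
      scaled (p ^ D) c s = scaled (p ^ D) c t := by
  have hp := hp'.out.two_le
  induction N using Nat.strong_induction_on with
  | _ N ih =>
  intro Y Y' s t hN hY hY' hkY hkY' hD hD' hDD hs ht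
  wlog hle : floorTotal p n Y ≤ floorTotal p n Y' generalizing Y Y' s t
  · refine (this Y' Y t s ?_ hY' hY hkY' hkY hD' hD hDD.symm ht hs (by omega)).symm
    convert hN using 2
    rw [← Int.natAbs_neg, neg_sub]
  have hlt : ∀ e ∈ Y, e < n := fun e he => le_of_mem_of_sum_powers hp hY he
  have hlt' : ∀ e ∈ Y', e < n := fun e he => le_of_mem_of_sum_powers hp hY' he
  rcases hle.lt_or_eq with h | h
  · obtain ⟨i, _, hi⟩ := Finset.exists_lt_of_sum_lt h
    obtain ⟨j, Z, rfl, hj⟩ := exists_merge hp (hY.trans hY'.symm) ⟨_, hi⟩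
    have hjn : j < n := hlt j (by
      rw [Multiset.mem_add]; left; rw [Multiset.mem_replicate]; exact ⟨by omega, rfl⟩)
    have hT := floorTotal_merge hp hjn Z
    have hY1 : (powers p ((j + 1) ::ₘ Z)).sum = n := by rw [sum_powers_merge, hY]
    -- The merged multiset has valuation at most that of `Y'`, hence at least as many elements as
    -- `Y'`.
    have hcard : k ≤ ((j + 1) ::ₘ Z).card := by
      by_contra hcon
      rcases (show floorTotal p n ((j + 1) ::ₘ Z) ≤ floorTotal p n Y' by omega).lt_or_eq with h | h
      · have := card_lt_of_floorTotal_lt hp hY1 hY' h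
        omega
      · have h1 := card_add_mul_floorTotal hp (fun e he => le_of_mem_of_sum_powers hp hY1 he)
        have h2 := card_add_mul_floorTotal hp hlt'
        rw [hY1] at h1
        rw [hY'] at h2
        rw [h] at h1
        omega
    have hcard2 := card_lt_of_floorTotal_lt hp hY hY1 (by omega)
    obtain ⟨r, hr⟩ := exists_isGrouping hk (X := powers p ((j + 1) ::ₘ Z))
      (by simpa [powers] using hcard)
    rw [scaled_eq_of_isGrouping_powers hp hk hc hY (by omega) hD hs (hr.of_merge hp)]
    refine ih _ ?_ ((j + 1) ::ₘ Z) Y' r t le_rfl hY1 hY' hcard hkY' (by omega) hD' (by omega) hr ht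
    refine lt_of_lt_of_le (Finset.sum_lt_sum ?_ ⟨j, by simpa using hjn, ?_⟩) hN
    · intro i _
      rw [floorSum_merge hp]
      by_cases hij : i = j
      · subst hij; simp only [if_true]; omega
      · simp [hij]
    · rw [floorSum_merge hp]
      simp only [if_true]
      omega
  · rcases eq_or_ne Y Y' with rfl | hne
    · rcases hkY.eq_or_lt with hcard | hcard
      · rw [hs.eq_of_card_eq (by simp [powers, hcard]), ht.eq_of_card_eq (by simp [powers, hcard])]
      · exact scaled_eq_of_isGrouping_powers hp hk hc hY hcard hD hs ht
    -- The valuations are equal and one of them is at least `D + 1`, so both are. The split side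
    -- stays at least `D` and the untouched side supplies the strict bound.
    · rcases exists_split hp (hY.trans hY'.symm) hne with ⟨j, Z, rfl, hj⟩ | ⟨j, Z, rfl, hj⟩
      · have hjn : j < n := (Nat.lt_succ_self j).trans (hlt' _ (by simp))
        have hT := floorTotal_merge hp hjn Z
        have hY1 : (powers p (Multiset.replicate p j + Z)).sum = n := by
          rw [← sum_powers_merge, hY']
        have hcard := card_lt_of_floorTotal_lt hp hY1 hY' (by omega)
        refine ih _ ?_ Y (Multiset.replicate p j + Z) s t le_rfl hY hY1 hkY (by omega) hD (by omega)
          (by omega) hs (ht.of_merge hp)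
        refine lt_of_lt_of_le (Finset.sum_lt_sum ?_ ⟨j, by simpa using hjn, ?_⟩) hN
        · intro i _
          rw [floorSum_merge hp] at hj ⊢
          by_cases hij : i = j
          · subst hij; simp only [if_true] at hj ⊢; omega
          · simp [hij]
        · rw [floorSum_merge hp] at hj ⊢
          simp only [if_true] at hj ⊢
          omega
      · have hjn : j < n := (Nat.lt_succ_self j).trans (hlt _ (by simp))
        have hT := floorTotal_merge hp hjn Z
        have hY1 : (powers p (Multiset.replicate p j + Z)).sum = n := by
          rw [← sum_powers_merge, hY]
        have hcard := card_lt_of_floorTotal_lt hp hY1 hY (by omega)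
        refine ih _ ?_ (Multiset.replicate p j + Z) Y' s t le_rfl hY1 hY' (by omega) hkY' (by omega)
          hD' (by omega) (hs.of_merge hp) ht
        refine lt_of_lt_of_le (Finset.sum_lt_sum ?_ ⟨j, by simpa using hjn, ?_⟩) hN
        · intro i _
          rw [floorSum_merge hp] at hj ⊢
          by_cases hij : i = j
          · subst hij; simp only [if_true] at hj ⊢; omega
          · simp [hij]
        · rw [floorSum_merge hp] at hj ⊢
          simp only [if_true] at hj ⊢
          omega

theorem exists_floorSum_eq_div (hp : 2 ≤ p) (x : ℕ) :
    ∃ Y : Multiset ℕ, ∀ i, floorSum p i Y = x / p ^ i := by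
  induction x using Nat.strong_induction_on with
  | _ x ih =>
  rcases Nat.eq_zero_or_pos x with rfl | hx
  · exact ⟨0, by simp [floorSum]⟩
  · obtain ⟨Y, hY⟩ := ih (x / p) (Nat.div_lt_self hx hp)
    refine ⟨Multiset.replicate (x % p) 0 + Y.map (· + 1), fun i => ?_⟩
    have hmap : ∀ i, floorSum p i (Y.map (· + 1)) = (Y.map fun e => p ^ (e + 1) / p ^ i).sum := by
      intro i
      simp [floorSum]
    rw [floorSum_add, floorSum_replicate, hmap]
    rcases i with _ | i
    · have := hY 0
      simp only [floorSum, pow_zero, Nat.div_one] at this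
      simp only [pow_zero, Nat.div_one, mul_one, pow_succ, Multiset.sum_map_mul_right, this]
      rw [mul_comm]
      exact Nat.mod_add_div x p
    · have := hY i
      simp only [floorSum] at this
      have h0 : p ^ 0 / p ^ (i + 1) = 0 :=
        Nat.div_eq_of_lt (Nat.pow_lt_pow_right hp (Nat.succ_pos i))
      rw [h0, mul_zero, zero_add]
      simp only [pow_succ, Nat.mul_div_mul_right _ _ (show 0 < p by omega), this]
      rw [mul_comm, Nat.div_div_eq_div_mul]

/-- Each part `x` is replaced by its base-`p` expansion. The floor sums of the expansion are `x / p
^ i`, so Legendre's formula gives the same valuation for `x !` and for its atoms: no carries occur.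
-/
theorem exists_powers_isGrouping [hp' : Fact p.Prime] {s : Multiset ℕ} (hs : ∀ x ∈ s, 0 < x) :
    ∃ Y : Multiset ℕ, IsGrouping s.card (powers p Y) s ∧
      padicValNat p (factProd (powers p Y)) = padicValNat p (factProd s) := by
  have hp := hp'.out.two_le
  induction s using Multiset.induction with
  | empty => exact ⟨0, ⟨0, by simp [powers]⟩, by simp [powers]⟩
  | cons x s ih =>
    obtain ⟨Y, ⟨B, hB, hB0, hBX, hBs⟩, hv⟩ := ih fun x hx => hs x (by simp [hx])
    obtain ⟨Z, hZ⟩ := exists_floorSum_eq_div hp x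
    have hsum : (powers p Z).sum = x := by rw [← floorSum_zero, hZ]; simp
    have hmul : padicValNat p (factProd (powers p Z)) = padicValNat p x.factorial := by
      rw [padicValNat_factProd_powers (fun e he => le_of_mem_of_sum_powers hp hsum he), floorTotal,
        padicValNat_factorial (b := x + 1) ((Nat.log_le_self p x).trans_lt (Nat.lt_succ_self x)),
        Finset.sum_Ico_eq_sum_range]
      simp [hZ, add_comm]
    have hadd : powers p (Z + Y) = powers p Z + powers p Y := by simp [powers]
    refine ⟨Z + Y, ⟨powers p Z ::ₘ B, by simp [hB], ?_, by rw [hadd, Multiset.join_cons, hBX],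
      by rw [Multiset.map_cons, hsum, hBs]⟩, ?_⟩
    · intro β hβ
      rcases Multiset.mem_cons.1 hβ with rfl | h
      · intro h0
        have := hs x (by simp)
        rw [h0] at hsum
        simp at hsum
        omega
      · exact hB0 β h
    · rw [hadd, factProd_add, padicValNat.mul (factProd_pos _).ne' (factProd_pos _).ne',
        padicValNat_factProd_cons, hmul, hv]

theorem IsParts.exists_powers [hp' : Fact p.Prime] {s : Multiset ℕ} (hs : IsParts k n s) :
    ∃ Y : Multiset ℕ, IsGrouping k (powers p Y) s ∧ (powers p Y).sum = n ∧ k ≤ Y.card ∧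
      floorTotal p n Y = padicValNat p (factProd s) := by
  obtain ⟨rfl, rfl, h0⟩ := hs
  obtain ⟨Y, hY, hv⟩ := exists_powers_isGrouping (p := p) h0
  refine ⟨Y, hY, hY.sum_eq.symm, ?_, ?_⟩
  · obtain ⟨B, hB, hB0, hBX, hBs⟩ := hY
    have h1 : Y.card = (B.map Multiset.card).sum := by
      rw [← Multiset.card_join, hBX]; simp [powers]
    have h2 : ∀ x ∈ B.map Multiset.card, 1 ≤ x := by
      intro x hx
      obtain ⟨β, hβ, rfl⟩ := Multiset.mem_map.1 hx
      exact Multiset.card_pos.2 (hB0 β hβ)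
    have := Multiset.card_nsmul_le_sum h2
    rw [← h1] at this
    simpa [hB] using this
  · rw [← hv, padicValNat_factProd_powers
      (fun e he => le_of_mem_of_sum_powers hp'.out.two_le hY.sum_eq.symm he)]

theorem scaled_eq_of_lt [Fact p.Prime] (hk : 0 < k) (hc : IsPartitionCocycle k n c)
    {s t : Multiset ℕ} (hs : IsParts k n s) (ht : IsParts k n t)
    (hD : D ≤ padicValNat p (factProd s)) (hD' : D + 1 ≤ padicValNat p (factProd t)) :
    scaled (p ^ D) c s = scaled (p ^ D) c t := by
  obtain ⟨Y, h1, h2, h3, h4⟩ := hs.exists_powers (p := p)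
  obtain ⟨Y', h1', h2', h3', h4'⟩ := ht.exists_powers (p := p)
  exact scaled_eq_of_powers hk hc _ Y Y' s t le_rfl h2 h2' h3 h3' (by omega) (by omega) (by omega)
    h1 h1'

/-- For two parts, partitions into powers of `p` with the least number of powers are unique. -/
theorem scaled_eq_of_two [hp' : Fact p.Prime] (hc : IsPartitionCocycle 2 n c)
    {s t : Multiset ℕ} (hs : IsParts 2 n s) (ht : IsParts 2 n t)
    (hD : padicValNat p (factProd s) = D) (hD' : padicValNat p (factProd t) = D)
    (hmax : ∀ r, IsParts 2 n r → padicValNat p (factProd r) ≤ D) :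
    scaled (p ^ D) c s = scaled (p ^ D) c t := by
  have hp := hp'.out.two_le
  obtain ⟨Y, h1, h2, h3, h4⟩ := hs.exists_powers (p := p)
  obtain ⟨Y', h1', h2', h3', h4'⟩ := ht.exists_powers (p := p)
  -- If `Y ≠ Y'` have the same valuation, `p` copies of some `j` in `Y` can be merged. Were anything
  -- else left in `Y`, the merged multiset would still have two elements and would yield a pair of
  -- valuation above the maximum. So `Y` consists of `p` equal atoms, and by symmetry so does `Y'`;
  -- their equal sums then force `Y = Y'`.
  have key : ∀ Y Y' : Multiset ℕ, (powers p Y).sum = n → (powers p Y').sum = n →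
      floorTotal p n Y = D → floorTotal p n Y' = D → Y ≠ Y' →
      ∃ j, Y = Multiset.replicate p j := by
    intro Y Y' hY hY' hYD hYD' hne
    have hlt : ∀ e ∈ Y, e < n := fun e he => le_of_mem_of_sum_powers hp hY he
    have hlt' : ∀ e ∈ Y', e < n := fun e he => le_of_mem_of_sum_powers hp hY' he
    obtain ⟨i, hi⟩ : ∃ i, floorSum p i Y < floorSum p i Y' := by
      by_contra hcon
      push Not at hcon
      refine hne (eq_of_floorSum_eq hp fun i => ?_)
      rcases i with _ | i
      · rw [floorSum_zero, floorSum_zero, hY, hY']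
      · by_contra hi
        have hin : i < n := by
          by_contra hin
          exact hi (by rw [floorSum_eq_zero hp hlt (by omega), floorSum_eq_zero hp hlt' (by omega)])
        have : floorTotal p n Y' < floorTotal p n Y :=
          Finset.sum_lt_sum (fun i _ => hcon (i + 1))
            ⟨i, by simpa using hin, lt_of_le_of_ne (hcon _) (Ne.symm hi)⟩
        omega
    obtain ⟨j, Z, rfl, _⟩ := exists_merge hp (hY.trans hY'.symm) ⟨i, hi⟩
    refine ⟨j, ?_⟩
    have hjn : j < n := hlt j (by
      rw [Multiset.mem_add]; left; rw [Multiset.mem_replicate]; exact ⟨by omega, rfl⟩)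
    rcases eq_or_ne Z 0 with rfl | hZ
    · simp
    · have hY1 : (powers p ((j + 1) ::ₘ Z)).sum = n := by rw [sum_powers_merge, hY]
      obtain ⟨r, hr⟩ := exists_isGrouping two_pos (X := powers p ((j + 1) ::ₘ Z)) (by
        have := Multiset.card_pos.2 hZ
        simp only [powers, Multiset.card_map, Multiset.card_cons]
        omega)
      have hr' := hr.isParts (powers_pos hp _)
      rw [hY1] at hr'
      have h5 := hmax r hr'
      have h6 := (padicValNat_dvd_iff_le (factProd_pos _).ne').1
        (pow_padicValNat_dvd.trans hr.factProd_dvd : p ^ padicValNat p (factProd _) ∣ _)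
      rw [padicValNat_factProd_powers (fun e he => le_of_mem_of_sum_powers hp hY1 he),
        floorTotal_merge hp hjn] at h6
      omega
  have hYY : Y = Y' := by
    by_contra hne
    obtain ⟨i, rfl⟩ := key Y Y' h2 h2' (by omega) (by omega) hne
    obtain ⟨j, rfl⟩ := key Y' _ h2' h2 (by omega) (by omega) (Ne.symm hne)
    have : p * p ^ i = p * p ^ j := by simpa [powers] using h2.trans h2'.symm
    have := Nat.eq_of_mul_eq_mul_left (by omega) this
    rw [Nat.pow_right_injective hp this] at hne
    exact hne rfl
  subst hYY
  rcases h3.eq_or_lt with hcard | hcard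
  · rw [h1.eq_of_card_eq (by simp [powers, hcard]), h1'.eq_of_card_eq (by simp [powers, hcard])]
  · exact scaled_eq_of_isGrouping_powers hp two_pos hc h2 hcard (by omega) h1 h1'

end Atoms

/-! ### Torsion of the minors at one prime -/

section Annihilation

variable {A : Type*} [AddCommGroup A] {k n : ℕ} {c : Multiset ℕ → A}

/-- With `factProd s = D a` and `factProd t = D b`, the hypotheses read `a c(s) = b c(t)` and `x a =
y b`, whence `a (y c(s) - x c(t)) = (y b - x a) c(t) = 0`. -/
theorem smul_sub_eq_zero_of_scaled_eq {D : ℕ} (hD : 0 < D) {s t : Multiset ℕ} {x y : ℤ}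
    (h : scaled D c s = scaled D c t) (hs : D ∣ factProd s) (ht : D ∣ factProd t)
    (hxy : x * factProd s = y * factProd t) : (factProd s / D) • (y • c s - x • c t) = 0 := by
  obtain ⟨a, ha⟩ := hs
  obtain ⟨b, hb⟩ := ht
  rw [scaled, scaled, ha, hb, Nat.mul_div_cancel_left _ hD, Nat.mul_div_cancel_left _ hD] at h
  rw [ha, hb] at hxy
  have hxy' : x * a = y * b := by
    have : (D : ℤ) ≠ 0 := by exact_mod_cast hD.ne'
    apply mul_left_cancel₀ this
    push_cast at hxy
    linarith
  rw [ha, Nat.mul_div_cancel_left _ hD, smul_sub, smul_comm, h]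
  have h1 : y • b • c t = (y * b) • c t := by rw [mul_smul, natCast_zsmul]
  have h2 : a • x • c t = (x * a) • c t := by rw [mul_comm, mul_smul, natCast_zsmul]
  rw [h1, h2, hxy', sub_self]

/-- In the application `x` and `y` are values of an integral cocycle: where it is prime to `p`, the
factorial product has maximal `p`-adic valuation. -/
theorem padicValNat_factProd_le {p : ℕ} [hp : Fact p.Prime] {s t : Multiset ℕ} {x y : ℤ}
    (hy : ¬ (p : ℤ) ∣ y) (hxy : x * factProd s = y * factProd t) :
    padicValNat p (factProd s) ≤ padicValNat p (factProd t) := by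
  rw [← padicValNat_dvd_iff_le (factProd_pos _).ne']
  have h1 : ((p ^ padicValNat p (factProd s) : ℕ) : ℤ) ∣ factProd t * y := by
    rw [mul_comm, ← hxy]
    exact Dvd.dvd.mul_left (Int.natCast_dvd_natCast.2 pow_padicValNat_dvd) _
  have h2 : IsCoprime ((p ^ padicValNat p (factProd s) : ℕ) : ℤ) y := by
    push_cast
    exact IsCoprime.pow_left ((Prime.coprime_iff_not_dvd
      (Nat.prime_iff_prime_int.1 hp.out)).2 hy)
  exact_mod_cast h2.dvd_of_dvd_mul_right h1

/-- Up to factors prime to `p`, the 2 × 2 minors of a cocycle and an integral cocycle `z` are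
killed by `p`, and by `1` in several cases. -/
theorem exists_smul_minor_eq_zero {p : ℕ} [hp : Fact p.Prime] (hk : 2 ≤ k)
    (hc : IsPartitionCocycle k n c) {z : Multiset ℕ → ℤ}
    (hz : ∀ s t, IsParts k n s → IsParts k n t → z s * factProd s = z t * factProd t)
    {s t : Multiset ℕ} (hs : IsParts k n s) (ht : IsParts k n t) (hzt : ¬ (p : ℤ) ∣ z t) :
    ∃ m : ℕ, ¬ p ∣ m ∧ (p * m) • (z t • c s - z s • c t) = 0 ∧
      ((p : ℤ) ∣ z s ∨ k = 2 ∨ n < p → m • (z t • c s - z s • c t) = 0) := by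
  have hxy := hz s t hs ht
  have hle := padicValNat_factProd_le hzt hxy
  have hFs := (factProd_pos s).ne'
  have hdvd := pow_padicValNat_dvd (p := p) (n := factProd s)
  have hpp : ∀ v, 0 < p ^ v := fun v => pow_pos hp.out.pos v
  have hm : ¬ p ∣ factProd s / p ^ padicValNat p (factProd s) := by
    intro h
    rw [Nat.dvd_div_iff_mul_dvd hdvd, ← pow_succ] at h
    exact pow_succ_padicValNat_not_dvd hFs h
  -- The multiplier `m` is the part of `factProd s` prime to `p`.
  refine ⟨_, hm, ?_⟩
  have main : ((p : ℤ) ∣ z s ∨ k = 2 ∨ n < p ∨ padicValNat p (factProd s) = 0 →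
      (factProd s / p ^ padicValNat p (factProd s)) • (z t • c s - z s • c t) = 0) := by
    intro hor
    rcases hle.lt_or_eq with hlt | heq
    · exact smul_sub_eq_zero_of_scaled_eq (hpp _)
        (scaled_eq_of_lt (by omega) hc hs ht le_rfl hlt) hdvd
        ((padicValNat_dvd_iff_le (factProd_pos _).ne').2 hle) hxy
    -- The valuations at `s` and `t` now agree, so `z s` and `z t` differ by a `p`-adic unit, which
    -- excludes `p ∣ z s`. For `k = 2` both valuations are maximal and `scaled_eq_of_two` applies;
    -- otherwise the valuation is zero and the scaling by `D = 1` suffices.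
    rcases hor with h | rfl | h | h
    · obtain ⟨a, ha⟩ := hdvd
      obtain ⟨b, hb⟩ := pow_padicValNat_dvd (p := p) (n := factProd t)
      rw [← heq] at hb
      have hbp : ¬ p ∣ b := by
        rintro ⟨b, rfl⟩
        refine pow_succ_padicValNat_not_dvd (p := p) (factProd_pos t).ne' ?_
        rw [← heq, pow_succ]
        exact ⟨b, by rw [mul_assoc]; exact hb⟩
      have h1 : z s * a = z t * b := by
        have : ((p ^ padicValNat p (factProd s) : ℕ) : ℤ) ≠ 0 := by exact_mod_cast (hpp _).ne'
        apply mul_left_cancel₀ this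
        have ha' := congrArg (Nat.cast : ℕ → ℤ) ha
        have hb' := congrArg (Nat.cast : ℕ → ℤ) hb
        rw [Nat.cast_mul] at ha' hb'
        rw [ha', hb'] at hxy
        linarith
      rcases (Nat.prime_iff_prime_int.1 hp.out).dvd_or_dvd (h1 ▸ Dvd.dvd.mul_right h _) with h | h
      · exact absurd h hzt
      · exact absurd (Int.natCast_dvd_natCast.1 h) hbp
    · exact smul_sub_eq_zero_of_scaled_eq (hpp _)
        (scaled_eq_of_two hc hs ht rfl heq.symm fun r hr => by
          rw [heq]; exact padicValNat_factProd_le hzt (hz r t hr ht)) hdvd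
        ((padicValNat_dvd_iff_le (factProd_pos _).ne').2 hle) hxy
    all_goals
      have h0 : padicValNat p (factProd s) = 0 := by
        first
        | exact h
        | refine padicValNat.eq_zero_of_not_dvd fun hd => ?_
          have h1 := factProd_dvd_factorial_sum s
          rw [hs.2.1] at h1
          have := (hp.out.dvd_factorial).1 (hd.trans h1)
          omega
      rw [h0, pow_zero]
      exact smul_sub_eq_zero_of_scaled_eq one_pos
        (by simpa [scaled] using factProd_smul_eq (by omega) hc hs ht) (one_dvd _) (one_dvd _) hxy
  refine ⟨?_, fun h => main (by tauto)⟩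
  by_cases h0 : padicValNat p (factProd s) = 0
  · rw [mul_smul, main (by tauto), smul_zero]
  rcases hle.lt_or_eq with hlt | heq
  · rw [mul_smul, smul_sub_eq_zero_of_scaled_eq (hpp _)
      (scaled_eq_of_lt (by omega) hc hs ht le_rfl hlt) hdvd
      ((padicValNat_dvd_iff_le (factProd_pos _).ne').2 hle) hxy, smul_zero]
  -- Equal positive valuations `v + 1`: lowering the exponent to `v` provides the strict inequality
  -- required by `scaled_eq_of_lt`, at the cost of one factor `p`.
  · obtain ⟨v, hv⟩ := Nat.exists_eq_succ_of_ne_zero h0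
    have h1 : p ^ v ∣ factProd s := (padicValNat_dvd_iff_le hFs).2 (by omega)
    have := smul_sub_eq_zero_of_scaled_eq (hpp v)
      (scaled_eq_of_lt (p := p) (D := v) (by omega) hc hs ht (by omega) (by omega)) h1
      ((padicValNat_dvd_iff_le (factProd_pos _).ne').2 (by omega)) hxy
    have e : p * (factProd s / p ^ padicValNat p (factProd s)) = factProd s / p ^ v := by
      rw [hv] at hdvd ⊢
      rw [Nat.succ_eq_add_one, pow_succ] at hdvd ⊢
      obtain ⟨a, ha⟩ := hdvd
      have h2 : 0 < p ^ v * p := Nat.mul_pos (hpp v) hp.out.pos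
      rw [ha, Nat.mul_div_cancel_left _ h2, mul_assoc, Nat.mul_div_cancel_left _ (hpp v)]
    rw [e]
    exact this

end Annihilation

/-! ### Binary linear relations and their indecomposable solutions over a field -/

/-- A system of linear relations `a e • c (src e) = b e • c (tgt e)` between pairs of the values of
functions `c` on `Λ`. -/
structure Relations (Λ : Type*) where
  Edge : Type
  src : Edge → Λ
  tgt : Edge → Λ
  a : Edge → ℕ
  b : Edge → ℕ

namespace Relations

variable {Λ : Type*} (r : Relations Λ)

/-- The solutions of a system of relations with values in an abelian group. -/
def IsSol {A : Type*} [AddCommGroup A] (c : Λ → A) : Prop :=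
  ∀ e, r.a e • c (r.src e) = r.b e • c (r.tgt e)

variable {r}

theorem IsSol.add {A : Type*} [AddCommGroup A] {c d : Λ → A} (hc : r.IsSol c) (hd : r.IsSol d) :
    r.IsSol (c + d) := fun e => by
  rw [Pi.add_apply, Pi.add_apply, smul_add, smul_add, hc e, hd e]

theorem IsSol.comp {A B : Type*} [AddCommGroup A] [AddCommGroup B] {c : Λ → A} (hc : r.IsSol c)
    (φ : A →+ B) : r.IsSol (φ ∘ c) := fun e => by
  rw [Function.comp_apply, Function.comp_apply, ← map_nsmul, ← map_nsmul, hc e]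

variable (r)

/-- The space of solutions of a system of relations with values in a ring. -/
def sol (K : Type*) [CommRing K] : Submodule K (Λ → K) where
  carrier := {c | r.IsSol c}
  add_mem' := IsSol.add
  zero_mem' := fun e => by simp
  smul_mem' x c hc := hc.comp (AddMonoidHom.mulLeft x)

/-- A nonzero solution is indecomposable if it is not a sum of two nonzero solutions with
complementary supports. -/
def IsIndecomposable {K : Type*} [CommRing K] (f : Λ → K) : Prop :=
  f ∈ r.sol K ∧ f ≠ 0 ∧ ¬ ∃ (S : Set Λ) (f₁ f₂ : Λ → K), f₁ ∈ r.sol K ∧ f₂ ∈ r.sol K ∧ f₁ ≠ 0 ∧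
    f₂ ≠ 0 ∧ (∀ x ∉ S, f₁ x = 0) ∧ (∀ x ∈ S, f₂ x = 0) ∧ f₁ + f₂ = f

/-- A basis of the solutions that lists the indecomposable solutions up to scalars. -/
structure IsIndecomposableBasis {K : Type*} [CommRing K] {ι : Type*} (β : ι → Λ → K) : Prop where
  indecomposable : ∀ i, r.IsIndecomposable (β i)
  complete : ∀ f, r.IsIndecomposable f → ∃ (i : ι) (c : K), f = c • β i
  linearIndependent : LinearIndependent K β
  span_eq : Submodule.span K (Set.range β) = r.sol K

section Field

variable {K : Type*} [Field K] {r} {z : Λ → K}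

variable (r z) in
/-- The points at which all solutions are proportional to `z` with the same factor as at `x`. -/
def component (x : Λ) : Set Λ := {y | z y ≠ 0 ∧ ∀ f ∈ r.sol K, f x * z y = f y * z x}

theorem mem_component_self {x : Λ} (hx : z x ≠ 0) : x ∈ component r z x := ⟨hx, fun _ _ => rfl⟩

theorem component_eq {x y : Λ} (hx : z x ≠ 0) (h : y ∈ component r z x) :
    component r z y = component r z x := by
  ext w
  refine ⟨fun hw => ⟨hw.1, fun f hf => ?_⟩, fun hw => ⟨hw.1, fun f hf => ?_⟩⟩
  · apply mul_right_cancel₀ h.1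
    linear_combination (z w) * h.2 f hf + z x * hw.2 f hf
  · apply mul_right_cancel₀ hx
    linear_combination -(z w) * h.2 f hf + z y * hw.2 f hf

-- A relation with one end in the component and one outside imposes nothing on `f` across the
-- boundary: if its two equal sides were nonzero, both weights would be invertible, proportionality
-- to `z` would pass along the edge, and the other end would lie in the component as well.
open Classical in
theorem indicator_component_mem (hz : z ∈ r.sol K) {f : Λ → K} (hf : f ∈ r.sol K) (x : Λ) :
    (component r z x).indicator f ∈ r.sol K := by
  intro e
  have hfe := hf e
  have hze := hz e
  simp only [nsmul_eq_mul] at hfe hze ⊢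
  by_cases h1 : r.src e ∈ component r z x <;> by_cases h2 : r.tgt e ∈ component r z x <;>
    simp only [Set.indicator_of_mem, Set.indicator_of_notMem, h1, h2, not_false_eq_true, hfe,
      mul_zero]
  · by_contra hne
    have hb : (r.b e : K) ≠ 0 := left_ne_zero_of_mul hne
    have ha : (r.a e : K) ≠ 0 := left_ne_zero_of_mul (hfe ▸ hne)
    refine h2 ⟨fun h0 => ?_, fun g hg => ?_⟩
    · rw [h0, mul_zero] at hze
      exact (mul_ne_zero ha h1.1) hze
    · have hge := hg e
      simp only [nsmul_eq_mul] at hge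
      apply mul_left_cancel₀ hb
      linear_combination -(g x) * hze + r.a e * h1.2 g hg + z x * hge
  · by_contra hne
    have hb : (r.b e : K) ≠ 0 := left_ne_zero_of_mul (Ne.symm hne)
    have ha : (r.a e : K) ≠ 0 := left_ne_zero_of_mul (hfe ▸ Ne.symm hne)
    refine h1 ⟨fun h0 => ?_, fun g hg => ?_⟩
    · rw [h0, mul_zero] at hze
      exact (mul_ne_zero hb h2.1) hze.symm
    · have hge := hg e
      simp only [nsmul_eq_mul] at hge
      apply mul_left_cancel₀ ha
      linear_combination (g x) * hze + r.b e * h2.2 g hg - z x * hge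

/-- Restricting `f` to the component of a point of its support, and to the complement, splits `f`
into solutions with complementary supports. Indecomposability kills the second piece, and on a
component every solution is a multiple of `z`. -/
theorem eq_smul_of_isIndecomposable (hz : z ∈ r.sol K)
    (hsupp : ∀ f ∈ r.sol K, ∀ x, z x = 0 → f x = 0) {f : Λ → K} (hf : r.IsIndecomposable f) :
    ∃ (x : Λ) (c : K), z x ≠ 0 ∧ c ≠ 0 ∧ f = c • (component r z x).indicator z := by
  classical
  obtain ⟨hfs, hf0, hf⟩ := hf
  obtain ⟨x, hx⟩ := Function.ne_iff.1 hf0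
  have hzx : z x ≠ 0 := fun h => hx (hsupp f hfs x h)
  have h1 := indicator_component_mem hz hfs x
  have h2 : f - (component r z x).indicator f = 0 := by
    by_contra hne
    refine hf ⟨component r z x, _, _, h1, Submodule.sub_mem _ hfs h1, ?_, hne, ?_, ?_, by abel⟩
    · refine Function.ne_iff.2 ⟨x, ?_⟩
      rw [Set.indicator_of_mem (mem_component_self hzx)]
      exact hx
    · intro y hy
      rw [Set.indicator_of_notMem hy]
    · intro y hy
      rw [Pi.sub_apply, Set.indicator_of_mem hy, sub_self]
  refine ⟨x, f x / z x, hzx, div_ne_zero hx hzx, ?_⟩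
  rw [sub_eq_zero] at h2
  nth_rw 1 [h2]
  ext y
  by_cases hy : y ∈ component r z x
  · rw [Pi.smul_apply, Set.indicator_of_mem hy, Set.indicator_of_mem hy, smul_eq_mul,
      div_mul_eq_mul_div, eq_div_iff hzx, hy.2 f hfs]
  · rw [Pi.smul_apply, Set.indicator_of_notMem hy, Set.indicator_of_notMem hy, smul_zero]

/-- A nonzero solution supported in the component is a nonzero multiple of `z` there, hence nonzero
at `x`. Two such solutions cannot have disjoint supports. -/
theorem isIndecomposable_indicator (hz : z ∈ r.sol K) {x : Λ} (hx : z x ≠ 0) :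
    r.IsIndecomposable ((component r z x).indicator z) := by
  classical
  refine ⟨indicator_component_mem hz hz x, Function.ne_iff.2 ⟨x, ?_⟩, ?_⟩
  · rw [Set.indicator_of_mem (mem_component_self hx)]
    exact hx
  rintro ⟨S, f₁, f₂, h₁, h₂, h₁0, h₂0, hS₁, hS₂, h⟩
  have hout : ∀ y ∉ component r z x, f₁ y = 0 ∧ f₂ y = 0 := by
    intro y hy
    have := congrFun h y
    rw [Set.indicator_of_notMem hy, Pi.add_apply] at this
    by_cases hyS : y ∈ S
    · rw [hS₂ y hyS, add_zero] at this
      exact ⟨this, hS₂ y hyS⟩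
    · rw [hS₁ y hyS, zero_add] at this
      exact ⟨hS₁ y hyS, this⟩
  have hval : ∀ g ∈ r.sol K, g ≠ 0 → (∀ y ∉ component r z x, g y = 0) → g x ≠ 0 := by
    intro g hg hg0 hout hgx
    obtain ⟨y, hy⟩ := Function.ne_iff.1 hg0
    have hyC : y ∈ component r z x := by
      by_contra hc
      exact hy (hout y hc)
    have := hyC.2 g hg
    rw [hgx, zero_mul] at this
    exact (mul_ne_zero hy hx) this.symm
  have e1 := hval f₁ h₁ h₁0 fun y hy => (hout y hy).1
  have e2 := hval f₂ h₂ h₂0 fun y hy => (hout y hy).2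
  by_cases hxS : x ∈ S
  · exact e2 (hS₂ x hxS)
  · exact e1 (hS₁ x hxS)

/-- The components partition the support of `z`. The basis consists of the restrictions of `z` to
them, and a solution has coordinate `f / z` evaluated at a representative `pt c` of each component.
-/
theorem exists_isIndecomposableBasis [Finite Λ] (hz : z ∈ r.sol K) (hz0 : z ≠ 0)
    (hsupp : ∀ f ∈ r.sol K, ∀ x, z x = 0 → f x = 0) :
    ∃ (m : ℕ) (β : Fin (m + 1) → Λ → K), r.IsIndecomposableBasis β := by
  classical
  have _ := Fintype.ofFinite Λ
  let C : Type _ := {C : Set Λ // ∃ x, z x ≠ 0 ∧ component r z x = C}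
  have _ : Fintype C := Fintype.ofFinite C
  have hC : Nonempty C := by
    obtain ⟨x, hx⟩ := Function.ne_iff.1 hz0
    exact ⟨⟨_, x, hx, rfl⟩⟩
  choose pt hpt0 hpt using fun c : C => c.2
  have hself : ∀ c : C, pt c ∈ c.1 := fun c => hpt c ▸ mem_component_self (hpt0 c)
  have hdisj : ∀ (c d : C) (x : Λ), x ∈ c.1 → x ∈ d.1 → c = d := by
    intro c d x hc hd
    apply Subtype.ext
    rw [← hpt c, ← hpt d]
    rw [← hpt c] at hc
    rw [← hpt d] at hd
    rw [← component_eq (hpt0 c) hc, component_eq (hpt0 d) hd]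
  let γ : C → Λ → K := fun c => c.1.indicator z
  have hγx : ∀ c x, γ c x = c.1.indicator z x := fun _ _ => rfl
  have hγ : ∀ c d : C, γ c (pt d) = if c = d then z (pt d) else 0 := by
    intro c d
    split_ifs with h
    · subst h
      exact Set.indicator_of_mem (hself _) _
    · exact Set.indicator_of_notMem (fun hc => h (hdisj _ _ _ hc (hself d))) _
  have hγi : ∀ c, r.IsIndecomposable (γ c) := by
    intro c
    have := isIndecomposable_indicator hz (hpt0 c)
    rwa [hpt c] at this
  have hbasis : r.IsIndecomposableBasis γ := by
    refine ⟨hγi, ?_, ?_, ?_⟩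
    · intro f hf
      obtain ⟨x, c, hx, _, h⟩ := eq_smul_of_isIndecomposable hz hsupp hf
      exact ⟨⟨_, x, hx, rfl⟩, c, h⟩
    · rw [Fintype.linearIndependent_iff]
      intro g hg d
      have := congrFun hg (pt d)
      rw [Finset.sum_apply, Finset.sum_eq_single d, Pi.smul_apply, hγ, if_pos rfl] at this
      · exact (mul_eq_zero.1 this).resolve_right (hpt0 d)
      · intro c _ hcd
        rw [Pi.smul_apply, hγ, if_neg hcd, smul_zero]
      · simp
    · apply le_antisymm
      · rw [Submodule.span_le]
        rintro _ ⟨c, rfl⟩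
        exact (hγi c).1
      · intro f hf
        have : f = ∑ c, (f (pt c) / z (pt c)) • γ c := by
          ext x
          rw [Finset.sum_apply]
          by_cases hx : z x = 0
          · rw [hsupp f hf x hx, Finset.sum_eq_zero]
            intro c _
            rw [Pi.smul_apply, hsupp _ (hγi c).1 x hx, smul_zero]
          · let d : C := ⟨_, x, hx, rfl⟩
            have hxd : x ∈ d.1 := mem_component_self hx
            rw [Finset.sum_eq_single d]
            · rw [Pi.smul_apply, hγx, Set.indicator_of_mem hxd, smul_eq_mul, div_mul_eq_mul_div,
                eq_div_iff (hpt0 d)]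
              have : x ∈ component r z (pt d) := by rw [hpt d]; exact hxd
              exact (this.2 f hf).symm
            · intro c _ hcd
              rw [Pi.smul_apply, hγx, Set.indicator_of_notMem fun hc => hcd (hdisj _ _ _ hc hxd),
                smul_zero]
            · simp
        rw [this]
        exact Submodule.sum_mem _ fun c _ => Submodule.smul_mem _ _
          (Submodule.subset_span ⟨c, rfl⟩)
  obtain ⟨m, hm⟩ := Nat.exists_eq_succ_of_ne_zero (Fintype.card_ne_zero (α := C))
  let e : Fin (m + 1) ≃ C := (Fintype.equivFinOfCardEq hm).symm
  refine ⟨m, γ ∘ e, fun i => hγi _, fun f hf => ?_, ?_, ?_⟩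
  · obtain ⟨c, a, h⟩ := hbasis.complete f hf
    exact ⟨e.symm c, a, by simpa using h⟩
  · exact hbasis.linearIndependent.comp _ e.injective
  · rw [EquivLike.range_comp]
    exact hbasis.span_eq

/-- All coordinates of `z` with respect to a basis of indecomposable solutions are nonzero. -/
theorem IsIndecomposableBasis.coord_ne_zero {ι : Type*} [Fintype ι] {β : ι → Λ → K}
    (hβ : r.IsIndecomposableBasis β) (hz : z ∈ r.sol K)
    (hsupp : ∀ f ∈ r.sol K, ∀ x, z x = 0 → f x = 0) {w : ι → K} (hw : ∑ i, w i • β i = z) (i : ι) :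
    w i ≠ 0 := by
  classical
  intro hi
  obtain ⟨x, c, hx, hc, h⟩ := eq_smul_of_isIndecomposable hz hsupp (hβ.indecomposable i)
  -- At a point `x` whose component carries `β i` the function `z` is nonzero, so some other `β j`
  -- with nonzero coordinate is nonzero there. Then `β i` and `β j` are multiples of `z` on the same
  -- component, contradicting independence.
  rw [← hw, Finset.sum_apply] at hx
  obtain ⟨j, _, hj⟩ := Finset.exists_ne_zero_of_sum_ne_zero hx
  obtain ⟨y, d, hy, hd, h'⟩ := eq_smul_of_isIndecomposable hz hsupp (hβ.indecomposable j)
  have hji : j ≠ i := by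
    rintro rfl
    simp [hi] at hj
  have hxy : x ∈ component r z y := by
    by_contra hc
    rw [h', Pi.smul_apply, Pi.smul_apply, Set.indicator_of_notMem hc] at hj
    simp at hj
  rw [← component_eq hy hxy] at h'
  have h0 : d⁻¹ • β j - c⁻¹ • β i = 0 := by
    rw [h, h', smul_smul, smul_smul, inv_mul_cancel₀ hd, inv_mul_cancel₀ hc, sub_self]
  have := (linearIndependent_iff'.1 hβ.linearIndependent) {j, i}
    (fun t => if t = j then d⁻¹ else - c⁻¹) (by
      rw [Finset.sum_pair hji]
      simp only [if_true, if_neg hji.symm, neg_smul]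
      rw [← sub_eq_add_neg]
      exact h0) j (by simp)
  simp only [if_true] at this
  exact inv_ne_zero hd this

/-- In a basis of indecomposable solutions the first vector can be replaced by `z`. -/
theorem IsIndecomposableBasis.cons_basis {m : ℕ} {β : Fin (m + 1) → Λ → K}
    (hβ : r.IsIndecomposableBasis β) (hz : z ∈ r.sol K)
    (hsupp : ∀ f ∈ r.sol K, ∀ x, z x = 0 → f x = 0) :
    LinearIndependent K (Fin.cons z (fun i => β i.succ) : Fin (m + 1) → Λ → K) ∧
    Submodule.span K (Set.range (Fin.cons z (fun i => β i.succ) : Fin (m + 1) → Λ → K)) =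
      r.sol K := by
  obtain ⟨w, hw⟩ := (Submodule.mem_span_range_iff_exists_fun K).1 (hβ.span_eq ▸ hz :
    z ∈ Submodule.span K (Set.range β))
  have hw0 := hβ.coord_ne_zero hz hsupp hw 0
  rw [Fin.sum_univ_succ] at hw
  have h0 : β 0 = (w 0)⁻¹ • (z - ∑ i : Fin m, w i.succ • β i.succ) := by
    rw [← hw, add_sub_cancel_right, smul_smul, inv_mul_cancel₀ hw0, one_smul]
  have hli := hβ.linearIndependent
  constructor
  · rw [Fintype.linearIndependent_iff] at hli ⊢
    intro g hg
    simp only [Fin.sum_univ_succ, Fin.cons_zero, Fin.cons_succ] at hg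
    have := hli (Fin.cons (g 0 * w 0) fun i => g 0 * w i.succ + g i.succ) (by
      rw [← hg, Fin.sum_univ_succ, ← hw]
      simp only [Fin.cons_zero, Fin.cons_succ, add_smul, mul_smul, Finset.sum_add_distrib,
        smul_add, Finset.smul_sum, add_assoc])
    have g0 : g 0 = 0 := by
      have h := this 0
      simpa [hw0] using h
    refine Fin.cases g0 fun i => ?_
    have h := this i.succ
    simpa [g0] using h
  · rw [← hβ.span_eq]
    apply le_antisymm
    · rw [Submodule.span_le]
      rintro _ ⟨i, rfl⟩
      refine Fin.cases ?_ (fun i => ?_) i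
      · rw [Fin.cons_zero, hβ.span_eq]
        exact hz
      · rw [Fin.cons_succ]
        exact Submodule.subset_span ⟨_, rfl⟩
    · rw [Submodule.span_le]
      rintro _ ⟨i, rfl⟩
      have hmem : ∀ i : Fin m, β i.succ ∈ Submodule.span K
          (Set.range (Fin.cons z (fun i => β i.succ) : Fin (m + 1) → Λ → K)) :=
        fun i => Submodule.subset_span ⟨i.succ, by rw [Fin.cons_succ]⟩
      refine Fin.cases ?_ hmem i
      rw [h0]
      refine Submodule.smul_mem _ _ (Submodule.sub_mem _
        (Submodule.subset_span ⟨0, by rw [Fin.cons_zero]⟩)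
        (Submodule.sum_mem _ fun i _ => Submodule.smul_mem _ _ (hmem i)))

/-- Coordinates of solutions with values in a vector space. -/
theorem exists_coordinates [Finite Λ] {ι : Type*} [Fintype ι] {β : ι → Λ → K}
    (hli : LinearIndependent K β) (hspan : Submodule.span K (Set.range β) = r.sol K)
    {W : Type*} [AddCommGroup W] [Module K W] {c : Λ → W} (hc : r.IsSol c) :
    ∃ τ : ι → W, ∀ x, c x = ∑ i, β i x • τ i := by
  classical
  have _ := Fintype.ofFinite Λ
  obtain ⟨G, hG⟩ := LinearMap.exists_leftInverse_of_injective (Fintype.linearCombination K β)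
    (LinearMap.ker_eq_bot.2 hli.fintypeLinearCombination_injective)
  -- The coordinates are given by the left inverse `G` applied formally to the vector-valued `c`.
  -- The identity is tested against all functionals `ψ`, which turn `c` into a scalar solution.
  refine ⟨fun i => ∑ y, G (Pi.single y 1) i • c y, fun x => ?_⟩
  rw [← sub_eq_zero, ← Module.forall_dual_apply_eq_zero_iff K]
  intro ψ
  have hψ : ψ ∘ c ∈ r.sol K := hc.comp ψ.toAddMonoidHom
  rw [← hspan] at hψ
  obtain ⟨w, hw⟩ := (Submodule.mem_span_range_iff_exists_fun K).1 hψ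
  have hGw : G (ψ ∘ c) = w := by
    have := LinearMap.congr_fun hG w
    simpa [Fintype.linearCombination_apply, hw] using this
  have hw' : ∀ i, w i = ∑ y, G (Pi.single y 1) i * ψ (c y) := by
    intro i
    rw [← hGw]
    have : ψ ∘ c = ∑ y, ψ (c y) • Pi.single y (1 : K) := by
      ext y
      simp [Finset.sum_apply, Pi.single_apply]
    conv_lhs => rw [this]
    simp [map_sum, Finset.sum_apply, mul_comm]
  have := congrFun hw x
  rw [Function.comp_apply, Finset.sum_apply] at this
  rw [map_sub, ← this, map_sum, sub_eq_zero]
  refine Finset.sum_congr rfl fun i _ => ?_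
  rw [map_smul, map_sum, Pi.smul_apply, hw']
  simp [mul_comm]

theorem coordinates_eq_zero [Finite Λ] {ι : Type*} [Fintype ι] {β : ι → Λ → K}
    (hli : LinearIndependent K β) {W : Type*} [AddCommGroup W] [Module K W] {τ : ι → W}
    (h : ∀ x, ∑ i, β i x • τ i = 0) : τ = 0 := by
  ext i
  rw [Pi.zero_apply, ← Module.forall_dual_apply_eq_zero_iff K]
  intro ψ
  refine (Fintype.linearIndependent_iff.1 hli) (fun i => ψ (τ i)) ?_ i
  ext x
  have := congrArg ψ (h x)
  rw [map_sum, map_zero] at this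
  rw [Finset.sum_apply, Pi.zero_apply, ← this]
  refine Finset.sum_congr rfl fun i _ => ?_
  simp [mul_comm]

end Field

end Relations

/-! ### Decomposition of solutions with values in an arbitrary abelian group -/

namespace Relations

variable {Λ : Type*} {r : Relations Λ} {A : Type*} [AddCommGroup A]

theorem zmod_smul_eq {p : ℕ} [NeZero p] {W : Type*} [AddCommGroup W] [Module (ZMod p) W]
    (x : ZMod p) (w : W) : x • w = x.val • w := by
  conv_lhs => rw [← ZMod.natCast_zmod_val x]
  rw [Nat.cast_smul_eq_nsmul]

/-- The `p`-torsion subgroup is an `𝔽_p`-vector space, so the coordinates over a field apply. -/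
theorem exists_torsion_coordinates [Finite Λ] {p : ℕ} [Fact p.Prime] {ι : Type*} [Fintype ι]
    {β : ι → Λ → ZMod p} (hli : LinearIndependent (ZMod p) β)
    (hspan : Submodule.span (ZMod p) (Set.range β) = r.sol (ZMod p)) {c : Λ → A}
    (hc : r.IsSol c) (hpc : ∀ x, p • c x = 0) :
    ∃ τ : ι → A, (∀ i, p • τ i = 0) ∧ ∀ x, c x = ∑ i, (β i x).val • τ i := by
  let W := (nsmulAddMonoidHom p : A →+ A).ker
  let _ : Module (ZMod p) W := AddCommGroup.zmodModule (by
    rintro ⟨x, hx⟩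
    exact Subtype.ext hx)
  obtain ⟨τ, hτ⟩ := exists_coordinates (W := W) hli hspan (c := fun x => ⟨c x, hpc x⟩)
    (fun e => Subtype.ext (hc e))
  refine ⟨fun i => τ i, fun i => (τ i).2, fun x => ?_⟩
  have := congrArg Subtype.val (hτ x)
  simpa [zmod_smul_eq] using this

theorem torsion_coordinates_eq_zero [Finite Λ] {p : ℕ} [Fact p.Prime] {ι : Type*} [Fintype ι]
    {β : ι → Λ → ZMod p} (hli : LinearIndependent (ZMod p) β) {τ : ι → A}
    (hτ : ∀ i, p • τ i = 0) (h : ∀ x, ∑ i, (β i x).val • τ i = 0) : τ = 0 := by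
  let W := (nsmulAddMonoidHom p : A →+ A).ker
  let _ : Module (ZMod p) W := AddCommGroup.zmodModule (by
    rintro ⟨x, hx⟩
    exact Subtype.ext hx)
  have := coordinates_eq_zero (W := W) hli (τ := fun i => ⟨τ i, hτ i⟩) (by
    intro x
    apply Subtype.ext
    simpa [zmod_smul_eq] using h x)
  ext i
  exact congrArg Subtype.val (congrFun this i)

/-- The idempotents of the Chinese remainder theorem modulo the product `N` of the primes in `P`:
coprimality of the cofactors gives `∑ μ_p N / p = 1`, and `e p = μ_p N / p`. They project an
`N`-torsion group onto its `p`-torsion parts. -/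
theorem exists_orthogonal_integers (P : Finset Nat.Primes) :
    ∃ e : Nat.Primes → ℤ, (∏ p ∈ P, ((p : ℕ) : ℤ)) ∣ 1 - ∑ p ∈ P, e p ∧
      (∀ p ∈ P, (∏ p ∈ P, ((p : ℕ) : ℤ)) ∣ (p : ℕ) * e p) ∧
      ∀ p ∈ P, ∀ q ∈ P, q ≠ p → ((q : ℕ) : ℤ) ∣ e p := by
  rcases P.eq_empty_or_nonempty with rfl | hP
  · exact ⟨0, by simp⟩
  obtain ⟨μ, hμ⟩ := (exists_sum_eq_one_iff_pairwise_coprime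
    (s := fun p : Nat.Primes => ((p : ℕ) : ℤ)) hP).2 (by
      intro p q hpq
      have := (Nat.coprime_primes p.1.2 q.1.2).2 fun h => hpq (Subtype.ext (Subtype.ext h))
      exact Nat.isCoprime_iff_coprime.2 this)
  refine ⟨fun p => μ p * ∏ q ∈ P \ {p}, ((q : ℕ) : ℤ), by rw [hμ]; simp, ?_, ?_⟩
  · intro p hp
    refine ⟨μ p, ?_⟩
    rw [← Finset.prod_sdiff (Finset.singleton_subset_iff.2 hp), Finset.prod_singleton]
    ring
  · intro p hp q hq hqp
    exact Dvd.dvd.mul_left (Finset.dvd_prod_of_mem _ (by simp [hq, hqp])) _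

theorem val_intCast_zsmul {p : ℕ} [NeZero p] (m : ℤ) {t : A} (ht : p • t = 0) :
    ((m : ZMod p).val) • t = m • t := by
  rw [← natCast_zsmul, ZMod.val_intCast]
  have h : m • t = (m % p + p * (m / p)) • t := by rw [Int.emod_add_mul_ediv]
  rw [h, add_smul, mul_comm (p : ℤ), mul_smul _ (p : ℤ), natCast_zsmul, ht, smul_zero, add_zero]

theorem zsmul_eq_zero_of_dvd {m n : ℤ} (h : m ∣ n) {t : A} (ht : m • t = 0) : n • t = 0 := by
  obtain ⟨a, rfl⟩ := h
  rw [mul_comm, mul_smul, ht, smul_zero]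

section Decomposition

variable [Fintype Λ] {z : Λ → ℤ} {P : Finset Nat.Primes} {l : Nat.Primes → ℕ}
  {γ : ∀ p : Nat.Primes, Fin (l p + 1) → Λ → ZMod p}

theorem sum_sigma_primes [Fintype (Σ p : Nat.Primes, Fin (l p))] (hl : ∀ p ∉ P, l p = 0)
    (F : (Σ p : Nat.Primes, Fin (l p)) → A) : ∑ j, F j = ∑ p ∈ P, ∑ i, F ⟨p, i⟩ := by
  rw [Finset.sum_sigma' P (fun p => Finset.univ) (fun p i => F ⟨p, i⟩)]
  refine (Finset.sum_subset (Finset.subset_univ _) ?_).symm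
  rintro ⟨p, i⟩ _ hj
  by_cases hp : p ∈ P
  · simp [hp] at hj
  · have := i.2
    have := hl p hp
    omega

/-- Solutions with 2 × 2 minors killed by a product of primes are sums of a multiple of `z` and
torsion solutions. -/
theorem exists_decomposition [Fintype (Σ p : Nat.Primes, Fin (l p))] (hz : r.IsSol z)
    {a : Λ → ℤ} (ha : ∑ x, a x * z x = 1) (hl : ∀ p ∉ P, l p = 0)
    (hγ : ∀ p x, γ p 0 x = z x) (hli : ∀ p : Nat.Primes, LinearIndependent (ZMod p) (γ p))
    (hspan : ∀ p : Nat.Primes, Submodule.span (ZMod p) (Set.range (γ p)) = r.sol (ZMod p))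
    {c : Λ → A}
    (hc : r.IsSol c)
    (hminor : ∀ x y, (∏ p ∈ P, ((p : ℕ) : ℤ)) • (z y • c x - z x • c y) = 0) :
    ∃ (b : A) (τ : (Σ p : Nat.Primes, Fin (l p)) → A), (∀ j, (j.1 : ℕ) • τ j = 0) ∧
      ∀ x, c x = z x • b + ∑ j, (γ j.1 j.2.succ x).val • τ j := by
  have _ : ∀ p : Nat.Primes, Fact (p : ℕ).Prime := fun p => ⟨p.2⟩
  set N := ∏ p ∈ P, ((p : ℕ) : ℤ) with hN
  -- With Bézout weights `a`, the difference `c - b₀ z` is a combination of minors, hence killed by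
  -- `N`.
  set b₀ := ∑ y, a y • c y with hb₀
  have ht : ∀ x, N • (c x - z x • b₀) = 0 := by
    intro x
    have : c x - z x • b₀ = ∑ y, a y • (z y • c x - z x • c y) := by
      simp only [smul_sub, Finset.sum_sub_distrib, smul_smul]
      rw [← Finset.sum_smul, ha, one_smul, hb₀, Finset.smul_sum]
      simp only [smul_smul, mul_comm]
    rw [this, Finset.smul_sum]
    refine Finset.sum_eq_zero fun y _ => ?_
    rw [smul_comm, hminor, smul_zero]
  have htsol : r.IsSol fun x => c x - z x • b₀ := by
    intro e
    have h1 := hc e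
    have h2 := congrArg (· • b₀) (hz e)
    simp only [nsmul_eq_mul, mul_smul, natCast_zsmul] at h2
    simp only [smul_sub, h1, h2]
  obtain ⟨e, he1, he2, -⟩ := exists_orthogonal_integers P
  have key : ∀ p : Nat.Primes, ∃ τ : Fin (l p + 1) → A, (∀ i, (p : ℕ) • τ i = 0) ∧
      (p ∈ P → ∀ x, e p • (c x - z x • b₀) = ∑ i, (γ p i x).val • τ i) := by
    intro p
    by_cases hp : p ∈ P
    · obtain ⟨τ, h1, h2⟩ := exists_torsion_coordinates (hli p) (hspan p)
        (c := fun x => e p • (c x - z x • b₀)) (fun f => by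
          have := htsol f
          dsimp only at this ⊢
          rw [smul_comm, this, smul_comm]) (fun x => by
          rw [← natCast_zsmul, smul_smul]
          exact zsmul_eq_zero_of_dvd (he2 p hp) (ht x))
      exact ⟨τ, h1, fun _ => h2⟩
    · exact ⟨0, by simp, fun h => absurd h hp⟩
  choose τ hτ hτ' using key
  -- The basis `γ p` begins with `z` modulo `p`; its coordinates `τ p 0` are moved into `b`.
  refine ⟨b₀ + ∑ p ∈ P, τ p 0, fun j => τ j.1 j.2.succ, fun j => hτ _ _, fun x => ?_⟩
  rw [sum_sigma_primes hl]
  have h1 : c x - z x • b₀ = ∑ p ∈ P, e p • (c x - z x • b₀) := by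
    rw [← Finset.sum_smul, ← sub_eq_zero]
    have := zsmul_eq_zero_of_dvd he1 (ht x)
    rwa [sub_smul, one_smul] at this
  have h2 : ∑ p ∈ P, e p • (c x - z x • b₀) =
      ∑ p ∈ P, (z x • τ p 0 + ∑ i : Fin (l p), (γ p i.succ x).val • τ p i.succ) := by
    refine Finset.sum_congr rfl fun p hp => ?_
    rw [hτ' p hp x, Fin.sum_univ_succ, hγ, val_intCast_zsmul _ (hτ p 0)]
  rw [Finset.sum_add_distrib, ← Finset.smul_sum] at h2
  rw [smul_add, add_assoc, ← h2, ← h1]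
  abel

/-- Multiplying by the product `N` of the primes kills all `τ`, and Bézout then gives `N b = 0`.
Applying `e p` isolates a relation in the `p`-torsion among `z` and the remaining basis members, so
`e p b` and the `τ` at `p` vanish. Finally `b` is the sum of the `e p b`. -/
theorem decomposition_unique [Fintype (Σ p : Nat.Primes, Fin (l p))]
    {a : Λ → ℤ} (ha : ∑ x, a x * z x = 1) (hl : ∀ p ∉ P, l p = 0)
    (hγ : ∀ p x, γ p 0 x = z x) (hli : ∀ p : Nat.Primes, LinearIndependent (ZMod p) (γ p)) {b : A}
    {τ : (Σ p : Nat.Primes, Fin (l p)) → A} (hτ : ∀ j, (j.1 : ℕ) • τ j = 0)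
    (h : ∀ x, z x • b + ∑ j, (γ j.1 j.2.succ x).val • τ j = 0) : b = 0 ∧ τ = 0 := by
  have _ : ∀ p : Nat.Primes, Fact (p : ℕ).Prime := fun p => ⟨p.2⟩
  set N := ∏ p ∈ P, ((p : ℕ) : ℤ) with hN
  have hP : ∀ j : Σ p : Nat.Primes, Fin (l p), j.1 ∈ P := by
    rintro ⟨p, i⟩
    by_contra hp
    have := i.2
    have := hl p hp
    omega
  have hNb : N • b = 0 := by
    have h1 : ∀ x, z x • N • b = 0 := by
      intro x
      have := congrArg (N • ·) (h x)
      simp only [smul_add, smul_zero, Finset.smul_sum] at this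
      rw [Finset.sum_eq_zero, add_zero, smul_comm] at this
      · exact this
      · intro j _
        rw [smul_comm, zsmul_eq_zero_of_dvd (Finset.dvd_prod_of_mem _ (hP j)), smul_zero]
        rw [natCast_zsmul]
        exact hτ j
    have h2 : N • b = ∑ x, a x • z x • N • b := by
      simp only [smul_smul (a _) (z _)]
      rw [← Finset.sum_smul, ha, one_smul]
    rw [h2]
    exact Finset.sum_eq_zero fun x _ => by rw [h1, smul_zero]
  obtain ⟨e, he1, he2, he3⟩ := exists_orthogonal_integers P
  have hone : ∀ p ∈ P, ∀ t : A, (p : ℕ) • t = 0 → e p • t = t := by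
    intro p hp t ht
    have ht' : ((p : ℕ) : ℤ) • t = 0 := by rwa [natCast_zsmul]
    have h1 := zsmul_eq_zero_of_dvd ((Finset.dvd_prod_of_mem _ hp).trans he1) ht'
    rw [sub_smul, one_smul, Finset.sum_smul, Finset.sum_eq_single p, sub_eq_zero] at h1
    · exact h1.symm
    · intro q hq hqp
      exact zsmul_eq_zero_of_dvd (he3 q hq p hp hqp.symm) ht'
    · exact fun h => absurd hp h
  have key : ∀ p ∈ P, (Fin.cons (e p • b) fun i => τ ⟨p, i⟩ : Fin (l p + 1) → A) = 0 := by
    intro p hp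
    have hpe : (p : ℕ) • e p • b = 0 := by
      rw [← natCast_zsmul, smul_smul]
      exact zsmul_eq_zero_of_dvd (he2 p hp) hNb
    refine torsion_coordinates_eq_zero (hli p) ?_ ?_
    · refine Fin.cases hpe fun i => ?_
      rw [Fin.cons_succ]
      exact hτ ⟨p, i⟩
    · intro x
      rw [Fin.sum_univ_succ, Fin.cons_zero, hγ, val_intCast_zsmul _ hpe]
      simp only [Fin.cons_succ]
      have := congrArg (e p • ·) (h x)
      simp only [smul_add, smul_zero] at this
      rw [← this, smul_comm, sum_sigma_primes hl, Finset.smul_sum, Finset.sum_eq_single p,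
        Finset.smul_sum]
      · congr 1
        refine Finset.sum_congr rfl fun i _ => ?_
        rw [smul_comm, hone p hp _ (hτ ⟨p, i⟩)]
      · intro q hq hqp
        rw [Finset.smul_sum]
        refine Finset.sum_eq_zero fun i _ => ?_
        rw [smul_comm, zsmul_eq_zero_of_dvd (he3 p hp q hq hqp), smul_zero]
        rw [natCast_zsmul]
        exact hτ ⟨q, i⟩
      · exact fun h => absurd hp h
  constructor
  · have h1 := zsmul_eq_zero_of_dvd he1 hNb
    rw [sub_smul, one_smul, Finset.sum_smul, Finset.sum_eq_zero, sub_zero] at h1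
    · exact h1
    · intro p hp
      have := congrFun (key p hp) 0
      rwa [Fin.cons_zero] at this
  · ext ⟨p, i⟩
    have := congrFun (key p (hP ⟨p, i⟩)) i.succ
    rwa [Fin.cons_succ] at this

end Decomposition

end Relations

open MvPolynomial

/-- A vector of natural numbers as an exponent. -/
abbrev expo {N : ℕ} (v : Fin N → ℕ) : Fin N →₀ ℕ := Finsupp.equivFunOnFinite.symm v

theorem expo_coe {N : ℕ} (s : Fin N →₀ ℕ) : expo s = s := by
  ext; simp

/-! ### Coefficients of the four substitutions in the coboundary -/

section FaceCoeff

variable {A : Type*} [CommRing A] {m : ℕ}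

theorem coeff_prod_X_pow_univ {N : ℕ} (v w : Fin N → ℕ) :
    coeff (expo w) (∏ i, (X i : MvPolynomial (Fin N) A) ^ v i) = if v = w then 1 else 0 := by
  classical
  have : (∏ i, (X i : MvPolynomial (Fin N) A) ^ v i) = monomial (expo v) 1 := by
    rw [monomial_eq, C_1, one_mul, Finsupp.prod_fintype _ _ (by simp)]
    simp
  rw [this, coeff_monomial]
  simp

theorem prod_cons_pow {N : ℕ} (x : ℕ) (v : Fin N → ℕ) :
    (∏ i, (X i : MvPolynomial (Fin (N + 1)) A) ^ (Fin.cons x v : Fin (N + 1) → ℕ) i) =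
      X 0 ^ x * ∏ i : Fin N, X i.succ ^ v i := by
  rw [Fin.prod_univ_succ]
  simp

theorem prod_cons_cons_cons_pow (a b d : ℕ) (R : Fin m → ℕ) :
    (∏ i, (X i : MvPolynomial (Fin (m + 3)) A) ^
      (Fin.cons a (Fin.cons b (Fin.cons d R : Fin (m + 1) → ℕ) : Fin (m + 2) → ℕ) :
        Fin (m + 3) → ℕ) i) =
      X 0 ^ a * (X 1 ^ b * (X 2 ^ d * ∏ i : Fin m, X i.succ.succ.succ ^ R i)) := by
  simp only [Fin.prod_univ_succ, Fin.cons_zero, Fin.cons_succ]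
  rfl

theorem cons_eq_cons_iff {N : ℕ} (a b : ℕ) (v w : Fin N → ℕ) :
    (Fin.cons a v : Fin (N + 1) → ℕ) = Fin.cons b w ↔ a = b ∧ v = w :=
  Fin.cons_inj

variable (x y a b d : ℕ) (S R : Fin m → ℕ)

local notation "src" => (Fin.cons x (Fin.cons y S : Fin (m + 1) → ℕ) : Fin (m + 2) → ℕ)
local notation "tgt" => expo (Fin.cons a (Fin.cons b (Fin.cons d R : Fin (m + 1) → ℕ) : Fin (m + 2) → ℕ) : Fin (m + 3) → ℕ)

theorem coeff_face_zero : coeff tgt (∏ j, face (m + 2) A 0 j ^ src j) =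
    if a = 0 ∧ x = b ∧ y = d ∧ S = R then 1 else 0 := by
  have : (∏ j, face (m + 2) A 0 j ^ src j) = ∏ i, (X i : MvPolynomial (Fin (m + 3)) A) ^
      (Fin.cons 0 src : Fin (m + 3) → ℕ) i := by
    rw [prod_cons_pow]
    simp [face]
  rw [this, coeff_prod_X_pow_univ]
  simp only [cons_eq_cons_iff, eq_comm (a := 0)]

theorem coeff_face_three : coeff tgt (∏ j, face (m + 2) A 3 j ^ src j) =
    if d = 0 ∧ x = a ∧ y = b ∧ S = R then 1 else 0 := by
  have : (∏ j, face (m + 2) A 3 j ^ src j) = ∏ i, (X i : MvPolynomial (Fin (m + 3)) A) ^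
      (Fin.cons x (Fin.cons y (Fin.cons 0 S : Fin (m + 1) → ℕ) : Fin (m + 2) → ℕ) :
        Fin (m + 3) → ℕ) i := by
    rw [prod_cons_cons_cons_pow]
    simp [Fin.prod_univ_succ, face]
  rw [this, coeff_prod_X_pow_univ]
  simp only [cons_eq_cons_iff]
  congr 1
  rw [eq_iff_iff]
  constructor
  · rintro ⟨rfl, rfl, rfl, rfl⟩; simp
  · rintro ⟨rfl, rfl, rfl, rfl⟩; simp

theorem coeff_face_one : coeff tgt (∏ j, face (m + 2) A 1 j ^ src j) =
    if x = a + b ∧ y = d ∧ S = R then ((a + b).choose a : A) else 0 := by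
  classical
  have : (∏ j, face (m + 2) A 1 j ^ src j) =
      ∑ t ∈ Finset.HasAntidiagonal.antidiagonal x, (x.choose t.1) •
      ∏ i, (X i : MvPolynomial (Fin (m + 3)) A) ^
      (Fin.cons t.1 (Fin.cons t.2 (Fin.cons y S : Fin (m + 1) → ℕ) : Fin (m + 2) → ℕ) :
        Fin (m + 3) → ℕ) i := by
    simp only [prod_cons_cons_cons_pow]
    have h : (∏ j, face (m + 2) A 1 j ^ src j) = (X 0 + X 1) ^ x * (X 2 ^ y *
        ∏ i : Fin m, X i.succ.succ.succ ^ S i) := by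
      simp [Fin.prod_univ_succ, face]
    rw [h, (Commute.all _ _).add_pow', Finset.sum_mul]
    refine Finset.sum_congr rfl fun t _ => ?_
    rw [smul_mul_assoc]
    ring
  rw [this, coeff_sum]
  simp only [coeff_smul, coeff_prod_X_pow_univ, cons_eq_cons_iff]
  split_ifs with h
  · obtain ⟨rfl, rfl, rfl⟩ := h
    rw [Finset.sum_eq_single (a, b)]
    · simp
    · rintro ⟨t1, t2⟩ _ hne
      rw [if_neg, smul_zero]
      rintro ⟨rfl, rfl, _⟩
      exact hne rfl
    · simp
  · refine Finset.sum_eq_zero ?_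
    rintro ⟨t1, t2⟩ ht
    rw [if_neg, smul_zero]
    rintro ⟨rfl, rfl, rfl, rfl⟩
    exact h ⟨(Finset.HasAntidiagonal.mem_antidiagonal.1 ht).symm, rfl, rfl⟩

theorem coeff_face_two : coeff tgt (∏ j, face (m + 2) A 2 j ^ src j) =
    if x = a ∧ y = b + d ∧ S = R then ((b + d).choose b : A) else 0 := by
  classical
  have : (∏ j, face (m + 2) A 2 j ^ src j) =
      ∑ t ∈ Finset.HasAntidiagonal.antidiagonal y, (y.choose t.1) •
      ∏ i, (X i : MvPolynomial (Fin (m + 3)) A) ^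
      (Fin.cons x (Fin.cons t.1 (Fin.cons t.2 S : Fin (m + 1) → ℕ) : Fin (m + 2) → ℕ) :
        Fin (m + 3) → ℕ) i := by
    simp only [prod_cons_cons_cons_pow]
    have h : (∏ j, face (m + 2) A 2 j ^ src j) = X 0 ^ x * ((X 1 + X 2) ^ y *
        ∏ i : Fin m, X i.succ.succ.succ ^ S i) := by
      simp [Fin.prod_univ_succ, face]
    rw [h, (Commute.all _ _).add_pow', Finset.sum_mul, Finset.mul_sum]
    refine Finset.sum_congr rfl fun t _ => ?_
    rw [smul_mul_assoc, mul_smul_comm]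
    ring
  rw [this, coeff_sum]
  simp only [coeff_smul, coeff_prod_X_pow_univ, cons_eq_cons_iff]
  split_ifs with h
  · obtain ⟨rfl, rfl, rfl⟩ := h
    rw [Finset.sum_eq_single (b, d)]
    · simp
    · rintro ⟨t1, t2⟩ _ hne
      rw [if_neg, smul_zero]
      rintro ⟨_, rfl, rfl, _⟩
      exact hne rfl
    · simp
  · refine Finset.sum_eq_zero ?_
    rintro ⟨t1, t2⟩ ht
    rw [if_neg, smul_zero]
    rintro ⟨rfl, rfl, rfl, rfl⟩
    exact h ⟨rfl, (Finset.HasAntidiagonal.mem_antidiagonal.1 ht).symm, rfl⟩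

end FaceCoeff

/-! ### Exponent vectors up to permutation -/

section Values

variable {N : ℕ}

/-- The multiset of the entries of a vector. -/
def vals (v : Fin N → ℕ) : Multiset ℕ := Finset.univ.val.map v

@[simp] theorem card_vals (v : Fin N → ℕ) : (vals v).card = N := by simp [vals]

@[simp] theorem sum_vals (v : Fin N → ℕ) : (vals v).sum = ∑ i, v i := rfl

theorem mem_vals {v : Fin N → ℕ} {x : ℕ} : x ∈ vals v ↔ ∃ i, v i = x := by simp [vals]

@[simp] theorem vals_cons (x : ℕ) (v : Fin N → ℕ) :
    vals (Fin.cons x v : Fin (N + 1) → ℕ) = x ::ₘ vals v := by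
  simp only [vals, Fin.univ_succ]
  simp [Function.comp_def]

theorem vals_comp_perm (v : Fin N → ℕ) (σ : Equiv.Perm (Fin N)) : vals (v ∘ σ) = vals v := by
  rw [vals, ← Multiset.map_map, Multiset.map_univ_val_equiv, vals]

theorem exists_perm_of_vals_eq {v w : Fin N → ℕ} (h : vals v = vals w) :
    ∃ σ : Equiv.Perm (Fin N), v ∘ σ = w := by
  have key : ∀ x, Nonempty ({i // w i = x} ≃ {i // v i = x}) := by
    intro x
    rw [← Fintype.card_eq, Fintype.card_subtype, Fintype.card_subtype]
    have := congrArg (Multiset.count x) h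
    rw [vals, vals, Multiset.count_map, Multiset.count_map] at this
    simp only [eq_comm (a := x)] at this
    exact this.symm
  let e' := fun x => (key x).some
  exact ⟨Equiv.ofFiberEquiv e', funext fun i => Equiv.ofFiberEquiv_map e' i⟩

/-- A vector with a given multiset of entries. -/
def ofVals (N : ℕ) (s : Multiset ℕ) : Fin N → ℕ := fun i => s.toList.getD i 0

theorem vals_ofVals {s : Multiset ℕ} (h : s.card = N) : vals (ofVals N s) = s := by
  subst h
  have : ofVals s.card s = fun i : Fin s.card => s.toList.get (i.cast (by simp)) := by
    ext i
    simp [ofVals]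
  conv_rhs => rw [← Multiset.coe_toList s, ← List.ofFn_get s.toList]
  rw [vals, this, Fin.univ_val_map, Multiset.coe_eq_coe]
  apply List.Perm.of_eq
  apply List.ext_get
  · simp
  · intro i h1 h2
    simp

theorem sum_eq_degree (v : Fin N → ℕ) : (expo v).degree = ∑ i, v i := by
  simp [Finsupp.degree_eq_sum]

end Values

/-! ### The cocycle condition on coefficients -/

section CocycleFun

variable {A : Type*} [CommRing A] {m : ℕ}

/-- The exponents that contribute to a given exponent of the coboundary. -/
def faceSource (i : Fin 4) (a b d : ℕ) (R : Fin m → ℕ) : Fin (m + 2) → ℕ :=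
  match i with
  | 0 => Fin.cons b (Fin.cons d R : Fin (m + 1) → ℕ)
  | 1 => Fin.cons (a + b) (Fin.cons d R : Fin (m + 1) → ℕ)
  | 2 => Fin.cons a (Fin.cons (b + d) R : Fin (m + 1) → ℕ)
  | 3 => Fin.cons a (Fin.cons b R : Fin (m + 1) → ℕ)

/-- The coefficients with which they contribute. -/
def faceWeight (i : Fin 4) (a b d : ℕ) : ℕ :=
  match i with
  | 0 => if a = 0 then 1 else 0
  | 1 => (a + b).choose a
  | 2 => (b + d).choose b
  | 3 => if d = 0 then 1 else 0

/-- For each face only one source monomial can contribute to a given target monomial. Hence the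
coboundary has coefficients with four terms, for polynomials and power series alike. -/
theorem coeff_face_prod (i : Fin 4) (a b d : ℕ) (R : Fin m → ℕ) (s : Fin (m + 2) →₀ ℕ) :
    coeff (expo (Fin.cons a (Fin.cons b (Fin.cons d R : Fin (m + 1) → ℕ) : Fin (m + 2) → ℕ) :
      Fin (m + 3) → ℕ)) (∏ j, face (m + 2) A i j ^ s j) =
    if s = expo (faceSource i a b d R) then (faceWeight i a b d : A) else 0 := by
  classical
  obtain ⟨x, y, S, hs⟩ : ∃ (x y : ℕ) (S : Fin m → ℕ),
      s = expo (Fin.cons x (Fin.cons y S : Fin (m + 1) → ℕ) : Fin (m + 2) → ℕ) := by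
    refine ⟨s 0, s 1, fun i => s i.succ.succ, ?_⟩
    ext i
    refine Fin.cases rfl (fun i => ?_) i
    exact Fin.cases rfl (fun i => rfl) i
  subst hs
  simp only [Finsupp.coe_equivFunOnFinite_symm, EmbeddingLike.apply_eq_iff_eq]
  fin_cases i
  · refine (coeff_face_zero x y a b d S R).trans ?_
    simp only [faceSource, faceWeight, cons_eq_cons_iff]
    split_ifs <;> simp_all
  · refine (coeff_face_one x y a b d S R).trans ?_
    simp only [faceSource, faceWeight, cons_eq_cons_iff]
  · refine (coeff_face_two x y a b d S R).trans ?_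
    simp only [faceSource, faceWeight, cons_eq_cons_iff]
  · refine (coeff_face_three x y a b d S R).trans ?_
    simp only [faceSource, faceWeight, cons_eq_cons_iff]
    split_ifs <;> simp_all

/-- A coefficient of the coboundary, as a function of the coefficients of the cochain. -/
def defect (F : (Fin (m + 2) → ℕ) → A) (a b d : ℕ) (R : Fin m → ℕ) : A :=
  ∑ i : Fin 4, (-1) ^ (i : ℕ) * (F (faceSource i a b d R) * faceWeight i a b d)

/-- Symmetric functions on exponents that satisfy the cocycle condition. -/
structure IsCocycleFun (F : (Fin (m + 2) → ℕ) → A) : Prop where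
  symm : ∀ (σ : Equiv.Perm (Fin (m + 2))) v, F (v ∘ σ) = F v
  defect_eq : ∀ a b d R, defect F a b d R = 0

theorem exists_cons_cons_cons (e : Fin (m + 3) →₀ ℕ) : ∃ (a b d : ℕ) (R : Fin m → ℕ),
    e = expo (Fin.cons a (Fin.cons b (Fin.cons d R : Fin (m + 1) → ℕ) : Fin (m + 2) → ℕ) :
      Fin (m + 3) → ℕ) := by
  refine ⟨e 0, e 1, e 2, fun i => e i.succ.succ.succ, ?_⟩
  ext i
  refine Fin.cases rfl (fun i => ?_) i
  refine Fin.cases rfl (fun i => ?_) i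
  exact Fin.cases rfl (fun i => rfl) i

theorem coeff_coboundary (f : MvPolynomial (Fin (m + 2)) A) (a b d : ℕ) (R : Fin m → ℕ) :
    coeff (expo (Fin.cons a (Fin.cons b (Fin.cons d R : Fin (m + 1) → ℕ) : Fin (m + 2) → ℕ) :
      Fin (m + 3) → ℕ)) (coboundary (m + 2) A f) = defect (fun v => coeff (expo v) f) a b d R := by
  classical
  have h : ∀ i, coeff (expo (Fin.cons a (Fin.cons b (Fin.cons d R : Fin (m + 1) → ℕ) :
      Fin (m + 2) → ℕ) : Fin (m + 3) → ℕ)) (aeval (face (m + 2) A i) f) =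
      coeff (expo (faceSource i a b d R)) f * faceWeight i a b d := by
    intro i
    rw [aeval_def, eval₂_eq', coeff_sum]
    simp only [algebraMap_eq, coeff_C_mul, coeff_face_prod]
    rw [Finset.sum_eq_single (expo (faceSource i a b d R))]
    · simp
    · intro s _ hs
      rw [if_neg hs, mul_zero]
    · intro hs
      rw [notMem_support_iff.1 hs, zero_mul]
  rw [coboundary, LinearMap.sum_apply, coeff_sum, defect]
  refine Finset.sum_congr rfl fun i _ => ?_
  rw [LinearMap.smul_apply, coeff_smul, AlgHom.toLinearMap_apply, h, smul_eq_mul]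

theorem isSymmetric_iff {N : ℕ} (f : MvPolynomial (Fin N) A) : f.IsSymmetric ↔
    ∀ (σ : Equiv.Perm (Fin N)) v, coeff (expo (v ∘ σ)) f = coeff (expo v) f := by
  have key : ∀ (σ : Equiv.Perm (Fin N)) (v : Fin N → ℕ),
      coeff (expo v) (rename σ f) = coeff (expo (v ∘ σ)) f := by
    intro σ v
    rw [← coeff_rename_mapDomain σ σ.injective f (expo (v ∘ σ))]
    congr 1
    ext i
    obtain ⟨j, rfl⟩ := σ.surjective i
    rw [Finsupp.mapDomain_apply σ.injective]
    simp
  constructor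
  · intro h σ v
    rw [← key, h σ]
  · intro h σ
    ext s
    have := key σ s
    rw [h, expo_coe] at this
    exact this

theorem mem_cocycles_iff {n : ℕ} {f : MvPolynomial (Fin (m + 2)) A} :
    f ∈ cocycles (m + 2) A n ↔ f.IsHomogeneous n ∧ IsCocycleFun fun v => coeff (expo v) f := by
  rw [cocycles, Submodule.mem_inf, Submodule.mem_inf, mem_homogeneousSubmodule,
    Subalgebra.mem_toSubmodule, mem_symmetricSubalgebra, LinearMap.mem_ker, isSymmetric_iff]
  constructor
  · rintro ⟨⟨h1, h2⟩, h3⟩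
    refine ⟨h1, h2, fun a b d R => ?_⟩
    rw [← coeff_coboundary, h3, coeff_zero]
  · rintro ⟨h1, h2, h3⟩
    refine ⟨⟨h1, h2⟩, ?_⟩
    ext e
    obtain ⟨a, b, d, R, rfl⟩ := exists_cons_cons_cons e
    rw [coeff_coboundary, h3, coeff_zero]

variable {F : (Fin (m + 2) → ℕ) → A}

theorem IsCocycleFun.eq_of_vals_eq (hF : IsCocycleFun F) {v w : Fin (m + 2) → ℕ}
    (h : vals v = vals w) : F v = F w := by
  obtain ⟨σ, rfl⟩ := exists_perm_of_vals_eq h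
  exact (hF.symm σ v).symm

/-- After moving the zero entry to position `0` and the nonzero one to position `1`, the condition
at `a = b = 0` has three equal terms with signs `+, -, +`, and the fourth has weight zero. -/
theorem IsCocycleFun.eq_zero (hF : IsCocycleFun F) {v : Fin (m + 2) → ℕ} {i j : Fin (m + 2)}
    (hi : v i = 0) (hj : v j ≠ 0) : F v = 0 := by
  have hij : i ≠ j := by rintro rfl; exact hj hi
  obtain ⟨σ, h0, h1⟩ : ∃ σ : Equiv.Perm (Fin (m + 2)), σ 0 = i ∧ σ 1 = j := by
    have h01 : (0 : Fin (m + 2)) ≠ 1 := by simp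
    refine ⟨(Equiv.swap 0 i).trans (Equiv.swap (Equiv.swap 0 i 1) j), ?_, ?_⟩
    · rw [Equiv.trans_apply, Equiv.swap_apply_left, Equiv.swap_apply_of_ne_of_ne _ hij]
      intro h
      have h2 := congrArg (Equiv.swap 0 i) h
      rw [Equiv.swap_apply_right, Equiv.swap_apply_self] at h2
      exact h01 h2
    · rw [Equiv.trans_apply, Equiv.swap_apply_left]
  rw [← hF.symm σ]
  obtain ⟨R, hR⟩ : ∃ R : Fin m → ℕ, v ∘ σ = Fin.cons 0 (Fin.cons (v j) R : Fin (m + 1) → ℕ) := by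
    refine ⟨fun i => v (σ i.succ.succ), ?_⟩
    ext i
    refine Fin.cases (by simp [h0, hi]) (fun i => ?_) i
    refine Fin.cases (by simp [h1]) (fun i => ?_) i
    simp
  rw [hR]
  have := hF.defect_eq 0 0 (v j) R
  simpa [defect, Fin.sum_univ_four, faceSource, faceWeight, hj] using this

theorem IsCocycleFun.edge (hF : IsCocycleFun F) {a b d : ℕ} (ha : 0 < a) (hd : 0 < d)
    (R : Fin m → ℕ) : (a + b).choose a • F (Fin.cons (a + b) (Fin.cons d R : Fin (m + 1) → ℕ)) =
      (b + d).choose b • F (Fin.cons a (Fin.cons (b + d) R : Fin (m + 1) → ℕ)) := by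
  have := hF.defect_eq a b d R
  simp only [defect, Fin.sum_univ_four, faceSource, faceWeight, ha.ne', hd.ne', if_false] at this
  rw [nsmul_eq_mul, nsmul_eq_mul]
  simp at this
  linear_combination -this

/-- When one of `a`, `b`, `d` is zero, the condition reduces to cancellations and to the vanishing
of `F` on vectors with a zero entry. -/
theorem isCocycleFun_of_edge (hsymm : ∀ (σ : Equiv.Perm (Fin (m + 2))) v, F (v ∘ σ) = F v)
    (h0 : ∀ v i, v i = 0 → F v = 0)
    (hedge : ∀ (a b d : ℕ) (R : Fin m → ℕ), 0 < a → 0 < b → 0 < d → (∀ i, 0 < R i) →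
      (a + b).choose a • F (Fin.cons (a + b) (Fin.cons d R : Fin (m + 1) → ℕ)) =
      (b + d).choose b • F (Fin.cons a (Fin.cons (b + d) R : Fin (m + 1) → ℕ))) :
    IsCocycleFun F := by
  refine ⟨hsymm, fun a b d R => ?_⟩
  have z0 : ∀ x (S : Fin m → ℕ), F (Fin.cons 0 (Fin.cons x S : Fin (m + 1) → ℕ)) = 0 :=
    fun x S => h0 _ 0 rfl
  have z1 : ∀ x (S : Fin m → ℕ), F (Fin.cons x (Fin.cons 0 S : Fin (m + 1) → ℕ)) = 0 :=
    fun x S => h0 _ 1 rfl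
  simp only [defect, Fin.sum_univ_four, faceSource, faceWeight]
  rcases Nat.eq_zero_or_pos a with rfl | ha
  · rcases Nat.eq_zero_or_pos d with rfl | hd
    · simp [z0, z1]
    · simp [z0, hd.ne']
  rcases Nat.eq_zero_or_pos d with rfl | hd
  · simp [z1, ha.ne']
    ring
  rcases Nat.eq_zero_or_pos b with rfl | hb
  · simp [ha.ne', hd.ne']
  by_cases hR : ∀ i, 0 < R i
  · have := hedge a b d R ha hb hd hR
    rw [nsmul_eq_mul, nsmul_eq_mul] at this
    simp [ha.ne', hd.ne']
    linear_combination -this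
  · push Not at hR
    obtain ⟨i, hi⟩ := hR
    have : ∀ x y, F (Fin.cons x (Fin.cons y R : Fin (m + 1) → ℕ)) = 0 :=
      fun x y => h0 _ i.succ.succ (by simpa using hi)
    simp [this]

end CocycleFun

/-! ### Symmetric cocycles as functions on partitions with exactly `k` parts -/

/-- The partitions of `n` into `k` positive parts. -/
abbrev Parts (k n : ℕ) : Type := {s : Multiset ℕ // IsParts k n s}

instance (k n : ℕ) : Finite (Parts k n) :=
  Finite.of_injective (β := n.Partition)
    (fun s => ⟨s.1, fun {x} hx => s.2.2.2 x hx, s.2.2.1⟩) (by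
      intro s t h
      exact Subtype.ext (congrArg Nat.Partition.parts h))

instance (k n : ℕ) : Fintype (Parts k n) := Fintype.ofFinite _

/-- The relations between the coefficients of cocycles. -/
def partRel (k n : ℕ) : Relations (Parts k n) where
  Edge := {q : ℕ × ℕ × ℕ × Multiset ℕ // 0 < q.1 ∧ 0 < q.2.1 ∧ 0 < q.2.2.1 ∧
    (∀ x ∈ q.2.2.2, 0 < x) ∧ q.2.2.2.card + 2 = k ∧ q.1 + q.2.1 + q.2.2.1 + q.2.2.2.sum = n}
  src q := ⟨(q.1.1 + q.1.2.1) ::ₘ q.1.2.2.1 ::ₘ q.1.2.2.2, by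
    obtain ⟨⟨a, b, d, R⟩, ha, hb, hd, hR, hk, hn⟩ := q
    simp only at ha hb hd hR hk hn ⊢
    refine ⟨by simp [hk], by simp; omega, fun x hx => ?_⟩
    rcases Multiset.mem_cons.1 hx with rfl | hx
    · omega
    rcases Multiset.mem_cons.1 hx with rfl | hx
    · exact hd
    · exact hR x hx⟩
  tgt q := ⟨q.1.1 ::ₘ (q.1.2.1 + q.1.2.2.1) ::ₘ q.1.2.2.2, by
    obtain ⟨⟨a, b, d, R⟩, ha, hb, hd, hR, hk, hn⟩ := q
    simp only at ha hb hd hR hk hn ⊢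
    refine ⟨by simp [hk], by simp; omega, fun x hx => ?_⟩
    rcases Multiset.mem_cons.1 hx with rfl | hx
    · exact ha
    rcases Multiset.mem_cons.1 hx with rfl | hx
    · omega
    · exact hR x hx⟩
  a q := (q.1.1 + q.1.2.1).choose q.1.1
  b q := (q.1.2.1 + q.1.2.2.1).choose q.1.2.1

theorem isSol_iff {A : Type*} [AddCommGroup A] {k n : ℕ} {c : Multiset ℕ → A} :
    (partRel k n).IsSol (fun s => c s.1) ↔ IsPartitionCocycle k n c :=
  ⟨fun h a b d R ha hb hd hR hk hn => h ⟨⟨a, b, d, R⟩, ha, hb, hd, hR, hk, hn⟩,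
    fun h ⟨⟨a, b, d, R⟩, ha, hb, hd, hR, hk, hn⟩ => h a b d R ha hb hd hR hk hn⟩

section Extend

variable {A : Type*} [Zero A] {k n : ℕ}

open Classical in
/-- The extension by zero of a function on partitions. -/
def extend (c : Parts k n → A) (s : Multiset ℕ) : A := if h : IsParts k n s then c ⟨s, h⟩ else 0

theorem extend_of_isParts (c : Parts k n → A) {s : Multiset ℕ} (h : IsParts k n s) :
    extend c s = c ⟨s, h⟩ := dif_pos h

theorem extend_of_not (c : Parts k n → A) {s : Multiset ℕ} (h : ¬ IsParts k n s) :
    extend c s = 0 := dif_neg h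

theorem extend_coe (c : Parts k n → A) (s : Parts k n) : extend c s.1 = c s :=
  extend_of_isParts c s.2

end Extend

theorem Relations.IsSol.extend {A : Type*} [AddCommGroup A] {k n : ℕ} {c : Parts k n → A}
    (hc : (partRel k n).IsSol c) : IsPartitionCocycle k n (extend c) := by
  rw [← isSol_iff]
  convert hc with s
  exact extend_coe c s

section

variable {A : Type*} [CommRing A]

/-- The symmetric polynomial with given coefficients. -/
def polyOf {k n : ℕ} (c : Parts k n → A) : MvPolynomial (Fin k) A :=
  ∑ s ∈ Finset.finsuppAntidiag Finset.univ n, monomial s (extend c (vals s))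

/-- The coefficients of a symmetric polynomial. -/
def partsOf (k n : ℕ) (f : MvPolynomial (Fin k) A) : Parts k n → A :=
  fun s => coeff (expo (ofVals k s.1)) f

theorem coeff_polyOf {k n : ℕ} (c : Parts k n → A) (v : Fin k → ℕ) :
    coeff (expo v) (polyOf c) = extend c (vals v) := by
  classical
  rw [polyOf, coeff_sum]
  simp only [coeff_monomial]
  rw [Finset.sum_ite_eq']
  split_ifs with h
  · rfl
  · rw [extend_of_not]
    rintro ⟨_, h2, _⟩
    exact h (by simpa [Finset.mem_finsuppAntidiag] using h2)

theorem partsOf_polyOf {k n : ℕ} (c : Parts k n → A) : partsOf k n (polyOf c) = c := by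
  ext s
  rw [partsOf, coeff_polyOf, vals_ofVals s.2.1, extend_coe]

theorem isHomogeneous_polyOf {k n : ℕ} (c : Parts k n → A) : (polyOf c).IsHomogeneous n := by
  refine IsHomogeneous.sum _ _ _ fun s hs => isHomogeneous_monomial _ ?_
  rw [Finset.mem_finsuppAntidiag] at hs
  rw [Finsupp.degree_eq_sum]
  exact hs.1

variable {m n : ℕ}

theorem isCocycleFun_extend {c : Parts (m + 2) n → A} (hc : (partRel (m + 2) n).IsSol c) :
    IsCocycleFun fun v : Fin (m + 2) → ℕ => extend c (vals v) := by
  apply isCocycleFun_of_edge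
  · intro σ v
    rw [vals_comp_perm]
  · intro v i hi
    refine extend_of_not _ fun h => ?_
    exact (h.2.2 _ (mem_vals.2 ⟨i, hi⟩)).ne' rfl
  · intro a b d R ha hb hd hR
    simp only [vals_cons]
    by_cases hn : a + b + d + (vals R).sum = n
    · refine hc.extend a b d (vals R) ha hb hd ?_ (by simp) hn
      intro x hx
      obtain ⟨i, rfl⟩ := mem_vals.1 hx
      exact hR i
    · rw [extend_of_not, extend_of_not, smul_zero, smul_zero]
      · rintro ⟨_, h2, _⟩
        simp only [Multiset.sum_cons] at h2
        omega
      · rintro ⟨_, h2, _⟩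
        simp only [Multiset.sum_cons] at h2
        omega

theorem polyOf_mem_cocycles {c : Parts (m + 2) n → A} (hc : (partRel (m + 2) n).IsSol c) :
    polyOf c ∈ cocycles (m + 2) A n := by
  rw [mem_cocycles_iff]
  refine ⟨isHomogeneous_polyOf c, ?_⟩
  simp only [coeff_polyOf]
  exact isCocycleFun_extend hc

variable {F : (Fin (m + 2) → ℕ) → A}

theorem IsCocycleFun.isSol (hF : IsCocycleFun F) (n : ℕ) :
    (partRel (m + 2) n).IsSol fun s => F (ofVals _ s.1) := by
  rw [isSol_iff (c := fun s => F (ofVals (m + 2) s))]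
  intro a b d R ha hb hd hR hk hn
  have hR' : R.card = m := by omega
  have key : ∀ x y, F (ofVals (m + 2) (x ::ₘ y ::ₘ R)) =
      F (Fin.cons x (Fin.cons y (ofVals m R) : Fin (m + 1) → ℕ)) := by
    intro x y
    apply hF.eq_of_vals_eq
    rw [vals_ofVals (by simp [hR']), vals_cons, vals_cons, vals_ofVals hR']
  simp only [key]
  exact hF.edge ha hd _

theorem IsCocycleFun.eq_extend (hF : IsCocycleFun F) (hn : 0 < n) {v : Fin (m + 2) → ℕ}
    (hv : ∑ i, v i = n) : F v = extend (fun s : Parts (m + 2) n => F (ofVals _ s.1)) (vals v) := by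
  by_cases h : IsParts (m + 2) n (vals v)
  · rw [extend_of_isParts _ h]
    apply hF.eq_of_vals_eq
    rw [vals_ofVals (by simp)]
  · rw [extend_of_not _ h]
    have h1 : ∃ i, v i = 0 := by
      by_contra hcon
      push Not at hcon
      refine h ⟨by simp, by simpa using hv, fun x hx => ?_⟩
      obtain ⟨i, rfl⟩ := mem_vals.1 hx
      exact Nat.pos_of_ne_zero (hcon i)
    obtain ⟨i, hi⟩ := h1
    obtain ⟨j, -, hj⟩ := Finset.exists_ne_zero_of_sum_ne_zero (hv.trans_ne hn.ne')
    exact hF.eq_zero hi hj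

theorem partsOf_isSol {f : MvPolynomial (Fin (m + 2)) A} (hf : f ∈ cocycles (m + 2) A n) :
    (partRel (m + 2) n).IsSol (partsOf (m + 2) n f) :=
  (mem_cocycles_iff.1 hf).2.isSol n

theorem polyOf_partsOf {f : MvPolynomial (Fin (m + 2)) A} (hn : 0 < n)
    (hf : f ∈ cocycles (m + 2) A n) : polyOf (partsOf (m + 2) n f) = f := by
  obtain ⟨h1, h2⟩ := mem_cocycles_iff.1 hf
  ext s
  rw [← expo_coe s, coeff_polyOf]
  by_cases hs : ∑ i, s i = n
  · exact (h2.eq_extend hn hs).symm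
  · rw [h1.coeff_eq_zero (by rwa [sum_eq_degree]), extend_of_not]
    rintro ⟨_, h, _⟩
    exact hs h

end

theorem factProd_vals {N : ℕ} (v : Fin N → ℕ) : factProd (vals v) = ∏ i, (v i).factorial := by
  simp only [factProd, vals, Multiset.map_map]
  rfl

/-- Toggling a fixed element outside `S` pairs the supersets of `S` with opposite signs. -/
theorem sum_neg_one_pow_card_superset {α : Type*} [Fintype α] [DecidableEq α] {S : Finset α}
    (hS : S ≠ Finset.univ) : ∑ I : Finset α, (if S ⊆ I then (-1 : ℤ) ^ I.card else 0) = 0 := by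
  obtain ⟨i, hi⟩ : ∃ i, i ∉ S := by
    by_contra hcon
    push Not at hcon
    exact hS (Finset.eq_univ_of_forall hcon)
  refine Finset.sum_involution (fun I _ => if i ∈ I then I.erase i else insert i I) ?_ ?_ ?_ ?_
  · intro I _
    by_cases hI : i ∈ I
    · have h1 : S ⊆ I.erase i ↔ S ⊆ I :=
        ⟨fun h => h.trans (Finset.erase_subset _ _), fun h x hx =>
          Finset.mem_erase.2 ⟨fun hxi => hi (hxi ▸ hx), h hx⟩⟩
      simp only [hI, if_true, h1]
      split_ifs
      · rw [← Finset.card_erase_add_one hI, pow_succ]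
        ring
      · rfl
    · have h1 : S ⊆ insert i I ↔ S ⊆ I := Finset.subset_insert_iff_of_notMem hi
      simp only [hI, if_false, h1]
      split_ifs
      · rw [Finset.card_insert_of_notMem hI, pow_succ]
        ring
      · rfl
  · intro I _ _ h
    by_cases hI : i ∈ I
    · simp only [hI, if_true] at h
      rw [← h] at hI
      simp at hI
    · simp only [hI, if_false] at h
      rw [← h] at hI
      simp at hI
  · simp
  · intro I _
    by_cases hI : i ∈ I
    · simp [hI]
    · simp [hI]

/-! ### The integral cocycle `ζ` and its coefficients -/

section Zeta

variable {k n : ℕ}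

-- Inclusion–exclusion: a subset `I` contributes a signed multinomial coefficient when it contains
-- the support of `v`, and the signs cancel unless the support is everything. Since `n > 0`, the
-- support is nonempty and omitting `I = ∅` changes nothing.
open Classical in
theorem coeff_zetaRaw (hn : 0 < n) (v : Fin k → ℕ) :
    coeff (expo v) (zetaRaw k n) * factProd (vals v) =
      if IsParts k n (vals v) then (-1) ^ k * (n.factorial : ℤ) else 0 := by
  have hterm : ∀ I : Finset (Fin k), coeff (expo v) ((-1) ^ I.card *
      (∑ i ∈ I, X i : MvPolynomial (Fin k) ℤ) ^ n) * factProd (vals v) =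
      if ∑ i, v i = n then
        (n.factorial : ℤ) * (if (expo v).support ⊆ I then (-1 : ℤ) ^ I.card else 0) else 0 := by
    intro I
    have h1 : (∑ i ∈ I, X i : MvPolynomial (Fin k) ℤ) =
        ∑ i, (if i ∈ I then (1 : ℤ) else 0) • X i := by
      simp [ite_smul]
    have h2 : ((-1 : MvPolynomial (Fin k) ℤ)) ^ I.card = C ((-1) ^ I.card) := by simp
    rw [h1, h2, coeff_C_mul, coeff_linearCombination_X_pow_of_fintype,
      Finsupp.sum_fintype _ _ (by simp), Finsupp.prod_fintype _ _ (by simp)]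
    simp only [Finsupp.coe_equivFunOnFinite_symm]
    by_cases hv : ∑ i, v i = n
    swap
    · simp [hv]
    simp only [if_pos hv]
    by_cases hI : (expo v).support ⊆ I
    · rw [if_pos hI]
      have h3 : ∏ i, (if i ∈ I then (1 : ℤ) else 0) ^ v i = 1 := by
        refine Finset.prod_eq_one fun i _ => ?_
        split_ifs with hi
        · simp
        · have : v i = 0 := by
            by_contra h
            exact hi (hI (by simpa using h))
          simp [this]
      have h4 := Nat.multinomial_spec Finset.univ v
      rw [hv] at h4
      rw [h3, factProd_vals, ← h4,
        Finsupp.multinomial_eq_of_support_subset (Finset.subset_univ _)]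
      push_cast
      simp only [Finsupp.coe_equivFunOnFinite_symm, hv, if_true]
      ring
    · rw [if_neg hI]
      rw [Finset.not_subset] at hI
      obtain ⟨i, hi, hiI⟩ := hI
      rw [Finset.prod_eq_zero (Finset.mem_univ i)]
      · simp
      · rw [if_neg hiI, zero_pow]
        simpa using hi
  rw [zetaRaw, coeff_sum, Finset.sum_mul, Finset.sum_congr rfl fun I _ => hterm I]
  by_cases hv : ∑ i, v i = n
  · simp only [if_pos hv]
    rw [← Finset.mul_sum]
    have hS0 : ((expo v).support).Nonempty := by
      obtain ⟨j, -, hj⟩ := Finset.exists_ne_zero_of_sum_ne_zero (hv.trans_ne hn.ne')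
      exact ⟨j, by simpa using hj⟩
    have hsum : ∑ I ∈ (Finset.univ : Finset (Finset (Fin k))).filter Finset.Nonempty,
        (if (expo v).support ⊆ I then (-1 : ℤ) ^ I.card else 0) =
        ∑ I : Finset (Fin k), (if (expo v).support ⊆ I then (-1 : ℤ) ^ I.card else 0) := by
      refine Finset.sum_subset (Finset.filter_subset _ _) fun I _ hI => if_neg fun h => hI ?_
      exact Finset.mem_filter.2 ⟨Finset.mem_univ _, hS0.mono h⟩
    rw [hsum]
    by_cases hS : (expo v).support = Finset.univ
    · rw [if_pos, hS, Finset.sum_eq_single Finset.univ]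
      · simp [mul_comm]
      · intro I _ hI
        rw [if_neg]
        intro h
        exact hI (Finset.univ_subset_iff.1 h)
      · simp
      · refine ⟨by simp, hv, fun x hx => ?_⟩
        obtain ⟨i, rfl⟩ := mem_vals.1 hx
        have := Finset.eq_univ_iff_forall.1 hS i
        exact Nat.pos_of_ne_zero (by simpa using this)
    · rw [sum_neg_one_pow_card_superset hS, if_neg, mul_zero]
      intro h
      refine hS (Finset.eq_univ_iff_forall.2 fun i => ?_)
      simpa using (h.2.2 _ (mem_vals.2 ⟨i, rfl⟩)).ne'
  · simp only [if_neg hv]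
    rw [if_neg, Finset.sum_const_zero]
    exact fun h => hv h.2.1

theorem coeff_zeta_mul (s : Fin k →₀ ℕ) :
    coeff s (zeta k n) * coeffGcd (zetaRaw k n) = coeff s (zetaRaw k n) := by
  classical
  rw [zeta, coeff_sum]
  simp only [coeff_monomial]
  rw [Finset.sum_ite_eq']
  split_ifs with h
  · exact Int.ediv_mul_cancel (Finset.gcd_dvd h)
  · rw [notMem_support_iff.1 h, zero_mul]

theorem exists_isParts (hk : 0 < k) (hkn : k ≤ n) : ∃ s, IsParts k n s := by
  obtain ⟨s, hs⟩ := exists_isGrouping hk (X := Multiset.replicate n 1) (by simpa using hkn)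
  have := hs.isParts (fun x hx => by rw [Multiset.eq_of_mem_replicate hx]; exact one_pos)
  exact ⟨s, by simpa using this⟩

/-- The coefficients of the integral cocycle. -/
def zetaParts (k n : ℕ) : Parts k n → ℤ := partsOf k n (zeta k n)

theorem zetaParts_mul (hn : 0 < n) (s : Parts k n) :
    zetaParts k n s * coeffGcd (zetaRaw k n) * factProd s.1 = (-1) ^ k * (n.factorial : ℤ) := by
  rw [zetaParts, partsOf, coeff_zeta_mul]
  have h := coeff_zetaRaw hn (ofVals k s.1)
  rwa [vals_ofVals s.2.1, if_pos s.2] at h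

theorem coeffGcd_ne_zero (hk : 0 < k) (hkn : k ≤ n) : coeffGcd (zetaRaw k n) ≠ 0 := by
  obtain ⟨s, hs⟩ := exists_isParts hk hkn
  intro h0
  have h := zetaParts_mul (by omega) ⟨s, hs⟩
  rw [h0, mul_zero, zero_mul] at h
  have h1 : ((-1 : ℤ)) ^ k ≠ 0 := by simp
  have h2 : (n.factorial : ℤ) ≠ 0 := by exact_mod_cast n.factorial_ne_zero
  exact mul_ne_zero h1 h2 h.symm

theorem zetaParts_mul_factProd (hk : 0 < k) (hkn : k ≤ n) (s t : Parts k n) :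
    zetaParts k n s * factProd s.1 = zetaParts k n t * factProd t.1 := by
  apply mul_right_cancel₀ (coeffGcd_ne_zero hk hkn)
  have h1 := zetaParts_mul (by omega) s
  have h2 := zetaParts_mul (by omega) t
  linear_combination h1 - h2

theorem extend_zetaParts_mul_factProd (hk : 0 < k) (hkn : k ≤ n) (s t : Multiset ℕ)
    (hs : IsParts k n s) (ht : IsParts k n t) :
    extend (zetaParts k n) s * factProd s = extend (zetaParts k n) t * factProd t := by
  rw [extend_of_isParts _ hs, extend_of_isParts _ ht]
  exact zetaParts_mul_factProd hk hkn ⟨s, hs⟩ ⟨t, ht⟩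

/-- `ζ` is rationally a constant multiple of `1 / factProd`, and the factorial products at the two
ends of an edge are in the ratio of the binomial coefficients. -/
theorem zetaParts_isSol (hk : 0 < k) (hkn : k ≤ n) : (partRel k n).IsSol (zetaParts k n) := by
  rintro ⟨⟨a, b, d, R⟩, ha, hb, hd, hR, hk', hn⟩
  set q : (partRel k n).Edge := ⟨⟨a, b, d, R⟩, ha, hb, hd, hR, hk', hn⟩
  have h := zetaParts_mul_factProd hk hkn ((partRel k n).src q) ((partRel k n).tgt q)
  have e1 : factProd ((partRel k n).src q).1 =
      (a + b).choose a * factProd (a ::ₘ b ::ₘ d ::ₘ R) := by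
    change factProd ((a + b) ::ₘ d ::ₘ R) = _
    have := Nat.add_choose_mul_factorial_mul_factorial a b
    simp only [factProd_cons]
    rw [← this, Nat.choose_symm_add]
    ring
  have e2 : factProd ((partRel k n).tgt q).1 =
      (b + d).choose b * factProd (a ::ₘ b ::ₘ d ::ₘ R) := by
    change factProd (a ::ₘ (b + d) ::ₘ R) = _
    have := Nat.add_choose_mul_factorial_mul_factorial b d
    simp only [factProd_cons]
    rw [← this, Nat.choose_symm_add]
    ring
  have h0 : (factProd (a ::ₘ b ::ₘ d ::ₘ R) : ℤ) ≠ 0 := by exact_mod_cast (factProd_pos _).ne'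
  change (a + b).choose a • _ = (b + d).choose b • _
  rw [nsmul_eq_mul, nsmul_eq_mul]
  apply mul_right_cancel₀ h0
  rw [e1, e2] at h
  push_cast at h
  linear_combination h

theorem polyOf_zetaParts (hk : 0 < k) (hkn : k ≤ n) : polyOf (zetaParts k n) = zeta k n := by
  ext s
  rw [← expo_coe s, coeff_polyOf]
  have hd := coeffGcd_ne_zero hk hkn
  have hF : (factProd (vals s) : ℤ) ≠ 0 := by exact_mod_cast (factProd_pos _).ne'
  apply mul_right_cancel₀ (mul_ne_zero hd hF)
  rw [← mul_assoc, ← mul_assoc, coeff_zeta_mul, coeff_zetaRaw (by omega)]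
  split_ifs with h
  · rw [extend_of_isParts _ h]
    exact zetaParts_mul (by omega) ⟨_, h⟩
  · rw [extend_of_not _ h]
    simp

theorem gcd_mem_span {ι : Type*} (s : Finset ι) (f : ι → ℤ) :
    s.gcd f ∈ Ideal.span (f '' s) := by
  classical
  induction s using Finset.induction_on with
  | empty => simp
  | insert i s hi ih =>
    rw [Finset.gcd_insert, Finset.coe_insert, Set.image_insert_eq, ← Int.coe_gcd,
      Int.gcd_eq_gcd_ab]
    refine Ideal.add_mem _ (Ideal.mul_mem_right _ _ (Ideal.subset_span (by simp)))
      (Ideal.mul_mem_right _ _ (Ideal.span_mono (Set.subset_insert _ _) ih))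

/-- Let `J` be the ideal generated by the values of `ζ`. The gcd `d` of the undivided coefficients
is an integral combination of them, hence lies in `d J`; cancelling `d` gives `1 ∈ J`. -/
theorem exists_bezout_zetaParts (hk : 0 < k) (hkn : k ≤ n) :
    ∃ a : Parts k n → ℤ, ∑ s, a s * zetaParts k n s = 1 := by
  have hd := coeffGcd_ne_zero hk hkn
  rw [← Ideal.mem_span_range_iff_exists_fun]
  set J := Ideal.span (Set.range (zetaParts k n)) with hJ
  have hmem : ∀ s, (zeta k n).coeff s ∈ J := by
    intro s
    rw [← polyOf_zetaParts hk hkn, ← expo_coe s, coeff_polyOf]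
    by_cases h : IsParts k n (vals s)
    · rw [extend_of_isParts _ h]
      exact Ideal.subset_span ⟨_, rfl⟩
    · rw [extend_of_not _ h]
      exact Ideal.zero_mem _
  have h1 : coeffGcd (zetaRaw k n) ∈ Ideal.span
      ((fun s => (zetaRaw k n).coeff s) '' (zetaRaw k n).support) := gcd_mem_span _ _
  have hmul := coeff_zeta_mul (k := k) (n := n)
  generalize coeffGcd (zetaRaw k n) = d at h1 hd hmul
  have h2 : Ideal.span ((fun s => (zetaRaw k n).coeff s) '' (zetaRaw k n).support) ≤
      Ideal.span {d} * J := by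
    rw [Ideal.span_le]
    rintro _ ⟨s, _, rfl⟩
    have := hmul s
    rw [mul_comm] at this
    simp only [SetLike.mem_coe]
    rw [← this]
    exact Ideal.mul_mem_mul (Ideal.mem_span_singleton_self d) (hmem s)
  obtain ⟨x, hx, h⟩ := Ideal.mem_span_singleton_mul.1 (h2 h1)
  have : x = 1 := mul_left_cancel₀ hd (h.trans (mul_one _).symm)
  rwa [this] at hx

end Zeta

/-! ### The minors of a cocycle against `ζ` have squarefree order -/

section Minors

variable {k n : ℕ}

theorem exists_zetaParts_not_dvd (hk : 0 < k) (hkn : k ≤ n) (p : ℕ) [hp : Fact p.Prime] :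
    ∃ t : Parts k n, ¬ (p : ℤ) ∣ zetaParts k n t := by
  by_contra hcon
  push Not at hcon
  obtain ⟨a, ha⟩ := exists_bezout_zetaParts hk hkn
  have : (p : ℤ) ∣ 1 := ha ▸ Finset.dvd_sum fun s _ => Dvd.dvd.mul_left (hcon s) _
  exact hp.out.one_lt.ne' (by exact_mod_cast Int.eq_one_of_dvd_one (by positivity) this)

variable {A : Type*} [AddCommGroup A] {c : Parts k n → A}

theorem exists_smul_minor_parts_eq_zero (hk : 2 ≤ k) (hkn : k ≤ n) (p : ℕ) [hp : Fact p.Prime]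
    (hc : (partRel k n).IsSol c) {x t : Parts k n} (ht : ¬ (p : ℤ) ∣ zetaParts k n t) :
    ∃ m : ℕ, ¬ p ∣ m ∧ (p * m) • (zetaParts k n t • c x - zetaParts k n x • c t) = 0 ∧
      ((p : ℤ) ∣ zetaParts k n x ∨ k = 2 ∨ n < p →
        m • (zetaParts k n t • c x - zetaParts k n x • c t) = 0) := by
  have := exists_smul_minor_eq_zero (p := p) hk hc.extend
    (extend_zetaParts_mul_factProd (by omega) hkn) x.2 t.2 (by rwa [extend_coe])
  simpa only [extend_coe] using this

/-- Compare both points with a `t` at which `z = ζ` is prime to `p`: `z t` times the minor at `x, y`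
equals `z y` times the minor at `x, t` minus `z x` times the minor at `y, t`. -/
theorem exists_smul_minor_eq_zero' (hk : 2 ≤ k) (hkn : k ≤ n) (p : ℕ) [hp : Fact p.Prime]
    (hc : (partRel k n).IsSol c) (x y : Parts k n) :
    ∃ m : ℕ, ¬ p ∣ m ∧ (p * m) • (zetaParts k n y • c x - zetaParts k n x • c y) = 0 ∧
      (k = 2 ∨ n < p → m • (zetaParts k n y • c x - zetaParts k n x • c y) = 0) := by
  obtain ⟨t, ht⟩ := exists_zetaParts_not_dvd (by omega) hkn p
  obtain ⟨m₁, h1, h2, h3⟩ := exists_smul_minor_parts_eq_zero hk hkn p hc (x := x) ht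
  obtain ⟨m₂, h4, h5, h6⟩ := exists_smul_minor_parts_eq_zero hk hkn p hc (x := y) ht
  set z := zetaParts k n
  have key : ∀ q : ℕ, (q * m₁) • (z t • c x - z x • c t) = 0 →
      (q * m₂) • (z t • c y - z y • c t) = 0 →
      (q * (m₁ * m₂ * (z t).natAbs)) • (z y • c x - z x • c y) = 0 := by
    intro q hq1 hq2
    have e : z t • (z y • c x - z x • c y) =
        z y • (z t • c x - z x • c t) - z x • (z t • c y - z y • c t) := by
      simp only [smul_sub, smul_smul]
      rw [mul_comm (z t) (z y), mul_comm (z t) (z x), mul_comm (z y) (z x)]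
      abel
    have h7 : (q * (m₁ * m₂)) • (z y • (z t • c x - z x • c t) -
        z x • (z t • c y - z y • c t)) = 0 := by
      rw [smul_sub, smul_comm _ (z y), smul_comm _ (z x)]
      have e1 : q * (m₁ * m₂) = m₂ * (q * m₁) := by ring
      have e2 : q * (m₁ * m₂) = m₁ * (q * m₂) := by ring
      rw [e1, mul_smul, hq1, ← e1, e2, mul_smul m₁, hq2]
      simp
    rw [← e] at h7
    rw [← mul_assoc, mul_smul, ← natCast_zsmul _ (z t).natAbs]
    rcases Int.natAbs_eq (z t) with h | h
    · rw [← h]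
      exact h7
    · rw [show (((z t).natAbs : ℕ) : ℤ) = - z t by omega, neg_smul, smul_neg, h7, neg_zero]
  refine ⟨m₁ * m₂ * (z t).natAbs, ?_, key p h2 h5, fun h => ?_⟩
  · intro h
    rcases hp.out.dvd_mul.1 h with h | h
    · rcases hp.out.dvd_mul.1 h with h | h
      · exact h1 h
      · exact h4 h
    · exact ht (Int.natCast_dvd.2 h)
  · have := key 1 (by rw [one_mul]; exact h3 (Or.inr h)) (by rw [one_mul]; exact h6 (Or.inr h))
    rwa [one_mul] at this

/-- If `p` divides `ζ(x)`, the minor against a point `t` with `ζ(t)` prime to `p` reduces to `ζ(t)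
f(x)`, and it is killed by an integer prime to `p`. This is the support hypothesis on which the
component argument rests. -/
theorem eq_zero_of_zetaParts_eq_zero (hk : 2 ≤ k) (hkn : k ≤ n) (p : ℕ) [hp : Fact p.Prime]
    {f : Parts k n → ZMod p} (hf : (partRel k n).IsSol f) {x : Parts k n}
    (hx : (zetaParts k n x : ZMod p) = 0) : f x = 0 := by
  obtain ⟨t, ht⟩ := exists_zetaParts_not_dvd (by omega) hkn p
  obtain ⟨m, h1, -, h3⟩ := exists_smul_minor_parts_eq_zero hk hkn p hf (x := x) ht
  have h4 := h3 (Or.inl ((ZMod.intCast_zmod_eq_zero_iff_dvd _ _).1 hx))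
  simp only [nsmul_eq_mul, zsmul_eq_mul, hx, zero_mul, sub_zero, mul_eq_zero] at h4
  rcases h4 with h | h | h
  · exact absurd ((ZMod.natCast_eq_zero_iff _ _).1 h) h1
  · exact absurd ((ZMod.intCast_zmod_eq_zero_iff_dvd _ _).1 h) ht
  · exact h

/-- The primes up to `n`. -/
def primesUpTo (n : ℕ) : Finset Nat.Primes := (Finset.range (n + 1)).subtype Nat.Prime

theorem mem_primesUpTo {p : Nat.Primes} : p ∈ primesUpTo n ↔ (p : ℕ) ≤ n := by
  exact Finset.mem_subtype.trans (Finset.mem_range.trans Nat.lt_succ_iff)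

/-- The additive order of the minor is examined one prime at a time: `p ^ 2` never divides it, and
`p` divides it only if `p ≤ n`. -/
theorem prod_primes_smul_minor_eq_zero (hk : 2 ≤ k) (hkn : k ≤ n) (hc : (partRel k n).IsSol c)
    (x y : Parts k n) : (∏ p ∈ primesUpTo n, ((p : ℕ) : ℤ)) •
      (zetaParts k n y • c x - zetaParts k n x • c y) = 0 := by
  rw [← Nat.cast_prod, natCast_zsmul, ← addOrderOf_dvd_iff_nsmul_eq_zero,
    Nat.dvd_iff_prime_pow_dvd_dvd]
  intro p e hp hpe
  have _ : Fact p.Prime := ⟨hp⟩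
  obtain ⟨m, h1, h2, h3⟩ := exists_smul_minor_eq_zero' hk hkn p hc x y
  have h4 := hpe.trans (addOrderOf_dvd_iff_nsmul_eq_zero.2 h2)
  rcases e with _ | _ | e
  · simp
  · rw [zero_add, pow_one] at hpe ⊢
    have hpn : p ≤ n := by
      by_contra hpn
      exact h1 (hpe.trans (addOrderOf_dvd_iff_nsmul_eq_zero.2 (h3 (Or.inr (by omega)))))
    exact Finset.dvd_prod_of_mem (fun p : Nat.Primes => (p : ℕ))
      (mem_primesUpTo.2 hpn : (⟨p, hp⟩ : Nat.Primes) ∈ _)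
  · rw [pow_succ', pow_succ'] at h4
    exact absurd ((Dvd.intro _ rfl).trans ((Nat.mul_dvd_mul_iff_left hp.pos).1 h4)) h1

end Minors

/-! ### Coefficients of the monomial symmetric polynomials -/

section MonomialBasis

variable {k n : ℕ} {K : Type*} [CommRing K]

/-- A partition with `k` parts as a partition of `n`. -/
def Parts.toPartition (s : Parts k n) : n.Partition := ⟨s.1, fun {x} hx => s.2.2.2 x hx, s.2.2.1⟩

theorem Parts.toPartition_injective : Function.Injective (Parts.toPartition (k := k) (n := n)) :=
  fun _ _ h => Subtype.ext (congrArg Nat.Partition.parts h)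

theorem prod_map_X_eq_monomial {σ : Type*} [DecidableEq σ] (a : Multiset σ) :
    (a.map X).prod = (monomial (Multiset.toFinsupp a) 1 : MvPolynomial σ K) := by
  induction a using Multiset.induction with
  | empty => simp
  | cons i a ih =>
    rw [Multiset.map_cons, Multiset.prod_cons, ih, ← Multiset.singleton_add, map_add,
      Multiset.toFinsupp_singleton, X, monomial_mul, one_mul]

theorem parts_ofSym (a : Sym (Fin k) n) : (Nat.Partition.ofSym a).parts =
    (vals fun i => a.1.count i).filter (· ≠ 0) := by
  simp only [Nat.Partition.ofSym, vals, Multiset.filter_map, Function.comp_def]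
  congr 1
  rw [← Multiset.toFinset_val]
  have : a.1.toFinset = Finset.univ.filter fun i => a.1.count i ≠ 0 := by
    ext i
    simp
  rw [this]
  rfl

theorem sum_filter_ne_zero (s : Multiset ℕ) : (s.filter (· ≠ 0)).sum = s.sum := by
  induction s using Multiset.induction with
  | empty => simp
  | cons a s ih =>
    by_cases h : a = 0
    · rw [Multiset.filter_cons_of_neg _ (by simpa using h), ih, h, Multiset.sum_cons, zero_add]
    · simp [h, ih]

open Classical in
theorem coeff_msymm (μ : n.Partition) (v : Fin k → ℕ) :
    coeff (expo v) (msymm (Fin k) K μ) =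
      if (vals v).filter (· ≠ 0) = μ.parts then 1 else 0 := by
  rw [msymm, coeff_sum]
  simp only [prod_map_X_eq_monomial, coeff_monomial]
  have hiff : ∀ a : Multiset (Fin k), Multiset.toFinsupp a = expo v ↔
      (fun i => a.count i) = v := by
    intro a
    rw [Finsupp.ext_iff, funext_iff]
    simp
  split_ifs with h
  · have hsum : (Multiset.toFinsupp.symm (expo v)).card = n := by
      rw [← μ.parts_sum, ← h]
      rw [sum_filter_ne_zero]
      simp [Finsupp.sum_fintype]
    let a : Sym (Fin k) n := ⟨Multiset.toFinsupp.symm (expo v), hsum⟩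
    have ha : Multiset.toFinsupp a.1 = expo v := by simp [a]
    have hμ : Nat.Partition.ofSym a = μ := by
      ext1
      rw [parts_ofSym, (hiff _).1 ha, h]
    rw [Finset.sum_eq_single ⟨a, hμ⟩]
    · rw [if_pos ha]
    · rintro ⟨b, hb⟩ _ hne
      rw [if_neg]
      intro hb'
      apply hne
      apply Subtype.ext
      apply Subtype.ext
      exact Multiset.toFinsupp.injective (hb'.trans ha.symm)
    · simp
  · refine Finset.sum_eq_zero ?_
    rintro ⟨a, rfl⟩ _
    rw [if_neg]
    intro ha
    apply h
    rw [parts_ofSym, (hiff _).1 ha]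

theorem coeff_msymm_toPartition (s : Parts k n) (v : Fin k → ℕ) :
    coeff (expo v) (msymm (Fin k) K s.toPartition) = extend (Pi.single s 1) (vals v) := by
  classical
  rw [coeff_msymm]
  have hs : s.toPartition.parts = s.1 := rfl
  rw [hs]
  by_cases h : IsParts k n (vals v)
  · rw [extend_of_isParts _ h, Multiset.filter_eq_self.2 fun x hx => (h.2.2 x hx).ne',
      Pi.single_apply]
    simp [Subtype.ext_iff]
  · rw [extend_of_not _ h, if_neg]
    intro hv
    apply h
    have : (vals v).filter (· ≠ 0) = vals v :=
      Multiset.eq_of_le_of_card_le (Multiset.filter_le _ _) (by rw [hv, s.2.1, card_vals])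
    rw [← this, hv]
    exact s.2

end MonomialBasis

/-! ### Indecomposability for polynomials and for functions on partitions -/

section Transfer

variable (k n : ℕ) (K : Type*) [CommRing K]

/-- `partsOf` as a linear map. -/
def partsOfₗ : MvPolynomial (Fin k) K →ₗ[K] (Parts k n → K) where
  toFun := partsOf k n
  map_add' f g := by ext; simp [partsOf]
  map_smul' c f := by ext; simp [partsOf]

/-- `polyOf` as a linear map. -/
def polyOfₗ : (Parts k n → K) →ₗ[K] MvPolynomial (Fin k) K where
  toFun := polyOf
  map_add' f g := by
    ext s
    rw [← expo_coe s, coeff_add, coeff_polyOf, coeff_polyOf, coeff_polyOf]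
    by_cases h : IsParts k n (vals s)
    · simp [extend_of_isParts _ h]
    · simp [extend_of_not _ h]
  map_smul' c f := by
    ext s
    rw [← expo_coe s, RingHom.id_apply, coeff_smul, coeff_polyOf, coeff_polyOf]
    by_cases h : IsParts k n (vals s)
    · simp [extend_of_isParts _ h]
    · simp [extend_of_not _ h]

variable {k n K} {m : ℕ}

theorem polyOf_eq_sum (c : Parts k n → K) :
    polyOf c = ∑ s, c s • msymm (Fin k) K s.toPartition := by
  classical
  ext s
  rw [← expo_coe s, coeff_polyOf, coeff_sum]
  simp only [coeff_smul, coeff_msymm_toPartition]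
  by_cases h : IsParts k n (vals s)
  · simp [extend_of_isParts _ h, Pi.single_apply]
  · simp [extend_of_not _ h]

theorem polyOf_mem_monomialSpan {c : Parts k n → K} {S : Set n.Partition}
    (h : ∀ s : Parts k n, s.toPartition ∉ S → c s = 0) : polyOf c ∈ monomialSpan k n K S := by
  rw [polyOf_eq_sum]
  refine Submodule.sum_mem _ fun s _ => ?_
  by_cases hs : s.toPartition ∈ S
  · exact Submodule.smul_mem _ _ (Submodule.subset_span ⟨_, hs, rfl⟩)
  · rw [h s hs, zero_smul]
    exact Submodule.zero_mem _

theorem partsOf_eq_zero_of_mem_monomialSpan {f : MvPolynomial (Fin k) K} {S : Set n.Partition}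
    (hf : f ∈ monomialSpan k n K S) {s : Parts k n} (hs : s.toPartition ∉ S) :
    partsOf k n f s = 0 := by
  classical
  have : monomialSpan k n K S ≤ LinearMap.ker ((LinearMap.proj s).comp (partsOfₗ k n K)) := by
    rw [monomialSpan, Submodule.span_le]
    rintro _ ⟨μ, hμ, rfl⟩
    rw [SetLike.mem_coe, LinearMap.mem_ker]
    change coeff (expo (ofVals k s.1)) (msymm (Fin k) K μ) = 0
    rw [coeff_msymm, vals_ofVals s.2.1, Multiset.filter_eq_self.2 fun x hx => (s.2.2.2 x hx).ne',
      if_neg]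
    intro h
    apply hs
    convert hμ
    ext1
    exact h
  exact this hf

/-- Cocycles of positive degree involve only partitions with exactly `k` parts, so complementary
sets of partitions of `n` restrict to complementary sets of `Parts`. Conversely, the image of `S`
and its complement serve as the two halves. -/
theorem isIndecomposable_iff (hn : 0 < n) {f : MvPolynomial (Fin (m + 2)) K}
    (hf : f ∈ cocycles (m + 2) K n) :
    IsIndecomposable (m + 2) n f ↔ (partRel (m + 2) n).IsIndecomposable (partsOf (m + 2) n f) := by
  have zero : ∀ {g : MvPolynomial (Fin (m + 2)) K}, g ∈ cocycles (m + 2) K n →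
      g ≠ 0 → partsOf (m + 2) n g ≠ 0 := by
    intro g hg hg0 h
    apply hg0
    rw [← polyOf_partsOf hn hg, h]
    exact map_zero (polyOfₗ _ _ _)
  have zero' : ∀ {c : Parts (m + 2) n → K}, c ≠ 0 → polyOf c ≠ 0 := by
    intro c hc h
    apply hc
    rw [← partsOf_polyOf c, h]
    exact map_zero (partsOfₗ _ _ _)
  constructor
  · rintro ⟨-, h0, h⟩
    refine ⟨partsOf_isSol hf, zero hf h0, ?_⟩
    rintro ⟨S, f₁, f₂, h₁, h₂, h₁0, h₂0, hS₁, hS₂, hadd⟩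
    refine h ⟨Parts.toPartition '' S, polyOf f₁, polyOf f₂, polyOf_mem_cocycles h₁,
      polyOf_mem_cocycles h₂, zero' h₁0, zero' h₂0,
      polyOf_mem_monomialSpan fun s hs => hS₁ s fun h => hs ⟨s, h, rfl⟩,
      polyOf_mem_monomialSpan fun s hs => ?_, ?_⟩
    · rw [Set.notMem_compl_iff] at hs
      obtain ⟨t, ht, hts⟩ := hs
      rw [← Parts.toPartition_injective hts]
      exact hS₂ t ht
    · rw [← polyOf_partsOf hn hf, ← hadd]
      exact (map_add (polyOfₗ _ _ _) _ _).symm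
  · rintro ⟨-, h0, h⟩
    refine ⟨hf, ?_, ?_⟩
    · rintro rfl
      exact h0 (map_zero (partsOfₗ _ _ _))
    · rintro ⟨S, f₁, f₂, h₁, h₂, h₁0, h₂0, hS₁, hS₂, hadd⟩
      refine h ⟨Parts.toPartition ⁻¹' S, partsOf _ _ f₁, partsOf _ _ f₂, partsOf_isSol h₁,
        partsOf_isSol h₂, zero h₁ h₁0, zero h₂ h₂0,
        fun s hs => partsOf_eq_zero_of_mem_monomialSpan hS₁ hs,
        fun s hs => partsOf_eq_zero_of_mem_monomialSpan hS₂ (by simpa using hs), ?_⟩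
      rw [← hadd]
      exact (map_add (partsOfₗ _ _ _) _ _).symm

theorem map_partsOf_cocycles :
    (cocycles (m + 2) K n).map (partsOfₗ (m + 2) n K) = (partRel (m + 2) n).sol K := by
  apply le_antisymm
  · rintro _ ⟨f, hf, rfl⟩
    exact partsOf_isSol hf
  · intro c hc
    exact ⟨polyOf c, polyOf_mem_cocycles hc, partsOf_polyOf c⟩

theorem map_polyOf_sol (hn : 0 < n) :
    ((partRel (m + 2) n).sol K).map (polyOfₗ (m + 2) n K) = cocycles (m + 2) K n := by
  apply le_antisymm
  · rintro _ ⟨f, hf, rfl⟩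
    exact polyOf_mem_cocycles hf
  · intro f hf
    exact ⟨partsOf _ _ f, partsOf_isSol hf, polyOf_partsOf hn hf⟩

theorem isIndecomposableBasis_partsOf (hn : 0 < n) {ι : Type*}
    {β : ι → MvPolynomial (Fin (m + 2)) K} (hβ : IsIndecomposableBasis (m + 2) n β) :
    (partRel (m + 2) n).IsIndecomposableBasis fun i => partsOf (m + 2) n (β i) := by
  refine ⟨fun i => ?_, fun f hf => ?_, ?_, ?_⟩
  · exact (isIndecomposable_iff hn (hβ.indecomposable i).1).1 (hβ.indecomposable i)
  · obtain ⟨i, c, h⟩ := hβ.complete (polyOf f)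
      ((isIndecomposable_iff hn (polyOf_mem_cocycles hf.1)).2 (by rwa [partsOf_polyOf]))
    refine ⟨i, c, ?_⟩
    rw [← partsOf_polyOf f, h]
    exact map_smul (partsOfₗ _ _ _) _ _
  · apply LinearIndependent.of_comp (polyOfₗ (m + 2) n K)
    have : (polyOfₗ (m + 2) n K) ∘ (fun i => partsOf (m + 2) n (β i)) = β :=
      funext fun i => polyOf_partsOf hn (hβ.indecomposable i).1
    rw [this]
    exact hβ.linearIndependent
  · rw [← map_partsOf_cocycles, ← hβ.span_eq, Submodule.map_span, ← Set.range_comp]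
    rfl

theorem isIndecomposableBasis_polyOf (hn : 0 < n) {ι : Type*} {γ : ι → Parts (m + 2) n → K}
    (hγ : (partRel (m + 2) n).IsIndecomposableBasis γ) :
    IsIndecomposableBasis (m + 2) n fun i => polyOf (γ i) := by
  refine ⟨fun i => ?_, fun f hf => ?_, ?_, ?_⟩
  · refine (isIndecomposable_iff hn (polyOf_mem_cocycles (hγ.indecomposable i).1)).2 ?_
    rw [partsOf_polyOf]
    exact hγ.indecomposable i
  · obtain ⟨i, c, h⟩ := hγ.complete (partsOf _ _ f) ((isIndecomposable_iff hn hf.1).1 hf)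
    refine ⟨i, c, ?_⟩
    rw [← polyOf_partsOf hn hf.1, h]
    exact map_smul (polyOfₗ _ _ _) _ _
  · apply LinearIndependent.of_comp (partsOfₗ (m + 2) n K)
    have : (partsOfₗ (m + 2) n K) ∘ (fun i => polyOf (γ i)) = γ :=
      funext fun i => partsOf_polyOf _
    rw [this]
    exact hγ.linearIndependent
  · rw [← map_polyOf_sol hn, ← hγ.span_eq, Submodule.map_span, ← Set.range_comp]
    rfl

end Transfer

/-! ### Bases modulo `p` containing `ζ` -/

section Bases

variable {m n : ℕ}

/-- The reduction of `ζ` modulo `p`. -/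
def zetaMod (k n p : ℕ) : Parts k n → ZMod p := fun x => (zetaParts k n x : ZMod p)

theorem zetaMod_mem_sol {k : ℕ} (hk : 0 < k) (hkn : k ≤ n) (p : ℕ) :
    zetaMod k n p ∈ (partRel k n).sol (ZMod p) :=
  (zetaParts_isSol hk hkn).comp (Int.castAddHom (ZMod p))

theorem exists_isIndecomposableBasis_cocycles (hkn : m + 2 ≤ n) (p : ℕ) [hp : Fact p.Prime] :
    ∃ (l : ℕ) (β : Fin (l + 1) → MvPolynomial (Fin (m + 2)) (ZMod p)),
      IsIndecomposableBasis (m + 2) n β := by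
  obtain ⟨l, β, hβ⟩ := Relations.exists_isIndecomposableBasis (r := partRel (m + 2) n)
    (zetaMod_mem_sol (by omega) hkn p) (by
      obtain ⟨t, ht⟩ := exists_zetaParts_not_dvd (k := m + 2) (by omega) hkn p
      intro h
      exact ht ((ZMod.intCast_zmod_eq_zero_iff_dvd _ _).1 (congrFun h t)))
    (fun f hf x hx => eq_zero_of_zetaParts_eq_zero (by omega) hkn p hf hx)
  exact ⟨l, _, isIndecomposableBasis_polyOf (by omega) hβ⟩

variable {l : ℕ} {p : ℕ} {β : Fin (l + 1) → MvPolynomial (Fin (m + 2)) (ZMod p)}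

variable (β) (n) in
/-- The basis of the cocycles obtained by replacing the first member of `β` by `ζ`. -/
def zetaBasis : Fin (l + 1) → Parts (m + 2) n → ZMod p :=
  Fin.cons (zetaMod (m + 2) n p) fun i => partsOf (m + 2) n (β i.succ)

theorem zetaBasis_spec [hp : Fact p.Prime] (hkn : m + 2 ≤ n)
    (hβ : IsIndecomposableBasis (m + 2) n β) :
    LinearIndependent (ZMod p) (zetaBasis n β) ∧
      Submodule.span (ZMod p) (Set.range (zetaBasis n β)) = (partRel (m + 2) n).sol (ZMod p) :=
  (isIndecomposableBasis_partsOf (by omega) hβ).cons_basis (zetaMod_mem_sol (by omega) hkn p)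
    fun f hf x hx => eq_zero_of_zetaParts_eq_zero (by omega) hkn p hf hx

/-- In these cases all minors over `𝔽_p` vanish, so every solution is a multiple of `ζ`; a second
basis member would be proportional to `ζ`. -/
theorem eq_zero_of_isIndecomposableBasis [hp : Fact p.Prime] (hkn : m + 2 ≤ n)
    (hβ : IsIndecomposableBasis (m + 2) n β) (h : m = 0 ∨ n < p) : l = 0 := by
  by_contra hl
  obtain ⟨hli, hspan⟩ := zetaBasis_spec hkn hβ
  let j : Fin (l + 1) := Fin.succ ⟨0, Nat.pos_of_ne_zero hl⟩
  have hj : zetaBasis n β j ∈ (partRel (m + 2) n).sol (ZMod p) :=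
    hspan ▸ Submodule.subset_span ⟨j, rfl⟩
  obtain ⟨t, ht⟩ := exists_zetaParts_not_dvd (k := m + 2) (by omega) hkn p
  have hpair : LinearIndependent (ZMod p) ![zetaBasis n β 0, zetaBasis n β j] := by
    have := hli.comp ![0, j] (by
      intro a b hab
      fin_cases a <;> fin_cases b <;> simp_all [j, Fin.ext_iff])
    convert this using 1
    ext i : 1
    fin_cases i <;> rfl
  have := (LinearIndependent.pair_iff.1 hpair (zetaBasis n β j t)
    (-(zetaParts (m + 2) n t : ZMod p))
    (by
      ext x
      obtain ⟨q, hq, -, hq0⟩ := exists_smul_minor_eq_zero' (k := m + 2) (by omega) hkn p hj x t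
      have h1 := hq0 (by omega)
      rw [nsmul_eq_mul, mul_eq_zero, ZMod.natCast_eq_zero_iff] at h1
      have h2 := h1.resolve_left hq
      simp only [zsmul_eq_mul] at h2
      change zetaBasis n β j t * (zetaParts (m + 2) n x : ZMod p) +
        -(zetaParts (m + 2) n t : ZMod p) * zetaBasis n β j x = 0
      linear_combination -h2)).2
  rw [neg_eq_zero, ZMod.intCast_zmod_eq_zero_iff_dvd] at this
  exact ht this

end Bases

/-! ### Universality of `L_k^n` in a fixed degree -/

section Universal

variable {m n : ℕ} {A B : Type*} [CommRing A] [CommRing B]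

theorem map_polyOf {k : ℕ} (φ : A →+* B) (c : Parts k n → A) :
    map φ (polyOf c) = polyOf (φ ∘ c) := by
  ext s
  rw [← expo_coe s, coeff_map, coeff_polyOf, coeff_polyOf]
  by_cases h : IsParts k n (vals s)
  · simp [extend_of_isParts _ h]
  · simp [extend_of_not _ h]

theorem coeff_torsionMul {σ : Type*} {p : ℕ} (c : A) (f : MvPolynomial σ (ZMod p)) (s : σ →₀ ℕ) :
    coeff s (torsionMul c f) = (coeff s f).val • c := by
  classical
  rw [torsionMul, coeff_sum]
  simp only [coeff_monomial]
  rw [Finset.sum_ite_eq']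
  split_ifs with h
  · rfl
  · rw [notMem_support_iff.1 h, ZMod.val_zero, zero_smul]

theorem Relations.IsSol.val_smul {Λ : Type*} {r : Relations Λ} {p : ℕ} [NeZero p] {f : Λ → ZMod p}
    (hf : r.IsSol f) {c : A} (hc : p • c = 0) : r.IsSol fun x => (f x).val • c := by
  intro e
  have h := hf e
  rw [smul_smul, smul_smul]
  have h1 : ((r.a e * (f (r.src e)).val : ℕ) : ZMod p) =
      ((r.b e * (f (r.tgt e)).val : ℕ) : ZMod p) := by
    simpa using h
  rw [ZMod.natCast_eq_natCast_iff] at h1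
  have key : ∀ q : ℕ, q • c = (q % p) • c := by
    intro q
    conv_lhs => rw [← Nat.mod_add_div q p, add_smul, mul_comm p, mul_smul, hc, smul_zero, add_zero]
  rw [key, h1, ← key]

variable {l : Nat.Primes → ℕ}
  {β : ∀ p : Nat.Primes, Fin (l p + 1) → MvPolynomial (Fin (m + 2)) (ZMod p)}

variable (β) in
/-- The coefficients of the universal cocycle. -/
def univParts (n : ℕ) [Fintype (Σ p : Nat.Primes, Fin (l p))] (b : A)
    (c : (Σ p : Nat.Primes, Fin (l p)) → A) (x : Parts (m + 2) n) : A :=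
  zetaParts (m + 2) n x • b + ∑ j, (zetaBasis n (β j.1) j.2.succ x).val • c j

theorem finite_sigma (hkn : m + 2 ≤ n) (hβ : ∀ p, IsIndecomposableBasis (m + 2) n (β p)) :
    Finite (Σ p : Nat.Primes, Fin (l p)) := by
  refine Finite.of_injective (β := Σ p : primesUpTo n, Fin (l p.1)) (fun j => ⟨⟨j.1, ?_⟩, j.2⟩) ?_
  · obtain ⟨p, i⟩ := j
    have _ : Fact (p : ℕ).Prime := ⟨p.2⟩
    rw [mem_primesUpTo]
    by_contra h
    change ¬ (p : ℕ) ≤ n at h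
    have := eq_zero_of_isIndecomposableBasis hkn (hβ p) (Or.inr (by omega))
    exact (this ▸ i : Fin 0).elim0
  · rintro ⟨p, i⟩ ⟨q, j⟩ h
    simp only [Sigma.mk.injEq, Subtype.mk.injEq] at h
    obtain ⟨rfl, h⟩ := h
    rw [eq_of_heq h]

variable [Fintype (Σ p : Nat.Primes, Fin (l p))]

theorem univCocycle_eq_polyOf (hkn : m + 2 ≤ n)
    (hβ : ∀ p, IsIndecomposableBasis (m + 2) n (β p)) :
    univCocycle (m + 2) n l β =
      polyOf (univParts β n (DegreeRing.b l) (DegreeRing.c l)) := by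
  ext s
  rw [← expo_coe s, univCocycle, finsum_eq_sum_of_fintype, coeff_add, coeff_C_mul, coeff_map,
    coeff_sum, coeff_polyOf, ← polyOf_zetaParts (by omega) hkn, coeff_polyOf]
  have h1 : ∀ j : Σ p : Nat.Primes, Fin (l p),
      coeff (expo s) (torsionMul (DegreeRing.c l j) (β j.1 j.2.succ)) =
        (extend (partsOf (m + 2) n (β j.1 j.2.succ)) (vals s)).val • DegreeRing.c l j := by
    intro j
    rw [coeff_torsionMul, ← coeff_polyOf, polyOf_partsOf (by omega) ((hβ _).indecomposable _).1]
  rw [Finset.sum_congr rfl fun j _ => h1 j]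
  by_cases h : IsParts (m + 2) n (vals s)
  · simp only [extend_of_isParts _ h, univParts, zetaBasis, Fin.cons_succ, zsmul_eq_mul]
    rw [mul_comm]
    rfl
  · simp [extend_of_not _ h]

theorem comp_univParts (φ : A →+* B) (b : A) (c : (Σ p : Nat.Primes, Fin (l p)) → A) :
    φ ∘ univParts β n b c = univParts β n (φ b) (φ ∘ c) := by
  ext x
  simp [univParts]

theorem univParts_isSol (hkn : m + 2 ≤ n) (hβ : ∀ p, IsIndecomposableBasis (m + 2) n (β p))
    (b : A) {c : (Σ p : Nat.Primes, Fin (l p)) → A} (hc : ∀ j, (j.1 : ℕ) • c j = 0) :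
    (partRel (m + 2) n).IsSol (univParts β n b c) := by
  have h1 : (fun x => zetaParts (m + 2) n x • b) ∈ (partRel (m + 2) n).sol A :=
    (zetaParts_isSol (by omega) hkn).comp ((zmultiplesHom A) b)
  have h2 : ∀ j : Σ p : Nat.Primes, Fin (l p),
      (fun x => (zetaBasis n (β j.1) j.2.succ x).val • c j) ∈ (partRel (m + 2) n).sol A := by
    rintro ⟨p, i⟩
    have _ : NeZero (p : ℕ) := ⟨p.2.ne_zero⟩
    exact Relations.IsSol.val_smul (partsOf_isSol ((hβ p).indecomposable i.succ).1) (hc ⟨p, i⟩)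
  have h3 := Submodule.add_mem _ h1 (Submodule.sum_mem _ fun j (_ : j ∈ Finset.univ) => h2 j)
  have e : univParts β n b c = (fun x => zetaParts (m + 2) n x • b) +
      ∑ j, fun x => (zetaBasis n (β j.1) j.2.succ x).val • c j := by
    ext x
    simp [univParts]
  exact e ▸ h3

/-- A homomorphism out of `DegreeRing l` amounts to an element `b` and elements `τ j` killed by the
corresponding primes. These are exactly the data that decompose a cocycle, so existence and
uniqueness of the decomposition give those of the homomorphism. -/
theorem isUniversalCocycle_univCocycle (hkn : m + 2 ≤ n)
    (hβ : ∀ p, IsIndecomposableBasis (m + 2) n (β p)) :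
    IsUniversalCocycle.{u} (m + 2) n (DegreeRing l) (univCocycle (m + 2) n l β) := by
  have hl : ∀ p ∉ primesUpTo n, l p = 0 := by
    intro p hp
    have _ : Fact (p : ℕ).Prime := ⟨p.2⟩
    rw [mem_primesUpTo] at hp
    exact eq_zero_of_isIndecomposableBasis hkn (hβ p) (Or.inr (by omega))
  have hspec : ∀ p : Nat.Primes, LinearIndependent (ZMod p) (zetaBasis n (β p)) ∧
      Submodule.span (ZMod p) (Set.range (zetaBasis n (β p))) =
        (partRel (m + 2) n).sol (ZMod p) := by
    intro p
    have _ : Fact (p : ℕ).Prime := ⟨p.2⟩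
    exact zetaBasis_spec hkn (hβ p)
  obtain ⟨a, ha⟩ := exists_bezout_zetaParts (k := m + 2) (by omega) hkn
  rw [univCocycle_eq_polyOf hkn hβ]
  refine ⟨polyOf_mem_cocycles (univParts_isSol hkn hβ _ DegreeRing.prime_smul_c), ?_⟩
  intro A _ g hg
  obtain ⟨b, τ, hτ, h⟩ := Relations.exists_decomposition (zetaParts_isSol (by omega) hkn) ha hl
    (γ := fun p => zetaBasis n (β p)) (fun _ _ => rfl) (fun p => (hspec p).1)
    (fun p => (hspec p).2) (partsOf_isSol hg)
    (prod_primes_smul_minor_eq_zero (by omega) hkn (partsOf_isSol hg))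
  obtain ⟨φ, hφb, hφc⟩ := DegreeRing.exists_hom b τ hτ
  refine ⟨φ, ?_, ?_⟩
  · simp only
    rw [map_polyOf, comp_univParts, hφb, ← polyOf_partsOf (by omega) hg]
    congr 1
    ext x
    rw [h x, univParts]
    simp only [Function.comp_apply, hφc]
  · intro ψ hψ
    simp only [map_polyOf, comp_univParts] at hψ
    have h1 := congrArg (partsOf (m + 2) n) hψ
    rw [partsOf_polyOf] at h1
    have hψτ : ∀ j : Σ p : Nat.Primes, Fin (l p), (j.1 : ℕ) • ψ (DegreeRing.c l j) = 0 := by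
      intro j
      rw [← map_nsmul, DegreeRing.prime_smul_c, map_zero]
    have := Relations.decomposition_unique ha hl (γ := fun p => zetaBasis n (β p))
      (fun _ _ => rfl) (fun p => (hspec p).1) (b := ψ (DegreeRing.b l) - b)
      (τ := fun j => ψ (DegreeRing.c l j) - τ j)
      (fun j => by rw [smul_sub, hψτ, hτ, sub_zero]) (fun x => by
        have h2 := congrFun h1 x
        rw [h x, univParts] at h2
        simp only [smul_sub, Finset.sum_sub_distrib]
        simp only [Function.comp_apply] at h2
        rw [sub_add_sub_comm, h2, sub_self])
    refine DegreeRing.hom_ext ?_ fun j => ?_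
    · rw [hφb, sub_eq_zero.1 this.1]
    · rw [hφc, sub_eq_zero.1 (congrFun this.2 j)]

end Universal

/-! ### Power series cocycles, degree by degree -/

section Series

variable {m : ℕ} {A : Type*} [CommRing A]

theorem coeff_subst_face (f : MvPowerSeries (Fin (m + 2)) A) (i : Fin 4) (a b d : ℕ)
    (R : Fin m → ℕ) :
    MvPowerSeries.coeff (expo (Fin.cons a (Fin.cons b (Fin.cons d R : Fin (m + 1) → ℕ) :
      Fin (m + 2) → ℕ) : Fin (m + 3) → ℕ)) (MvPowerSeries.subst
        (fun j => (face (m + 2) A i j : MvPowerSeries (Fin (m + 3)) A)) f) =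
      MvPowerSeries.coeff (expo (faceSource i a b d R)) f * faceWeight i a b d := by
  have hsubst : MvPowerSeries.HasSubst
      fun j => (face (m + 2) A i j : MvPowerSeries (Fin (m + 3)) A) := by
    apply MvPowerSeries.hasSubst_of_constantCoeff_zero
    intro j
    rw [← MvPowerSeries.coeff_zero_eq_constantCoeff_apply, MvPolynomial.coeff_coe,
      ← constantCoeff_eq]
    fin_cases i <;> simp only [face] <;> (try split_ifs) <;> simp
  rw [MvPowerSeries.coeff_subst hsubst]
  have h : ∀ s : Fin (m + 2) →₀ ℕ, (s.prod fun j e =>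
      (face (m + 2) A i j : MvPowerSeries (Fin (m + 3)) A) ^ e) =
      ((∏ j, face (m + 2) A i j ^ s j : MvPolynomial (Fin (m + 3)) A) :
        MvPowerSeries (Fin (m + 3)) A) := by
    intro s
    rw [Finsupp.prod_fintype _ _ (by simp), ← coeToMvPowerSeries.ringHom_apply, map_prod]
    simp
  simp only [h, MvPolynomial.coeff_coe, coeff_face_prod]
  rw [finsum_eq_single _ (expo (faceSource i a b d R))]
  · simp
  · intro s hs
    rw [if_neg hs, smul_zero]

theorem coeff_renameEquiv {N : ℕ} (f : MvPowerSeries (Fin N) A) (σ : Equiv.Perm (Fin N))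
    (v : Fin N → ℕ) : MvPowerSeries.coeff (expo v) (MvPowerSeries.renameEquiv A σ f) =
      MvPowerSeries.coeff (expo (v ∘ σ)) f := by
  have h : expo v = Finsupp.embDomain σ.toEmbedding (expo (v ∘ σ)) := by
    ext i
    obtain ⟨j, rfl⟩ := σ.surjective i
    rw [← Equiv.toEmbedding_apply, Finsupp.embDomain_apply_self]
    simp
  rw [h]
  exact MvPowerSeries.coeff_embDomain_rename σ.toEmbedding f (expo (v ∘ σ))

theorem isSeriesCocycle_iff {f : MvPowerSeries (Fin (m + 2)) A} :
    IsSeriesCocycle (m + 2) A f ↔ MvPowerSeries.constantCoeff f = 0 ∧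
      IsCocycleFun fun v => MvPowerSeries.coeff (expo v) f := by
  have hdefect : ∀ a b d R, MvPowerSeries.coeff (expo (Fin.cons a (Fin.cons b
      (Fin.cons d R : Fin (m + 1) → ℕ) : Fin (m + 2) → ℕ) : Fin (m + 3) → ℕ))
      (∑ i : Fin 4, ((-1 : A) ^ (i : ℕ)) • MvPowerSeries.subst
        (fun j => (face (m + 2) A i j : MvPowerSeries (Fin (m + 3)) A)) f) =
      defect (fun v => MvPowerSeries.coeff (expo v) f) a b d R := by
    intro a b d R
    rw [map_sum, defect]
    refine Finset.sum_congr rfl fun i _ => ?_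
    rw [MvPowerSeries.coeff_smul, coeff_subst_face]
  constructor
  · rintro ⟨h0, hs, hc⟩
    refine ⟨h0, fun σ v => ?_, fun a b d R => ?_⟩
    · rw [← coeff_renameEquiv, hs]
    · rw [← hdefect, hc, map_zero]
  · rintro ⟨h0, hs, hc⟩
    refine ⟨h0, fun σ => ?_, ?_⟩
    · ext s
      rw [← expo_coe s, coeff_renameEquiv, hs]
    · ext e
      obtain ⟨a, b, d, R, rfl⟩ := exists_cons_cons_cons e
      rw [hdefect, hc, map_zero]

theorem map_mem_cocycles {n : ℕ} (hn : 0 < n) {B : Type*} [CommRing B] (φ : A →+* B)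
    {f : MvPolynomial (Fin (m + 2)) A} (hf : f ∈ cocycles (m + 2) A n) :
    map φ f ∈ cocycles (m + 2) B n := by
  rw [← polyOf_partsOf hn hf, map_polyOf]
  exact polyOf_mem_cocycles ((partsOf_isSol hf).comp φ.toAddMonoidHom)

/-- Symmetry and the cocycle condition each relate only exponents of one total degree. -/
theorem isCocycleFun_of_degreewise {F : (Fin (m + 2) → ℕ) → A}
    (h : ∀ n, ∃ G : (Fin (m + 2) → ℕ) → A, IsCocycleFun G ∧ ∀ v, ∑ i, v i = n → F v = G v) :
    IsCocycleFun F := by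
  refine ⟨fun σ v => ?_, fun a b d R => ?_⟩
  · obtain ⟨G, hG, hFG⟩ := h (∑ i, v i)
    rw [hFG v rfl, hFG (v ∘ σ) (Equiv.sum_comp σ v), hG.symm]
  · obtain ⟨G, hG, hFG⟩ := h (a + b + d + ∑ i, R i)
    rw [← hG.defect_eq a b d R, defect, defect]
    refine Finset.sum_congr rfl fun i _ => ?_
    -- The outer faces drop `a` or `d` from the degree, but have nonzero weight only when the
    -- dropped exponent is zero.
    by_cases hw : faceWeight i a b d = 0
    · simp [hw]
    · rw [hFG]
      fin_cases i <;> simp_all [faceSource, faceWeight, Fin.sum_univ_succ] <;> omega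

variable {l : {n : ℕ // m + 2 ≤ n} → Nat.Primes → ℕ}
  {v : ∀ n : {n : ℕ // m + 2 ≤ n}, MvPolynomial (Fin (m + 2)) (DegreeRing (l n))}

theorem coeff_univSeries {s : Fin (m + 2) →₀ ℕ} {n : {n : ℕ // m + 2 ≤ n}} (h : s.degree = n) :
    MvPowerSeries.coeff s (univSeries (m + 2) l v) =
      RingTensor.of (fun n : {n : ℕ // m + 2 ≤ n} => DegreeRing (l n)) n ((v n).coeff s) := by
  obtain ⟨n, hn⟩ := n
  subst h
  exact dif_pos hn

theorem coeff_univSeries_eq_zero {s : Fin (m + 2) →₀ ℕ} (h : ¬ m + 2 ≤ s.degree) :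
    MvPowerSeries.coeff s (univSeries (m + 2) l v) = 0 := dif_neg h

theorem isSeriesCocycle_univSeries
    (hv : ∀ n : {n : ℕ // m + 2 ≤ n}, v n ∈ cocycles (m + 2) (DegreeRing (l n)) n) :
    IsSeriesCocycle (m + 2) (LazardRing (m + 2) l) (univSeries (m + 2) l v) := by
  rw [isSeriesCocycle_iff]
  constructor
  · rw [← MvPowerSeries.coeff_zero_eq_constantCoeff_apply, coeff_univSeries_eq_zero (by simp)]
  · refine isCocycleFun_of_degreewise fun n => ?_
    by_cases hn : m + 2 ≤ n
    · refine ⟨_, (mem_cocycles_iff.1 (map_mem_cocycles (n := n) (by omega) (RingTensor.of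
        (fun n : {n : ℕ // m + 2 ≤ n} => DegreeRing (l n)) ⟨n, hn⟩) (hv ⟨n, hn⟩))).2,
        fun w hw => ?_⟩
      rw [coeff_map]
      exact coeff_univSeries ((sum_eq_degree w).trans hw)
    · refine ⟨fun _ => 0, ⟨fun _ _ => rfl, fun a b d R => by simp [defect]⟩, fun w hw => ?_⟩
      exact coeff_univSeries_eq_zero (by rwa [sum_eq_degree, hw])

/-- The homogeneous component `c n` of `g` is a cocycle and determines the homomorphism on the
factor of degree `n`; these homomorphisms glue uniquely over the tensor product. -/
theorem isUniversalSeriesCocycle_univSeries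
    (hv : ∀ n : {n : ℕ // m + 2 ≤ n}, IsUniversalCocycle.{u} (m + 2) n (DegreeRing (l n)) (v n)) :
    IsUniversalSeriesCocycle.{u} (m + 2) (LazardRing (m + 2) l) (univSeries (m + 2) l v) := by
  refine ⟨isSeriesCocycle_univSeries fun n => (hv n).1, fun A _ g hg => ?_⟩
  obtain ⟨hg0, hgF⟩ := isSeriesCocycle_iff.1 hg
  let c (n : ℕ) : MvPolynomial (Fin (m + 2)) A := polyOf (n := n) fun s =>
    MvPowerSeries.coeff (expo (ofVals (m + 2) s.1)) g
  have hc : ∀ n, c n ∈ cocycles (m + 2) A n := fun n => polyOf_mem_cocycles (hgF.isSol n)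
  have hcoeff : ∀ s : Fin (m + 2) →₀ ℕ, 0 < s.degree →
      MvPowerSeries.coeff s g = coeff s (c s.degree) := by
    intro s hs
    have := hgF.eq_extend hs (v := s) (by rw [← sum_eq_degree, expo_coe])
    rw [expo_coe] at this
    rw [this, ← coeff_polyOf, expo_coe]
  choose φ hφ hφu using fun n => (hv n).2 A (c n) (hc n)
  simp only at hφ hφu
  refine ⟨RingTensor.lift φ, ?_, fun ψ hψ => ?_⟩
  · ext s
    rw [MvPowerSeries.coeff_map]
    by_cases hs : m + 2 ≤ s.degree
    · rw [coeff_univSeries (n := ⟨s.degree, hs⟩) rfl, RingTensor.lift_of, ← coeff_map, hφ,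
        hcoeff s (by omega)]
    · rw [coeff_univSeries_eq_zero hs, map_zero]
      rcases Nat.eq_zero_or_pos s.degree with h | h
      · rw [(Finsupp.degree_eq_zero_iff s).1 h, MvPowerSeries.coeff_zero_eq_constantCoeff_apply,
          hg0]
      -- In degrees strictly between `0` and `k` a cocycle vanishes, as there are no partitions into
      -- `k` positive parts.
      · rw [hcoeff s h, ← expo_coe s, coeff_polyOf, extend_of_not]
        rintro ⟨h1, h2, h3⟩
        apply hs
        have := Multiset.card_nsmul_le_sum (a := 1) h3
        rw [h1, h2] at this
        simpa [expo_coe] using this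
  · apply RingTensor.hom_ext
    intro n a
    rw [RingTensor.lift_of, ← RingHom.comp_apply]
    congr 1
    apply hφu
    ext s
    by_cases hs : s.degree = n
    · have := congrArg (MvPowerSeries.coeff s) hψ
      simp only [MvPowerSeries.coeff_map] at this
      rw [coeff_univSeries hs] at this
      rw [coeff_map, RingHom.comp_apply, this, hcoeff s (by have := n.2; omega), hs]
    · have h0 : ∀ {B : Type _} [CommRing B] {f : MvPolynomial (Fin (m + 2)) B},
          f ∈ cocycles (m + 2) B n → coeff s f = 0 := fun hf =>
        (mem_cocycles_iff.1 hf).1.coeff_eq_zero hs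
      rw [h0 (hc n), coeff_map, (mem_cocycles_iff.1 (hv n).1).1.coeff_eq_zero hs, map_zero]

end Series

/-! ### Without torsion factors `L_k` is a polynomial ring -/

section TwoVariables

variable {k : ℕ} {l : {n : ℕ // k ≤ n} → Nat.Primes → ℕ}

theorem exists_ringEquiv_of_eq_zero (hl : ∀ n p, l n p = 0) :
    ∃ e : LazardRing k l ≃+* MvPolynomial {n : ℕ // k ≤ n} ℤ,
      ∀ n, e (RingTensor.of (fun n => DegreeRing (l n)) n (DegreeRing.b (l n))) = X n := by
  have hempty : ∀ n, (Σ p : Nat.Primes, Fin (l n p)) → False := fun n j =>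
    (hl n j.1 ▸ j.2 : Fin 0).elim0
  choose φ hφ _ using fun n => DegreeRing.exists_hom (l := l n)
    (X n : MvPolynomial {n : ℕ // k ≤ n} ℤ) (fun _ => 0) fun _ => smul_zero _
  let ψ : MvPolynomial {n : ℕ // k ≤ n} ℤ →+* LazardRing k l :=
    eval₂Hom (Int.castRingHom _) fun n =>
      RingTensor.of (fun n => DegreeRing (l n)) n (DegreeRing.b (l n))
  have hψ : ∀ n, ψ (X n) = RingTensor.of (fun n => DegreeRing (l n)) n (DegreeRing.b (l n)) :=
    fun n => eval₂Hom_X' _ _ _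
  have hlift : ∀ n, RingTensor.lift φ (RingTensor.of (fun n => DegreeRing (l n)) n
      (DegreeRing.b (l n))) = X n := fun n => by rw [RingTensor.lift_of, hφ]
  refine ⟨RingEquiv.ofRingHom (RingTensor.lift φ) ψ ?_ ?_, hlift⟩
  · refine MvPolynomial.ringHom_ext (fun a => by simp) fun n => ?_
    rw [RingHom.comp_apply, hψ, hlift, RingHom.id_apply]
  · apply RingTensor.hom_ext
    intro n a
    rw [← RingHom.comp_apply, ← RingHom.comp_apply (RingHom.id _)]
    congr 1
    refine DegreeRing.hom_ext ?_ fun j => (hempty n j).elim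
    rw [RingHom.comp_apply, RingHom.comp_apply, RingHom.comp_apply, hlift, hψ, RingHom.id_apply]

end TwoVariables

end Cocycle

end

theorem mainTheorem5 (k : ℕ) (hk : 2 ≤ k) :
    -- indecomposable bases exist (and are finite and non-empty) for all `n ≥ k` and all primes
    (∀ (n : {n : ℕ // k ≤ n}) (p : Nat.Primes),
      ∃ (m : ℕ) (β : Fin (m + 1) → MvPolynomial (Fin k) (ZMod p)),
        Cocycle.IsIndecomposableBasis k n β) ∧
    -- for any choice of such bases, listed as `β n p 0, …, β n p (l n p)`
    ∀ (l : {n : ℕ // k ≤ n} → Nat.Primes → ℕ)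
      (β : ∀ (n : {n : ℕ // k ≤ n}) (p : Nat.Primes),
        Fin (l n p + 1) → MvPolynomial (Fin k) (ZMod p)),
      (∀ (n : {n : ℕ // k ≤ n}) (p : Nat.Primes),
        Cocycle.IsIndecomposableBasis k n (β n p)) →
      -- there are finitely many torsion factors in each degree
      (∀ n, Finite (Σ p : Nat.Primes, Fin (l n p))) ∧
      -- `L_k^n` represents cocycles of degree `n`
      (∀ n : {n : ℕ // k ≤ n}, Cocycle.IsUniversalCocycle.{u} k n (Cocycle.DegreeRing (l n))
        (Cocycle.univCocycle k n (l n) (β n))) ∧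
      -- `L_k` represents cocycles of all degrees
      Cocycle.IsUniversalSeriesCocycle.{u} k (Cocycle.LazardRing k l)
        (Cocycle.univSeries k l fun n => Cocycle.univCocycle k n (l n) (β n)) ∧
      -- for `k = 2` there is no torsion factor and `L_2 = ℤ[b_2, b_3, …]`
      (k = 2 → (∀ n p, l n p = 0) ∧
        ∃ e : Cocycle.LazardRing k l ≃+* MvPolynomial {n : ℕ // k ≤ n} ℤ,
          ∀ n, e (Cocycle.RingTensor.of (fun n => Cocycle.DegreeRing (l n)) n
            (Cocycle.DegreeRing.b (l n))) = MvPolynomial.X n) := by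
  obtain ⟨m, rfl⟩ : ∃ m, k = m + 2 := ⟨k - 2, by omega⟩
  refine ⟨fun n p => ?_, fun l β hβ => ?_⟩
  · have _ : Fact (p : ℕ).Prime := ⟨p.2⟩
    exact Cocycle.exists_isIndecomposableBasis_cocycles n.2 p
  have hfin : ∀ n, Finite (Σ p : Nat.Primes, Fin (l n p)) := fun n =>
    Cocycle.finite_sigma n.2 (hβ n)
  have huniv : ∀ n : {n : ℕ // m + 2 ≤ n}, Cocycle.IsUniversalCocycle.{u} (m + 2) n
      (Cocycle.DegreeRing (l n)) (Cocycle.univCocycle (m + 2) n (l n) (β n)) := by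
    intro n
    have _ := Fintype.ofFinite (Σ p : Nat.Primes, Fin (l n p))
    exact Cocycle.isUniversalCocycle_univCocycle n.2 (hβ n)
  refine ⟨hfin, huniv, Cocycle.isUniversalSeriesCocycle_univSeries huniv, fun h2 => ?_⟩
  have hl : ∀ n p, l n p = 0 := by
    intro n p
    have _ : Fact (p : ℕ).Prime := ⟨p.2⟩
    exact Cocycle.eq_zero_of_isIndecomposableBasis n.2 (hβ n p) (Or.inl (by omega))
  exact ⟨hl, Cocycle.exists_ringEquiv_of_eq_zero hl⟩
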